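/- **Model.** A tandem of two single-server FIFO queues Q1, Q2, empty at time $0$. Jobs arrive at Q1 at the points of a Poisson process $E$ of rate $r$; job $i\ge 1$ needs the same service $V_i\ge 0$ at Q1 and then at Q2, where $V_1,V_2,\dots$ are i.i.d. and independent of $E$. Thus, with $I(t)=\sup_{s\le t}\big[\sum_{i\le E(s)}V_i-s\big]^-$, the workload of Q1 is $W_1(t)=\sum_{i\le E(t)}V_i-t+I(t)$, the departure process of Q1 is $D(t)=\max\{k\ge0:\sum_{i\le k}V_i\le t-I(t)\}$, and the workload $W_2$ of Q2 is defined like $W_1$ with $D$ in place of $E$. For $k\ge1$ let $R_k=W_2(t_k+W_1(t_k))$, where $t_k$ is the arrival time at Q1 of the last job of the $k$th busy period of Q1 (so $R_k$ is the workload of Q2 when that job arrives there, the job included), and let $R_0=0$. Let $m$ be the distribution function of the largest service time of a job in a busy period of Q1 and $\bar m=1-m$. **Assumptions.** $1<\nu<2$, and $\bar F(x)=P(V_1>x)$ is regularly varying at infinity with parameter $-\nu$ (so $E V_1<\infty$); $E V_1>0$; $\lambda=1/E V_1$. For $n\ge1$ the $n$th system has the service times $V_i$ (the same for all $n$) and Poisson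 arrivals of rate $\lambda^{(n)}>0$; its quantities carry the superscript $(n)$. The sequence $\lambda^{(n)}$ is nondecreasing with limit $\lambda$, and, with $\rho^{(n)}=\lambda^{(n)}E V_1$, $\ (1-\rho^{(n)})/(n\bar F(n))\to\gamma\ge0$. **Theorem.** For each $y>0$ the equation $$\frac{-1}{\Gamma(1-\nu)}E\big[e^{-\lambda \kappa T_\nu}\big]-\kappa\gamma y^{\nu-1}\frac{-1}{\Gamma(1-\nu)}=(\lambda\kappa)^\nu,\qquad P(T_\nu>u)=u^{-\nu}\ (u\ge1),$$ has exactly one solution $\kappa=\kappa(y)>0$, and $\kappa(y)/y$ is integrable over $[x,x+t/\lambda]$ for all $x>0$, $t\ge0$. For each $t\ge0$ there is a random variable $Z_t\ge0$ with $$P(Z_t\le x)=\exp\Big(-\lambda\int_x^{x+t/\lambda}\frac{\kappa(y)}{y}\,dy\Big)\qquad(x>0),$$ $P(Z_t=0)=0$ if $t>0$, and $Z_0=0$, and $$X_n(t)=\tfrac1n R^{(n)}_{[nt]}\ \Rightarrow\ Z_t\qquad(n\to\infty).$$ If $\gamma=0$, then $\kappa$ is constant and $P(Z_t\le x)=\big(1+\frac{t}{x\lambda}\big)^{-\lambda\kappa}$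 for $t\ge0$, $x>0$. If $\gamma>0$, then $\rho^{(n)}<1$ for all large $n$; for every $x>0$ and every $n\ge1$ with $\rho^{(n)}<1$ the scaled steady-state distribution function $$\lim_{k\to\infty}P\big(\tfrac1nR^{(n)}_k\le x\big)=m^{(n)}(nx)\exp\Big(-\lambda^{(n)}\int_x^\infty n\bar m^{(n)}(ns)\,ds\Big)$$ exists, with a finite integral; and for every $x>0$ $$\lim_{t\to\infty}P(Z_t\le x)=\exp\Big(-\lambda\int_x^\infty\frac{\kappa(y)}{y}\,dy\Big)=\lim_{n\to\infty}m^{(n)}(nx)\exp\Big(-\lambda^{(n)}\int_x^\infty n\bar m^{(n)}(ns)\,ds\Big),$$ with a finite integral in the middle. So the limits $t\to\infty$ and $n\to\infty$ can be interchanged. -/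

import Mathlib

open MeasureTheory ProbabilityTheory Filter Set Topology

namespace TandemQueue

noncomputable section

/-! ### Sample paths of the tandem queue

`a j` is the time between the arrivals (to the first queue Q1) of jobs `j - 1` and `j` (for `j = 0`,
between time zero and the first arrival), and `v j` is the service requirement of job `j`, which
is the same at both servers.  Jobs are numbered `0, 1, 2, …`.  The system is empty at time zero. -/

/-- The arrival time of job `j` at Q1. -/
def arrivalTime (a : ℕ → ℝ) (j : ℕ) : ℝ := ∑ i ∈ Finset.range (j + 1), a i

/-- The exogenous arrival process: the number `E(t)` of jobs that arrive at Q1 in `[0, t]`. -/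
def arrivals (a : ℕ → ℝ) (t : ℝ) : ℕ := {j : ℕ | arrivalTime a j ≤ t}.ncard

/-- The total service requirement of the first `k` jobs. -/
def work (v : ℕ → ℝ) (k : ℕ) : ℝ := ∑ i ∈ Finset.range k, v i

/-- The cumulative idle time up to time `t` of a work-conserving server with arrival counting
process `N`: the supremum over `s ∈ [0, t]` of the negative part of `work v (N s) - s`. -/
def idleTime (N : ℝ → ℕ) (v : ℕ → ℝ) (t : ℝ) : ℝ :=
  sSup ((fun s : ℝ => max 0 (-(work v (N s) - s))) '' Icc 0 t)

/-- The workload at time `t` of a queue with arrival counting process `N`. -/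
def workload (N : ℝ → ℕ) (v : ℕ → ℝ) (t : ℝ) : ℝ := work v (N t) - t + idleTime N v t

/-- The departure process of Q1, which is the arrival process of Q2: the largest `k` such that
the first `k` service requirements add up to at most the busy time `t - I(t)` of the server. -/
def departures (a v : ℕ → ℝ) (t : ℝ) : ℕ :=
  sSup {k : ℕ | work v k ≤ t - idleTime (arrivals a) v t}

/-- The workload `W₁(t)` in the first queue. -/
def workloadOne (a v : ℕ → ℝ) (t : ℝ) : ℝ := workload (arrivals a) v t

/-- The workload `W₂(t)` in the second queue. -/
def workloadTwo (a v : ℕ → ℝ) (t : ℝ) : ℝ := workload (departures a v) v t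

/-- The time at which job `j` leaves Q1 and arrives at Q2: its arrival time plus the workload of Q1
just after its arrival (its own service requirement included). -/
def transferTime (a v : ℕ → ℝ) (j : ℕ) : ℝ :=
  arrivalTime a j + workloadOne a v (arrivalTime a j)

/-- Job `j` is the last job of a busy period of Q1: it leaves Q1 before the next job arrives. -/
def IsLastJob (a v : ℕ → ℝ) (j : ℕ) : Prop := transferTime a v j ≤ arrivalTime a (j + 1)

/-- The last job of the `(k + 1)`-st busy period of Q1. -/
def lastJob (a v : ℕ → ℝ) (k : ℕ) : ℕ := Nat.nth (IsLastJob a v) k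

/-- The embedded workload `R_k`, `k ≥ 1`: the workload in Q2 at the time at which the last job of
the `k`-th busy period of Q1 arrives at Q2 (this job included).  `R_0 = 0`, as the system starts
empty. -/
def embeddedWorkload (a v : ℕ → ℝ) : ℕ → ℝ
  | 0 => 0
  | k + 1 => workloadTwo a v (transferTime a v (lastJob a v k))

/-- The largest service requirement of a job in the first busy period of Q1. -/
def largestJob (a v : ℕ → ℝ) : ℝ :=
  (Finset.range (lastJob a v 0 + 1)).sup' Finset.nonempty_range_add_one v

/-! ### Probabilistic notions -/

/-- `f` is regularly varying at infinity with parameter `r`. -/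
def RegularlyVarying (f : ℝ → ℝ) (r : ℝ) : Prop :=
  ∀ c : ℝ, 0 < c → Tendsto (fun x => f (c * x) / f x) atTop (𝓝 (c ^ r))

/-- The distribution tail `P(X > x)`. -/
def tail {Ω : Type*} [MeasurableSpace Ω] (P : Measure Ω) (X : Ω → ℝ) (x : ℝ) : ℝ :=
  P.real {ω | x < X ω}

/-- `A 0, A 1, …` are the interarrival times of a Poisson process of rate `r`: they are independent
and exponentially distributed with parameter `r`. -/
def IsPoissonArrivals {Ω : Type*} [MeasurableSpace Ω] (P : Measure Ω) (A : ℕ → Ω → ℝ)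
    (r : ℝ) : Prop :=
  (∀ j, HasLaw (A j) (expMeasure r) P) ∧ iIndepFun A P

/-- The random variable `R_k` of the tandem queue with interarrival times `A` and service
requirements `V`. -/
def R {Ω : Type*} (A V : ℕ → Ω → ℝ) (k : ℕ) (ω : Ω) : ℝ :=
  embeddedWorkload (fun j => A j ω) (fun j => V j ω) k

/-- The distribution function `m` of the largest service requirement in a busy period of Q1 (the
busy periods are identically distributed, so the first one is taken). -/
def maxCDF {Ω : Type*} [MeasurableSpace Ω] (P : Measure Ω) (A V : ℕ → Ω → ℝ) (w : ℝ) : ℝ :=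
  P.real {ω | largestJob (fun j => A j ω) (fun j => V j ω) ≤ w}

/-! ### The limit -/

/-- The equation, in the unknown `k`, that determines `κ(y)`; the expectation is over a
Pareto(`ν`) random variable with values in `[1, ∞)`. -/
def KappaEq (lam ν γ y k : ℝ) : Prop :=
  (-1 / Real.Gamma (1 - ν)) * (∫ u, Real.exp (-(lam * k * u)) ∂(paretoMeasure 1 ν))
    - k * γ * y ^ (ν - 1) * (-1 / Real.Gamma (1 - ν)) = (lam * k) ^ ν

/-- The function `κ`: `κ(y)` is the positive solution of its defining equation. -/
def kappa (lam ν γ y : ℝ) : ℝ := sInf {k : ℝ | 0 < k ∧ KappaEq lam ν γ y k}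

/-- The distribution function `x ↦ P(Z_t ≤ x)` of the limit `Z_t`, `t ≥ 0`.  For `x = 0` and
`t > 0`, the integral of `κ(y) / y` over `[0, t / λ]` is infinite, so that the value is `0`. -/
def limitCDF (lam ν γ t x : ℝ) : ℝ :=
  if 0 < x then Real.exp (-(lam * ∫ y in x..(x + t / lam), kappa lam ν γ y / y))
  else if x = 0 ∧ t = 0 then 1
  else 0

end

end TandemQueue

namespace TandemQueue

/-! ### Sample paths: recursions at the arrival epochs -/

/-! A job has the same service time at both servers. So if Q1 is idle for a time i between jobs j
and j + 1, the workload of Q2 at transfer epochs satisfies L_{j+1} = max(L_j - i, v_{j+1}). Inside a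
busy period of Q1 nothing is subtracted and only the largest service time matters. This gives
R_{k+1} = max(R_k - I_k, M_{k+1}), where I_k is the idle period after the k-th busy period and
M_{k+1} is the largest service time of the next one (`Recurrent.embLoad_succ`). By lack of memory
I_k is exponential and independent of R_k, and what follows is a fresh copy of the path. The
distribution functions G_k of R_k therefore satisfy G_{k+1}(x) = m(x) E G_k(x + S) with S
exponential (`IsTandem.measureReal_R_recursion`).

The law m comes from a first step analysis of a busy period with initial workload u. If 1 - q is the
integral of exp(-r q w) over w ≤ x, then exp(-r q u) is the probability that the busy period ends
with all further service times at most x. Since busy periods end almost surely when the load is at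
most 1, this identifies m(x) = 1 - q (`pathLaw_embLoad_zero`).

The recursion has the explicit fixed point m(x) exp(-r ∫_x^∞ (1 - m)) when the tail is integrable.
For finite k, the tail 1 - m is cut off at a level b. The error is controlled by exponentials exp(c
x), which averaging over S multiplies by r / (r - c). After scaling, the error becomes exp(c (x +
t/λ - b)). Taking b slightly above or below x + t/λ, and |c| large with the right sign, pinches
G_{[nt]}(n x) (`tendsto_scaled`).

What remains is the limit κ(y)/y of n (1 - m^{(n)}(n y)). Integration by parts turns the equation
for q into a `balance` equation for k = z q with z = n y. Its left side is monotone in k and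
involves only the ratios F̄(z s)/F̄(z). Potter's bounds and dominated convergence give the limit,
which is the equation of κ by a Gamma integral (`balance_rpow_eq_kappaFun`). Monotonicity makes the
roots converge (`HeavyTraffic.tendsto_mul_one_sub_maxCDF`).

For γ > 0 the bound 1 - m(z) ≤ F̄(z)/(1 - ρ) makes the tails integrable and, with Potter's bounds,
uniformly so after scaling. This gives the steady state and the interchange of limits. -/

/-- The workload of Q1 just after the arrival of job `j`, where `b j` is the time between the arrivals of
jobs `j` and `j + 1`. -/
noncomputable def loadOne (b v : ℕ → ℝ) : ℕ → ℝ
  | 0 => v 0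
  | j + 1 => max (loadOne b v j - b j) 0 + v (j + 1)

/-- The workload of Q2 just after job `j` arrives there. -/
noncomputable def loadTwo (b v : ℕ → ℝ) : ℕ → ℝ
  | 0 => v 0
  | j + 1 => max (loadTwo b v j - max (b j - loadOne b v j) 0) (v (j + 1))

/-- The server of Q1 becomes idle between jobs `j` and `j + 1`. -/
def EndsAt (b v : ℕ → ℝ) (j : ℕ) : Prop := loadOne b v j ≤ b j

/-- Regular sample paths. -/
structure RegularPath (a v : ℕ → ℝ) : Prop where
  pos : ∀ j, 0 < a j
  nonneg : ∀ j, 0 ≤ v j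
  arrival_tendsto : Tendsto (arrivalTime a) atTop atTop
  work_tendsto : Tendsto (work v) atTop atTop

lemma arrivalTime_succ (a : ℕ → ℝ) (j : ℕ) :
    arrivalTime a (j + 1) = arrivalTime a j + a (j + 1) := by
  simp [arrivalTime, Finset.sum_range_succ]

lemma work_succ (v : ℕ → ℝ) (j : ℕ) : work v (j + 1) = work v j + v j := by
  simp [work, Finset.sum_range_succ]

lemma work_zero (v : ℕ → ℝ) : work v 0 = 0 := by simp [work]

lemma work_mono {v : ℕ → ℝ} (hv : ∀ j, 0 ≤ v j) : Monotone (work v) :=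
  monotone_nat_of_le_succ fun j => by rw [work_succ]; linarith [hv j]

lemma work_nonneg {v : ℕ → ℝ} (hv : ∀ j, 0 ≤ v j) (j : ℕ) : 0 ≤ work v j := by
  simpa [work_zero] using work_mono hv (Nat.zero_le j)

lemma bddAbove_idle {N : ℝ → ℕ} {v : ℕ → ℝ} (hv : ∀ j, 0 ≤ v j) {t : ℝ} (ht : 0 ≤ t) :
    BddAbove ((fun s : ℝ => max 0 (-(work v (N s) - s))) '' Icc 0 t) := by
  refine ⟨t, ?_⟩
  rintro _ ⟨s, hs, rfl⟩
  have := work_nonneg hv (N s)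
  exact max_le ht (by linarith [hs.2])

lemma le_idleTime {N : ℝ → ℕ} {v : ℕ → ℝ} (hv : ∀ j, 0 ≤ v j) {s t : ℝ} (hs : 0 ≤ s)
    (hst : s ≤ t) : s - work v (N s) ≤ idleTime N v t := by
  refine le_trans ?_ (le_csSup (bddAbove_idle hv (hs.trans hst)) ⟨s, ⟨hs, hst⟩, rfl⟩)
  exact le_max_of_le_right (by linarith)

lemma idleTime_le {N : ℝ → ℕ} {v : ℕ → ℝ} {t c : ℝ} (ht : 0 ≤ t) (hc : 0 ≤ c)
    (h : ∀ s, 0 ≤ s → s ≤ t → s - work v (N s) ≤ c) : idleTime N v t ≤ c := by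
  refine csSup_le ⟨_, 0, ⟨le_rfl, ht⟩, rfl⟩ ?_
  rintro _ ⟨s, hs, rfl⟩
  exact max_le hc (by linarith [h s hs.1 hs.2])

/-- If the counting process is such that `work v (N s) ≤ c` for `s < t`, then `t - c` is a lower
bound for the idle time at later times. -/
lemma sub_le_idleTime {N : ℝ → ℕ} {v : ℕ → ℝ} (hv : ∀ j, 0 ≤ v j) {s t c : ℝ} (hs : 0 < s)
    (hst : s ≤ t) (h : ∀ r, 0 ≤ r → r < s → work v (N r) ≤ c) : s - c ≤ idleTime N v t := by
  refine le_of_forall_lt fun z hz => ?_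
  -- A jump of `N` at `s` may spoil the value at `s` itself, so the bound is approached from times
  -- just before `s`. The maximum with 0 keeps these times nonnegative.
  obtain ⟨r, hr1, hr2⟩ := exists_between (max_lt (show z + c < s by linarith) hs)
  have hr0 : 0 ≤ r := (le_max_right _ _).trans hr1.le
  have h1 := le_idleTime (N := N) hv hr0 (hr2.le.trans hst)
  have h2 := h r hr0 hr2
  have h3 := (le_max_left _ _).trans_lt hr1
  linarith

namespace RegularPath

variable {a v : ℕ → ℝ}

lemma arrivalTime_strictMono (h : RegularPath a v) : StrictMono (arrivalTime a) :=
  strictMono_nat_of_lt_succ fun j => by rw [arrivalTime_succ]; linarith [h.pos (j + 1)]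

lemma arrivalTime_pos (h : RegularPath a v) (j : ℕ) : 0 < arrivalTime a j :=
  (show 0 < arrivalTime a 0 by simpa [arrivalTime] using h.pos 0).trans_le
    (h.arrivalTime_strictMono.monotone (Nat.zero_le j))

lemma arrivalTime_le_iff (h : RegularPath a v) (t : ℝ) (i : ℕ) :
    arrivalTime a i ≤ t ↔ i < arrivals a t := by
  classical
  have hex : ∃ N, t < arrivalTime a N := (h.arrival_tendsto.eventually_gt_atTop t).exists
  have key : ∀ i, arrivalTime a i ≤ t ↔ i < Nat.find hex := fun i => by
    constructor
    · intro hi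
      by_contra hc
      exact absurd ((Nat.find_spec hex).trans_le
        (h.arrivalTime_strictMono.monotone (not_lt.1 hc))) (not_lt.2 hi)
    · exact fun hi => not_lt.1 (Nat.find_min hex hi)
  have : {j : ℕ | arrivalTime a j ≤ t} = ↑(Finset.range (Nat.find hex)) := by
    ext i; rw [mem_ofPred_eq, key, Finset.coe_range, mem_Iio]
  rw [arrivals, this, Set.ncard_coe_finset, Finset.card_range, key]

lemma arrivals_arrivalTime (h : RegularPath a v) (j : ℕ) :
    arrivals a (arrivalTime a j) = j + 1 := by
  have h1 := (h.arrivalTime_le_iff (arrivalTime a j) j).1 le_rfl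
  have h2 := (h.arrivalTime_le_iff (arrivalTime a j) (j + 1)).not.1
    (not_le.2 (h.arrivalTime_strictMono (Nat.lt_succ_self j)))
  omega

end RegularPath

/-- The idle time of Q1 up to the arrival of job `j`. -/
noncomputable def idleOne (a v : ℕ → ℝ) : ℕ → ℝ
  | 0 => a 0
  | j + 1 => max (idleOne a v j) (arrivalTime a (j + 1) - work v (j + 1))

/-- The idle time of Q2 up to the arrival there of job `j`. -/
noncomputable def idleTwo (a v : ℕ → ℝ) : ℕ → ℝ
  | 0 => work v 1 + idleOne a v 0
  | j + 1 => max (idleTwo a v j) (work v (j + 2) + idleOne a v (j + 1) - work v (j + 1))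

/-- Together with `idleOne_le` this identifies `idleOne` as a running maximum over arrival epochs.
Between arrivals time minus work received increases, so its supremum is approached just before an
arrival. -/
lemma le_idleOne (a v : ℕ → ℝ) {i j : ℕ} (hij : i ≤ j) :
    arrivalTime a i - work v i ≤ idleOne a v j := by
  induction j with
  | zero =>
    obtain rfl : i = 0 := by omega
    simp [idleOne, arrivalTime, work]
  | succ j ih =>
    rcases Nat.lt_or_ge j i with hlt | hge
    · obtain rfl : i = j + 1 := by omega
      exact le_max_right _ _
    · exact (ih hge).trans (le_max_left _ _)

lemma idleOne_le (a v : ℕ → ℝ) {j : ℕ} {c : ℝ}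
    (h : ∀ i ≤ j, arrivalTime a i - work v i ≤ c) : idleOne a v j ≤ c := by
  induction j with
  | zero => simpa [arrivalTime, work, idleOne] using h 0 le_rfl
  | succ j ih => exact max_le (ih fun i hi => h i (by omega)) (h _ le_rfl)

/-- The analogue for Q2: `work v (i + 1) + idleOne a v i` is the time at which job `i` leaves Q1,
just before which Q2 has received only the first `i` service times. -/
lemma le_idleTwo (a v : ℕ → ℝ) {i j : ℕ} (hij : i ≤ j) :
    work v (i + 1) + idleOne a v i - work v i ≤ idleTwo a v j := by
  induction j with
  | zero =>
    obtain rfl : i = 0 := by omega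
    simp [idleTwo, work]
  | succ j ih =>
    rcases Nat.lt_or_ge j i with hlt | hge
    · obtain rfl : i = j + 1 := by omega
      exact le_max_right _ _
    · exact (ih hge).trans (le_max_left _ _)

lemma idleTwo_le (a v : ℕ → ℝ) {j : ℕ} {c : ℝ}
    (h : ∀ i ≤ j, work v (i + 1) + idleOne a v i - work v i ≤ c) : idleTwo a v j ≤ c := by
  induction j with
  | zero => simpa [idleTwo, work] using h 0 le_rfl
  | succ j ih => exact max_le (ih fun i hi => h i (by omega)) (h _ le_rfl)

lemma idleOne_mono (a v : ℕ → ℝ) : Monotone (idleOne a v) :=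
  monotone_nat_of_le_succ fun _ => le_max_left _ _

lemma loadOne_eq (a v : ℕ → ℝ) (j : ℕ) :
    loadOne (fun i => a (i + 1)) v j = work v (j + 1) + idleOne a v j - arrivalTime a j := by
  induction j with
  | zero => simp [loadOne, work, idleOne, arrivalTime]
  | succ j ih =>
    rw [loadOne, ih, idleOne, work_succ v (j + 1), arrivalTime_succ]
    rcases le_total (idleOne a v j) (arrivalTime a j + a (j + 1) - work v (j + 1)) with hl | hl
    · rw [max_eq_right hl, max_eq_right (by linarith)]; ring
    · rw [max_eq_left hl, max_eq_left (by linarith)]; ring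

/-- When job `j` is transferred, the clock shows `work v (j + 1) + idleOne a v j` and Q2 has
received `work v (j + 1)`. The work cancels and only the difference of the idle times remains. -/
lemma loadTwo_eq (a v : ℕ → ℝ) (j : ℕ) :
    loadTwo (fun i => a (i + 1)) v j = idleTwo a v j - idleOne a v j := by
  induction j with
  | zero => simp [loadTwo, idleTwo, work]
  | succ j ih =>
    rw [loadTwo, ih, loadOne_eq, idleTwo, work_succ v (j + 1)]
    have e : max (a (j + 1) - (work v (j + 1) + idleOne a v j - arrivalTime a j)) 0
        = idleOne a v (j + 1) - idleOne a v j := by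
      rw [idleOne, arrivalTime_succ, ← max_sub_sub_right, max_comm, sub_self]
      congr 1; ring
    rw [e, ← max_sub_sub_right]
    congr 1 <;> ring

namespace RegularPath

variable {a v : ℕ → ℝ}

lemma idleOne_pos (h : RegularPath a v) (j : ℕ) : 0 < idleOne a v j :=
  (h.pos 0).trans_le (idleOne_mono a v (Nat.zero_le j))

/-- Either job `j` has arrived by time `s`, and the work received is at least `work v (j + 1)`, or
`s` precedes the next arrival, whose index is at most `j`. -/
lemma sub_work_arrivals_le (h : RegularPath a v) {j : ℕ} {s c : ℝ}
    (hc : idleOne a v j ≤ c) (hs : s - work v (j + 1) ≤ c) :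
    s - work v (arrivals a s) ≤ c := by
  rcases Nat.lt_or_ge j (arrivals a s) with hlt | hge
  · have := work_mono h.nonneg hlt
    simp only [Nat.succ_eq_add_one] at this
    linarith
  · have h1 : s < arrivalTime a (arrivals a s) :=
      not_le.1 ((h.arrivalTime_le_iff s _).not.2 (lt_irrefl _))
    have := le_idleOne a v hge
    linarith

lemma arrivalTime_sub_work_le_idleTime (h : RegularPath a v) {i : ℕ} {t : ℝ}
    (hi : arrivalTime a i ≤ t) : arrivalTime a i - work v i ≤ idleTime (arrivals a) v t :=
  sub_le_idleTime h.nonneg (h.arrivalTime_pos i) hi fun r _ hr =>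
    work_mono h.nonneg (not_lt.1 ((h.arrivalTime_le_iff r i).not.1 (not_le.2 hr)))

lemma idleOne_le_idleTime (h : RegularPath a v) {j : ℕ} {t : ℝ} (ht : arrivalTime a j ≤ t) :
    idleOne a v j ≤ idleTime (arrivals a) v t :=
  idleOne_le a v fun _ hi => h.arrivalTime_sub_work_le_idleTime
    ((h.arrivalTime_strictMono.monotone hi).trans ht)

/-- From the arrival of job `j` until its departure the server has work, so the idle time is frozen,
whether or not further jobs arrive meanwhile. -/
lemma idleTime_eq (h : RegularPath a v) {j : ℕ} {t : ℝ} (ht : arrivalTime a j ≤ t)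
    (ht' : t ≤ work v (j + 1) + idleOne a v j) :
    idleTime (arrivals a) v t = idleOne a v j := by
  refine le_antisymm ?_ (h.idleOne_le_idleTime ht)
  exact idleTime_le ((h.arrivalTime_pos j).le.trans ht) (h.idleOne_pos j).le
    fun s _ hs => h.sub_work_arrivals_le le_rfl (by linarith)

lemma arrivalTime_le_transfer (h : RegularPath a v) (j : ℕ) :
    arrivalTime a j ≤ work v (j + 1) + idleOne a v j := by
  have := le_idleOne a v (le_refl j)
  rw [work_succ]
  linarith [h.nonneg j]

lemma transferTime_eq (h : RegularPath a v) (j : ℕ) :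
    transferTime a v j = work v (j + 1) + idleOne a v j := by
  rw [transferTime, workloadOne, workload, h.idleTime_eq le_rfl (h.arrivalTime_le_transfer j),
    h.arrivals_arrivalTime]
  ring

lemma isLastJob_iff (h : RegularPath a v) (j : ℕ) :
    IsLastJob a v j ↔ EndsAt (fun i => a (i + 1)) v j := by
  rw [IsLastJob, EndsAt, h.transferTime_eq, loadOne_eq, arrivalTime_succ]
  constructor <;> intro <;> linarith

lemma transfer_mono (h : RegularPath a v) :
    Monotone (fun j => work v (j + 1) + idleOne a v j) := fun _ _ hij =>
  add_le_add (work_mono h.nonneg (Nat.succ_le_succ hij)) (idleOne_mono a v hij)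

/-- Jobs with zero service leave together with their predecessor, so the count of departures at a
transfer epoch is not determined by the job. Its work is, and the workload of Q2 sees nothing else.
Divergence of `work v` keeps the supremum from taking its default value. -/
lemma departures_spec (h : RegularPath a v) {s : ℝ} (hs : 0 ≤ s) :
    work v (departures a v s) ≤ s - idleTime (arrivals a) v s ∧
      ∀ k, work v k ≤ s - idleTime (arrivals a) v s → work v k ≤ work v (departures a v s) := by
  have h0 : idleTime (arrivals a) v s ≤ s := idleTime_le hs hs fun r _ hr => by
    linarith [work_nonneg h.nonneg (arrivals a r)]
  have hne : {k : ℕ | work v k ≤ s - idleTime (arrivals a) v s}.Nonempty :=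
    ⟨0, by simp [work_zero, h0]⟩
  have hb : BddAbove {k : ℕ | work v k ≤ s - idleTime (arrivals a) v s} := by
    obtain ⟨N, hN⟩ := (h.work_tendsto.eventually_gt_atTop
      (s - idleTime (arrivals a) v s)).exists
    refine ⟨N, fun k hk => ?_⟩
    by_contra hc
    exact absurd (work_mono h.nonneg (not_le.1 hc).le) (not_le.2 (lt_of_le_of_lt hk hN))
  exact ⟨Nat.sSup_mem hne hb, fun k hk => work_mono h.nonneg (le_csSup hb hk)⟩

lemma work_le_work_departures (h : RegularPath a v) {j : ℕ} {s : ℝ}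
    (hs : work v (j + 1) + idleOne a v j ≤ s) : work v (j + 1) ≤ work v (departures a v s) := by
  have hw := work_nonneg h.nonneg (j + 1)
  have hI := h.idleOne_pos j
  have hs0 : 0 ≤ s := by linarith
  refine (h.departures_spec hs0).2 _ ?_
  have : idleTime (arrivals a) v s ≤ s - work v (j + 1) := idleTime_le hs0 (by linarith)
    fun r _ hr => h.sub_work_arrivals_le (j := j) (by linarith) (by linarith)
  linarith

lemma work_departures_le (h : RegularPath a v) {j : ℕ} {s : ℝ} (hs0 : 0 ≤ s)
    (hs : s < work v (j + 1) + idleOne a v j) : work v (departures a v s) ≤ work v j := by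
  have hd := (h.departures_spec hs0).1
  rcases le_or_gt (arrivalTime a j) s with hj | hj
  · have h1 := h.idleOne_le_idleTime hj
    refine work_mono h.nonneg ?_
    by_contra hc
    have := work_mono h.nonneg (not_le.1 hc)
    simp only [Nat.succ_eq_add_one] at this
    linarith
  -- Job `j` has not even arrived: the busy time is at most the work received, which comes from the
  -- first `j` jobs.
  · have h1 : arrivals a s ≤ j := not_lt.1 ((h.arrivalTime_le_iff s j).not.1 (not_le.2 hj))
    have h2 := le_idleTime (N := arrivals a) h.nonneg hs0 (le_refl s)
    have h3 := work_mono h.nonneg h1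
    linarith

lemma work_departures_transfer (h : RegularPath a v) (j : ℕ) :
    work v (departures a v (work v (j + 1) + idleOne a v j)) = work v (j + 1) := by
  refine le_antisymm ?_ (h.work_le_work_departures le_rfl)
  have hw := work_nonneg h.nonneg (j + 1)
  have hI := h.idleOne_pos j
  have := (h.departures_spec (s := work v (j + 1) + idleOne a v j) (by linarith)).1
  rw [h.idleTime_eq (h.arrivalTime_le_transfer j) le_rfl] at this
  linarith

lemma sub_work_departures_le (h : RegularPath a v) {j : ℕ} {s : ℝ}
    (hs : s ≤ work v (j + 1) + idleOne a v j) :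
    s - work v (departures a v s) ≤ idleTwo a v j := by
  induction j with
  | zero =>
    have := work_nonneg h.nonneg (departures a v s)
    simp only [idleTwo, zero_add] at hs ⊢
    linarith
  | succ j ih =>
    rcases le_total s (work v (j + 1) + idleOne a v j) with hl | hl
    · exact (ih hl).trans (le_max_left _ _)
    · have := h.work_le_work_departures hl
      have := le_idleTwo a v (le_refl (j + 1))
      linarith

lemma idleTime_departures (h : RegularPath a v) (j : ℕ) :
    idleTime (departures a v) v (work v (j + 1) + idleOne a v j) = idleTwo a v j := by
  have hpos : ∀ i, 0 < work v (i + 1) + idleOne a v i := fun i =>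
    add_pos_of_nonneg_of_pos (work_nonneg h.nonneg _) (h.idleOne_pos i)
  refine le_antisymm (idleTime_le (hpos j).le ?_ fun s _ hs => h.sub_work_departures_le hs)
    (idleTwo_le a v fun i hi => sub_le_idleTime h.nonneg (hpos i) (h.transfer_mono hi)
      fun r hr0 hr => h.work_departures_le hr0 hr)
  refine le_trans ?_ (le_idleTwo a v (Nat.zero_le j))
  simpa [work_zero] using (hpos 0).le

lemma workloadTwo_transferTime (h : RegularPath a v) (j : ℕ) :
    workloadTwo a v (transferTime a v j) = loadTwo (fun i => a (i + 1)) v j := by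
  rw [h.transferTime_eq, workloadTwo, workload, h.idleTime_departures,
    h.work_departures_transfer, loadTwo_eq]
  ring

lemma lastJob_eq (h : RegularPath a v) (k : ℕ) :
    lastJob a v k = Nat.nth (EndsAt (fun i => a (i + 1)) v) k := by
  rw [lastJob, show IsLastJob a v = EndsAt (fun i => a (i + 1)) v from
    funext fun j => propext (h.isLastJob_iff j)]

lemma embeddedWorkload_succ (h : RegularPath a v) (k : ℕ) :
    embeddedWorkload a v (k + 1) = loadTwo (fun i => a (i + 1)) v
      (Nat.nth (EndsAt (fun i => a (i + 1)) v) k) := by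
  rw [embeddedWorkload, h.workloadTwo_transferTime, h.lastJob_eq]

end RegularPath

/-- Regeneration: the job after the end of a busy period finds Q1 empty, so Q1 starts afresh with
the shifted path. -/
lemma EndsAt.loadOne_add {b v : ℕ → ℝ} {j : ℕ} (hj : EndsAt b v j) (l : ℕ) :
    loadOne b v (j + 1 + l) =
      loadOne (fun i => b (j + 1 + i)) (fun i => v (j + 1 + i)) l := by
  induction l with
  | zero => simp [loadOne, max_eq_right (sub_nonpos.2 hj)]
  | succ l ih => rw [← add_assoc, loadOne, ih, loadOne]; rfl

lemma EndsAt.endsAt_add_iff {b v : ℕ → ℝ} {j : ℕ} (hj : EndsAt b v j) (l : ℕ) :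
    EndsAt b v (j + 1 + l) ↔ EndsAt (fun i => b (j + 1 + i)) (fun i => v (j + 1 + i)) l := by
  rw [EndsAt, hj.loadOne_add, EndsAt]

/-- Q2 does not regenerate, but within one busy period of Q1 nothing is subtracted. The workload
left over from before therefore only enters through one maximum with the fresh workload. -/
lemma EndsAt.loadTwo_add {b v : ℕ → ℝ} {j : ℕ} (hj : EndsAt b v j) (l : ℕ)
    (hl : ∀ i < l, ¬ EndsAt (fun i => b (j + 1 + i)) (fun i => v (j + 1 + i)) i) :
    loadTwo b v (j + 1 + l) = max (loadTwo b v j - (b j - loadOne b v j))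
      (loadTwo (fun i => b (j + 1 + i)) (fun i => v (j + 1 + i)) l) := by
  induction l with
  | zero => simp [loadTwo, max_eq_left (sub_nonneg.2 hj)]
  | succ l ih =>
    have h1 : ¬ EndsAt (fun i => b (j + 1 + i)) (fun i => v (j + 1 + i)) l :=
      hl l (Nat.lt_succ_self l)
    have h2 : b (j + 1 + l) ≤
      loadOne (fun i => b (j + 1 + i)) (fun i => v (j + 1 + i)) l := (not_le.1 h1).le
    rw [← add_assoc, loadTwo, ih fun i hi => hl i (by omega), hj.loadOne_add, loadTwo,
      max_eq_right (sub_nonpos.2 h2), sub_zero, sub_zero, max_assoc]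
    rfl

/-- Before the end of the first busy period, the second workload is the largest service time. -/
lemma loadTwo_eq_sup' {b v : ℕ → ℝ} {l : ℕ} (hl : ∀ i < l, ¬ EndsAt b v i) :
    loadTwo b v l = (Finset.range (l + 1)).sup' Finset.nonempty_range_add_one v := by
  induction l with
  | zero => simp [loadTwo]
  | succ l ih =>
    have h1 : b l ≤ loadOne b v l := (not_le.1 (hl l (Nat.lt_succ_self l))).le
    rw [loadTwo, ih fun i hi => hl i (by omega), max_eq_right (sub_nonpos.2 h1), sub_zero]
    simp_rw [Finset.range_add_one (n := l + 1)]
    rw [Finset.sup'_insert Finset.nonempty_range_add_one, max_comm]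

lemma loadOne_nonneg {b v : ℕ → ℝ} (hv : ∀ j, 0 ≤ v j) : ∀ j, 0 ≤ loadOne b v j
  | 0 => hv 0
  | _ + 1 => add_nonneg (le_max_right _ _) (hv _)

lemma le_loadTwo (b v : ℕ → ℝ) : ∀ j, v j ≤ loadTwo b v j
  | 0 => le_rfl
  | _ + 1 => le_max_right _ _

/-! ### Independent sequences -/

/-- The first `n` terms of `x` followed by `y`. -/
def splice (n : ℕ) (x y : ℕ → ℝ) : ℕ → ℝ := fun i => if i < n then x i else y (i - n)

/-- `s` followed by `x`. -/
def consSeq (s : ℝ) (x : ℕ → ℝ) : ℕ → ℝ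
  | 0 => s
  | i + 1 => x i

/-- The law of an i.i.d. sequence. -/
noncomputable def seqLaw (μ : Measure ℝ) : Measure (ℕ → ℝ) := Measure.infinitePi fun _ => μ

instance (μ : Measure ℝ) [IsProbabilityMeasure μ] : IsProbabilityMeasure (seqLaw μ) := by
  unfold seqLaw; infer_instance

lemma measurable_splice (n : ℕ) :
    Measurable fun p : (ℕ → ℝ) × (ℕ → ℝ) => splice n p.1 p.2 := by
  refine measurable_pi_lambda _ fun i => ?_
  unfold splice
  split_ifs <;> fun_prop

lemma measurable_consSeq : Measurable fun p : ℝ × (ℕ → ℝ) => consSeq p.1 p.2 := by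
  refine measurable_pi_lambda _ fun i => ?_
  cases i with
  | zero => exact measurable_fst
  | succ i => exact (measurable_pi_apply i).comp measurable_snd

/-- Independence of past and future in the form used below: gluing the first `n` terms of one i.i.d.
sequence to an independent copy does not change the law. -/
lemma measurePreserving_splice (μ : Measure ℝ) [IsProbabilityMeasure μ] (n : ℕ) :
    MeasurePreserving (fun p : (ℕ → ℝ) × (ℕ → ℝ) => splice n p.1 p.2)
      ((seqLaw μ).prod (seqLaw μ)) (seqLaw μ) := by
  refine ⟨measurable_splice n, Measure.eq_infinitePi _ fun s t ht => ?_⟩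
  rw [Measure.map_apply (measurable_splice n) (.pi s.countable_toSet fun i _ => ht i)]
  have hpre : (fun p : (ℕ → ℝ) × (ℕ → ℝ) => splice n p.1 p.2) ⁻¹' (Set.pi s t) =
      (Set.pi ↑(s.filter (· < n)) t) ×ˢ
        (Set.pi ↑((s.filter (¬ · < n)).image (· - n)) fun i => t (i + n)) := by
    ext ⟨x, y⟩
    simp only [mem_preimage, Set.mem_pi, Finset.mem_coe, Set.mem_prod, Finset.mem_filter,
      Finset.mem_image, splice]
    constructor
    · refine fun h => ⟨fun i hi => by simpa [hi.2] using h i hi.1, ?_⟩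
      rintro _ ⟨i, hi, rfl⟩
      have := h i hi.1
      rw [if_neg hi.2] at this
      rwa [Nat.sub_add_cancel (not_lt.1 hi.2)]
    · rintro ⟨h1, h2⟩ i hi
      split_ifs with hin
      · exact h1 i ⟨hi, hin⟩
      · have := h2 (i - n) ⟨i, ⟨hi, hin⟩, rfl⟩
        rwa [Nat.sub_add_cancel (not_lt.1 hin)] at this
  rw [hpre, Measure.prod_prod, seqLaw, Measure.infinitePi_pi _ fun i _ => ht i,
    Measure.infinitePi_pi _ fun i _ => ht _, Finset.prod_image,
    ← Finset.prod_filter_mul_prod_filter_not s (· < n)]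
  · congr 1
    refine Finset.prod_congr rfl fun i hi => ?_
    rw [Nat.sub_add_cancel (not_lt.1 (Finset.mem_filter.1 hi).2)]
  · intro i hi j hj hij
    have := not_lt.1 (Finset.mem_filter.1 hi).2
    have := not_lt.1 (Finset.mem_filter.1 hj).2
    simp only at hij
    omega

lemma measurePreserving_shift (μ : Measure ℝ) [IsProbabilityMeasure μ] (n : ℕ) :
    MeasurePreserving (fun (x : ℕ → ℝ) i => x (n + i)) (seqLaw μ) (seqLaw μ) :=
  ⟨by fun_prop, Measure.map_infinitePi_infinitePi_of_inj (P := fun _ : ℕ => μ)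
    (f := fun i => n + i) fun i j h => by simpa using h⟩

lemma measurePreserving_consSeq (μ : Measure ℝ) [IsProbabilityMeasure μ] :
    MeasurePreserving (fun p : ℝ × (ℕ → ℝ) => consSeq p.1 p.2) (μ.prod (seqLaw μ))
      (seqLaw μ) := by
  have h1 : MeasurePreserving (fun x : ℕ → ℝ => x 0) (seqLaw μ) μ :=
    measurePreserving_eval_infinitePi _ 0
  have h2 := h1.prod (MeasurePreserving.id (seqLaw μ))
  refine ⟨measurable_consSeq, ?_⟩
  rw [← h2.map_eq, Measure.map_map measurable_consSeq h2.measurable]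
  refine Eq.trans ?_ (measurePreserving_splice μ 1).map_eq
  congr 1
  ext p i
  cases i with
  | zero => simp [consSeq, splice]
  | succ i => simp [consSeq, splice]

lemma measurable_update_seq (j : ℕ) :
    Measurable fun p : ℝ × (ℕ → ℝ) => Function.update p.2 j p.1 := by
  refine measurable_pi_lambda _ fun i => ?_
  by_cases h : i = j
  · subst h; simpa using measurable_fst
  · simp only [Function.update_of_ne h]; fun_prop

/-- Resampling one coordinate keeps the law. This lets a single interarrival time be integrated out
while the loads before it stay fixed. -/
lemma measurePreserving_update (μ : Measure ℝ) [IsProbabilityMeasure μ] (j : ℕ) :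
    MeasurePreserving (fun p : ℝ × (ℕ → ℝ) => Function.update p.2 j p.1) (μ.prod (seqLaw μ))
      (seqLaw μ) := by
  refine ⟨measurable_update_seq j, Measure.eq_infinitePi _ fun s t ht => ?_⟩
  rw [Measure.map_apply (measurable_update_seq j) (.pi s.countable_toSet fun i _ => ht i)]
  have hpre : (fun p : ℝ × (ℕ → ℝ) => Function.update p.2 j p.1) ⁻¹' (Set.pi s t) =
      (if j ∈ s then t j else univ) ×ˢ (Set.pi ↑(s.erase j) t) := by
    ext ⟨x, y⟩
    simp only [mem_preimage, Set.mem_pi, Finset.mem_coe, Set.mem_prod, Finset.mem_erase]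
    constructor
    · refine fun h => ⟨?_, fun i hi => by simpa [hi.1] using h i hi.2⟩
      split_ifs with hj
      · simpa using h j hj
      · trivial
    · rintro ⟨h1, h2⟩ i hi
      by_cases hij : i = j
      · subst hij; simpa [hi] using h1
      · simpa [hij] using h2 i ⟨hij, hi⟩
  rw [hpre, Measure.prod_prod, seqLaw, Measure.infinitePi_pi _ fun i _ => ht i]
  split_ifs with hj
  · exact Finset.mul_prod_erase s (fun i => μ (t i)) hj
  · rw [Finset.erase_eq_of_notMem hj, measure_univ, one_mul]

lemma measurePreserving_prodProdProdComm {α β γ δ : Type*} [MeasurableSpace α] [MeasurableSpace β]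
    [MeasurableSpace γ] [MeasurableSpace δ] (μa : Measure α) (μb : Measure β) (μc : Measure γ)
    (μd : Measure δ) [IsProbabilityMeasure μa] [IsProbabilityMeasure μb]
    [IsProbabilityMeasure μc] [IsProbabilityMeasure μd] :
    MeasurePreserving (fun p : (α × β) × (γ × δ) => ((p.1.1, p.2.1), (p.1.2, p.2.2)))
      ((μa.prod μb).prod (μc.prod μd)) ((μa.prod μc).prod (μb.prod μd)) := by
  have h1 := measurePreserving_prodAssoc μa μb (μc.prod μd)
  have h2 := (MeasurePreserving.id μa).prod
    ((measurePreserving_prodAssoc μc μb μd).comp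
      ((Measure.measurePreserving_swap (μ := μb) (ν := μc)).prod (MeasurePreserving.id μd)
        |>.comp ((measurePreserving_prodAssoc μb μc μd).symm MeasurableEquiv.prodAssoc)))
  have h3 := (measurePreserving_prodAssoc μa μc (μb.prod μd)).symm MeasurableEquiv.prodAssoc
  exact h3.comp (h2.comp h1)

/-- The law of the pair of the interarrival times `b` and the service times `v`. -/
noncomputable def pathLaw (r : ℝ) (μ : Measure ℝ) : Measure ((ℕ → ℝ) × (ℕ → ℝ)) :=
  (seqLaw (expMeasure r)).prod (seqLaw μ)

section pathLaw

variable (r : ℝ) (μ : Measure ℝ) [IsProbabilityMeasure (expMeasure r)] [IsProbabilityMeasure μ]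

instance : IsProbabilityMeasure (pathLaw r μ) := by
  unfold pathLaw; infer_instance

/-- The path seen from job `n` on. -/
def shiftPath (n : ℕ) (p : (ℕ → ℝ) × (ℕ → ℝ)) : (ℕ → ℝ) × (ℕ → ℝ) :=
  (fun i => p.1 (n + i), fun i => p.2 (n + i))

lemma measurePreserving_shiftPath (n : ℕ) :
    MeasurePreserving (shiftPath n) (pathLaw r μ) (pathLaw r μ) :=
  (measurePreserving_shift (expMeasure r) n).prod (measurePreserving_shift μ n)

lemma measurePreserving_splicePath (n : ℕ) :
    MeasurePreserving (fun p : ((ℕ → ℝ) × (ℕ → ℝ)) × ((ℕ → ℝ) × (ℕ → ℝ)) =>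
      (splice n p.1.1 p.2.1, splice n p.1.2 p.2.2)) ((pathLaw r μ).prod (pathLaw r μ))
      (pathLaw r μ) :=
  ((measurePreserving_splice (expMeasure r) n).prod (measurePreserving_splice μ n)).comp
    (measurePreserving_prodProdProdComm _ _ _ _)

lemma measurePreserving_consPath :
    MeasurePreserving (fun p : (ℝ × ℝ) × ((ℕ → ℝ) × (ℕ → ℝ)) =>
      (consSeq p.1.1 p.2.1, consSeq p.1.2 p.2.2)) (((expMeasure r).prod μ).prod (pathLaw r μ))
      (pathLaw r μ) :=
  ((measurePreserving_consSeq (expMeasure r)).prod (measurePreserving_consSeq μ)).comp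
    (measurePreserving_prodProdProdComm _ _ _ _)

/-- Splits off the first service time, which plays the role of the initial workload of the first
busy period. -/
lemma measurePreserving_consService :
    MeasurePreserving (fun p : ℝ × ((ℕ → ℝ) × (ℕ → ℝ)) => (p.2.1, consSeq p.1 p.2.2))
      (μ.prod (pathLaw r μ)) (pathLaw r μ) := by
  have h1 := (measurePreserving_prodAssoc μ (seqLaw (expMeasure r)) (seqLaw μ)).symm
    MeasurableEquiv.prodAssoc
  have h2 := (Measure.measurePreserving_swap (μ := μ) (ν := seqLaw (expMeasure r))).prod
    (MeasurePreserving.id (seqLaw μ))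
  have h3 := measurePreserving_prodAssoc (seqLaw (expMeasure r)) μ (seqLaw μ)
  have h4 := (MeasurePreserving.id (seqLaw (expMeasure r))).prod (measurePreserving_consSeq μ)
  exact h4.comp (h3.comp (h2.comp h1))

lemma measurePreserving_updatePath (j : ℕ) :
    MeasurePreserving (fun p : ℝ × ((ℕ → ℝ) × (ℕ → ℝ)) => (Function.update p.2.1 j p.1, p.2.2))
      ((expMeasure r).prod (pathLaw r μ)) (pathLaw r μ) := by
  have h1 := (measurePreserving_prodAssoc (expMeasure r) (seqLaw (expMeasure r)) (seqLaw μ)).symm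
    MeasurableEquiv.prodAssoc
  have h2 := (measurePreserving_update (expMeasure r) j).prod (MeasurePreserving.id (seqLaw μ))
  exact h2.comp h1

end pathLaw

/-! ### The exponential distribution -/

section exponential

variable {r : ℝ}

lemma expMeasure_eq_withDensity (r : ℝ) :
    expMeasure r = volume.withDensity (exponentialPDF r) := rfl

lemma measurable_exponentialPDF (r : ℝ) : Measurable (exponentialPDF r) :=
  (measurable_exponentialPDFReal r).ennreal_ofReal

instance (r : ℝ) : NullSingletonClass (expMeasure r) := by
  rw [expMeasure_eq_withDensity]; infer_instance

lemma expMeasure_Ici (hr : 0 < r) (z : ℝ) :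
    expMeasure r (Ici z) = ENNReal.ofReal (Real.exp (-(r * max z 0))) := by
  have := isProbabilityMeasure_expMeasure hr
  rw [← measure_congr (Ioi_ae_eq_Ici (μ := expMeasure r) (a := z)), ← compl_Iic,
    measure_compl measurableSet_Iic (measure_ne_top _ _), measure_univ, ← ofReal_cdf,
    cdf_expMeasure_eq hr, ← ENNReal.ofReal_one, ← ENNReal.ofReal_sub]
  · split_ifs with h
    · rw [max_eq_left h]; congr 1; ring
    · rw [max_eq_right (not_le.1 h).le]; simp
  · split_ifs with h
    · simpa using by positivity
    · exact le_rfl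

/-- The memoryless property. -/
lemma expMeasure_Ici_inter_Ici (hr : 0 < r) {u : ℝ} (hu : 0 ≤ u) (w : ℝ) :
    expMeasure r (Ici u ∩ Ici (u + w)) = expMeasure r (Ici u) * expMeasure r (Ici w) := by
  rw [Ici_inter_Ici, expMeasure_Ici hr, expMeasure_Ici hr, expMeasure_Ici hr,
    ← ENNReal.ofReal_mul (Real.exp_pos _).le, ← Real.exp_add]
  congr 2
  rw [max_eq_left hu, show u ⊔ (u + w) = u + max w 0 by
    rw [← max_add_add_left, add_zero, max_comm], max_eq_left (add_nonneg hu (le_max_right _ _))]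
  ring

lemma ae_expMeasure_pos (hr : 0 < r) : ∀ᵐ x ∂(expMeasure r), 0 < x := by
  have := isProbabilityMeasure_expMeasure hr
  rw [ae_iff, show {a : ℝ | ¬ 0 < a} = Iic 0 by ext; simp, ← ofReal_cdf, cdf_expMeasure_eq hr]
  simp

lemma integral_expMeasure (hr : 0 < r) (f : ℝ → ℝ) :
    ∫ x, f x ∂(expMeasure r) = ∫ x in Ioi 0, r * Real.exp (-(r * x)) * f x := by
  rw [expMeasure_eq_withDensity, integral_withDensity_eq_integral_toReal_smul
    (measurable_exponentialPDF r) (by simp [exponentialPDF]),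
    ← integral_indicator measurableSet_Ioi]
  refine integral_congr_ae ?_
  filter_upwards [compl_mem_ae_iff.2 (measure_singleton (μ := volume) (0 : ℝ))] with x hx
  by_cases h : 0 < x
  · have : 0 ≤ r * Real.exp (-(r * x)) := by positivity
    simp [h, exponentialPDF_of_nonneg h.le, this]
  · have : x < 0 := lt_of_le_of_ne (not_lt.1 h) hx
    simp [h, exponentialPDF_of_neg this]

end exponential

/-! ### The embedded chain as a function of the path -/

open scoped Classical in
/-- The number of busy periods of Q1 that end before job `j`. -/
noncomputable def endCount (b v : ℕ → ℝ) (j : ℕ) : ℕ := Nat.count (EndsAt b v) j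

/-- The workload of Q2 at the arrival of the last job of the `k + 1`-st busy period of Q1. -/
noncomputable def embLoad (k : ℕ) (p : (ℕ → ℝ) × (ℕ → ℝ)) : ℝ :=
  loadTwo p.1 p.2 (Nat.nth (EndsAt p.1 p.2) k)

lemma loadOne_congr {b v b' v' : ℕ → ℝ} {j : ℕ} (hb : ∀ i < j, b i = b' i)
    (hv : ∀ i ≤ j, v i = v' i) : loadOne b v j = loadOne b' v' j := by
  induction j with
  | zero => exact hv 0 le_rfl
  | succ j ih =>
    rw [loadOne, loadOne, ih (fun i hi => hb i (by omega)) fun i hi => hv i (by omega),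
      hb j (by omega), hv (j + 1) le_rfl]

lemma loadTwo_congr {b v b' v' : ℕ → ℝ} {j : ℕ} (hb : ∀ i < j, b i = b' i)
    (hv : ∀ i ≤ j, v i = v' i) : loadTwo b v j = loadTwo b' v' j := by
  induction j with
  | zero => exact hv 0 le_rfl
  | succ j ih =>
    rw [loadTwo, loadTwo, ih (fun i hi => hb i (by omega)) fun i hi => hv i (by omega),
      loadOne_congr (fun i hi => hb i (by omega)) fun i hi => hv i (by omega),
      hb j (by omega), hv (j + 1) le_rfl]

lemma endCount_succ (b v : ℕ → ℝ) (j : ℕ) [Decidable (EndsAt b v j)] :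
    endCount b v (j + 1) = endCount b v j + if EndsAt b v j then 1 else 0 := by
  unfold endCount
  rw [Nat.count_succ]
  congr

lemma endCount_congr {b v b' v' : ℕ → ℝ} {j : ℕ} (hb : ∀ i < j, b i = b' i)
    (hv : ∀ i < j, v i = v' i) : endCount b v j = endCount b' v' j := by
  classical
  induction j with
  | zero => simp [endCount]
  | succ j ih =>
    have : EndsAt b v j ↔ EndsAt b' v' j := by
      rw [EndsAt, EndsAt, hb j (by omega),
        loadOne_congr (fun i hi => hb i (by omega)) fun i hi => hv i (by omega)]
    rw [endCount_succ, endCount_succ, ih (fun i hi => hb i (by omega)) fun i hi => hv i (by omega)]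
    simp only [this]

lemma measurable_loadOne (j : ℕ) :
    Measurable fun p : (ℕ → ℝ) × (ℕ → ℝ) => loadOne p.1 p.2 j := by
  induction j with
  | zero => simp only [loadOne]; fun_prop
  | succ j ih => simp only [loadOne]; fun_prop

lemma measurable_loadTwo (j : ℕ) :
    Measurable fun p : (ℕ → ℝ) × (ℕ → ℝ) => loadTwo p.1 p.2 j := by
  induction j with
  | zero => simp only [loadTwo]; fun_prop
  | succ j ih =>
    have := measurable_loadOne j
    simp only [loadTwo]
    fun_prop

lemma measurableSet_endsAt (j : ℕ) :
    MeasurableSet {p : (ℕ → ℝ) × (ℕ → ℝ) | EndsAt p.1 p.2 j} :=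
  measurableSet_le (measurable_loadOne j) (by fun_prop)

lemma measurable_endCount (j : ℕ) :
    Measurable fun p : (ℕ → ℝ) × (ℕ → ℝ) => endCount p.1 p.2 j := by
  classical
  induction j with
  | zero => simp only [endCount, Nat.count_zero]; fun_prop
  | succ j ih =>
    simp only [endCount_succ]
    exact ih.add (Measurable.ite (measurableSet_endsAt j) measurable_const measurable_const)

lemma nth_eq_of_endsAt {b v : ℕ → ℝ} {j k : ℕ} (h : EndsAt b v j) (hk : endCount b v j = k) :
    Nat.nth (EndsAt b v) k = j := by
  classical
  subst hk
  unfold endCount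
  convert Nat.nth_count h

lemma exists_endsAt_or_nth_eq_zero (b v : ℕ → ℝ) (k : ℕ) :
    (∃ j, EndsAt b v j ∧ endCount b v j = k) ∨ Nat.nth (EndsAt b v) k = 0 := by
  classical
  by_cases h : ∀ hf : (Set.ofPred (EndsAt b v)).Finite, k < hf.toFinset.card
  · refine Or.inl ⟨_, Nat.nth_mem k h, ?_⟩
    unfold endCount
    convert Nat.count_nth h
  · push Not at h
    exact Or.inr (Nat.nth_eq_zero.2 (Or.inr h))

lemma measurable_nth (k : ℕ) :
    Measurable fun p : (ℕ → ℝ) × (ℕ → ℝ) => Nat.nth (EndsAt p.1 p.2) k := by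
  have hE : ∀ j, MeasurableSet
      {p : (ℕ → ℝ) × (ℕ → ℝ) | EndsAt p.1 p.2 j ∧ endCount p.1 p.2 j = k} := fun j =>
    (measurableSet_endsAt j).inter (measurable_endCount j (measurableSet_singleton k))
  refine measurable_to_countable' fun j => ?_
  -- The second set contributes only for `j = 0`: it consists of the paths with at most `k` ends, on
  -- which `Nat.nth` has its default value 0.
  have : (fun p : (ℕ → ℝ) × (ℕ → ℝ) => Nat.nth (EndsAt p.1 p.2) k) ⁻¹' {j} =
      {p | EndsAt p.1 p.2 j ∧ endCount p.1 p.2 j = k} ∪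
        ((if j = 0 then univ else ∅) ∩ (⋃ i, {p | EndsAt p.1 p.2 i ∧ endCount p.1 p.2 i = k})ᶜ) := by
    ext p
    simp only [mem_preimage, mem_singleton_iff, mem_union, mem_inter_iff, mem_compl_iff, mem_iUnion]
    rcases exists_endsAt_or_nth_eq_zero p.1 p.2 k with ⟨i, hi, hk⟩ | h
    · rw [nth_eq_of_endsAt hi hk]
      constructor
      · rintro rfl; exact Or.inl ⟨hi, hk⟩
      · rintro (⟨h1, h2⟩ | ⟨_, h2⟩)
        · rw [← nth_eq_of_endsAt hi hk, nth_eq_of_endsAt h1 h2]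
        · exact absurd ⟨i, hi, hk⟩ h2
    · constructor
      · intro hj
        by_cases hc : ∃ i, EndsAt p.1 p.2 i ∧ endCount p.1 p.2 i = k
        · obtain ⟨i, hi, hk⟩ := hc
          rw [nth_eq_of_endsAt hi hk] at hj
          subst hj
          exact Or.inl ⟨hi, hk⟩
        · refine Or.inr ⟨?_, hc⟩
          rw [← hj, if_pos h]; trivial
      · rintro (⟨h1, h2⟩ | ⟨h1, _⟩)
        · exact nth_eq_of_endsAt h1 h2
        · split_ifs at h1 with h0
          · rw [h, h0]
          · exact absurd h1 (notMem_empty _)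
  rw [this]
  refine (hE j).union (MeasurableSet.inter ?_ (MeasurableSet.iUnion hE).compl)
  split_ifs
  · exact MeasurableSet.univ
  · exact MeasurableSet.empty

lemma measurable_embLoad (k : ℕ) : Measurable (embLoad k) := by
  have : Measurable fun q : ((ℕ → ℝ) × (ℕ → ℝ)) × ℕ => loadTwo q.1.1 q.1.2 q.2 :=
    measurable_from_prod_countable_left measurable_loadTwo
  exact this.comp (measurable_id.prodMk (measurable_nth k))

/-! ### The recursion for the distribution of the embedded workloads -/

/-- Busy periods of Q1 end, for every starting job. -/
def Recurrent (p : (ℕ → ℝ) × (ℕ → ℝ)) : Prop :=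
  ∀ n, ∃ j, EndsAt (shiftPath n p).1 (shiftPath n p).2 j

lemma Recurrent.shiftPath {p : (ℕ → ℝ) × (ℕ → ℝ)} (hp : Recurrent p) (n : ℕ) :
    Recurrent (shiftPath n p) := fun k => by
  simpa [TandemQueue.shiftPath, add_assoc] using hp (n + k)

/-- If there were a last end, the path shifted past it would have an end as well, and by
regeneration this would be a later end of the original path. -/
lemma Recurrent.infinite {p : (ℕ → ℝ) × (ℕ → ℝ)} (hp : Recurrent p) :
    (Set.ofPred (EndsAt p.1 p.2)).Infinite := by
  refine Set.infinite_of_not_bddAbove fun hb => ?_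
  have h0 : (Set.ofPred (EndsAt p.1 p.2)).Nonempty := by
    obtain ⟨j, hj⟩ := hp 0
    exact ⟨j, by simpa [TandemQueue.shiftPath] using hj⟩
  have hm : EndsAt p.1 p.2 (sSup (Set.ofPred (EndsAt p.1 p.2))) := Nat.sSup_mem h0 hb
  obtain ⟨i, hi⟩ := hp (sSup (Set.ofPred (EndsAt p.1 p.2)) + 1)
  have := le_csSup hb ((hm.endsAt_add_iff i).2 hi)
  omega

lemma Recurrent.exists_endsAt {p : (ℕ → ℝ) × (ℕ → ℝ)} (hp : Recurrent p) (k : ℕ) :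
    ∃ j, EndsAt p.1 p.2 j ∧ endCount p.1 p.2 j = k := by
  classical
  refine ⟨_, Nat.nth_mem_of_infinite hp.infinite k, ?_⟩
  unfold endCount
  convert Nat.count_nth_of_infinite hp.infinite k

lemma Recurrent.embLoad_le_iff {p : (ℕ → ℝ) × (ℕ → ℝ)} (hp : Recurrent p) (k : ℕ) (x : ℝ) :
    embLoad k p ≤ x ↔
      ∃ j, EndsAt p.1 p.2 j ∧ endCount p.1 p.2 j = k ∧ loadTwo p.1 p.2 j ≤ x := by
  constructor
  · intro h
    obtain ⟨j, hj, hk⟩ := hp.exists_endsAt k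
    refine ⟨j, hj, hk, ?_⟩
    rwa [embLoad, nth_eq_of_endsAt hj hk] at h
  · rintro ⟨j, hj, hk, h⟩
    rwa [embLoad, nth_eq_of_endsAt hj hk]

lemma not_endsAt_of_endCount_eq_zero {b v : ℕ → ℝ} {j : ℕ} (h : endCount b v j = 0) {i : ℕ}
    (hi : i < j) : ¬ EndsAt b v i := by
  classical
  intro hc
  have h1 : endCount b v (i + 1) ≤ endCount b v j := Nat.count_monotone _ hi
  rw [endCount_succ, if_pos hc] at h1
  omega

/-- The recursion of the embedded chain. The bracket `p.1 j - loadOne p.1 p.2 j` is the idle period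
of Q1, and the last term is the largest service time of the next busy period. -/
lemma Recurrent.embLoad_succ {p : (ℕ → ℝ) × (ℕ → ℝ)} (hp : Recurrent p) {j k : ℕ}
    (hj : EndsAt p.1 p.2 j) (hk : endCount p.1 p.2 j = k) :
    embLoad (k + 1) p = max (loadTwo p.1 p.2 j - (p.1 j - loadOne p.1 p.2 j))
      (embLoad 0 (TandemQueue.shiftPath (j + 1) p)) := by
  classical
  obtain ⟨i, hi, h0⟩ := (hp.shiftPath (j + 1)).exists_endsAt 0
  have hi' : EndsAt p.1 p.2 (j + 1 + i) := (hj.endsAt_add_iff i).2 hi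
  have hc : endCount p.1 p.2 (j + 1 + i) = k + 1 := by
    have e1 : endCount p.1 p.2 (j + 1 + i) = endCount p.1 p.2 (j + 1) +
        endCount (TandemQueue.shiftPath (j + 1) p).1 (TandemQueue.shiftPath (j + 1) p).2 i := by
      unfold endCount
      rw [Nat.count_add]
      simp only [Nat.count_eq_card_filter_range, hj.endsAt_add_iff]
      rfl
    rw [e1, h0, endCount_succ, if_pos hj, hk]
  rw [embLoad, embLoad, nth_eq_of_endsAt hi' hc, nth_eq_of_endsAt hi h0]
  exact hj.loadTwo_add i fun l hl => not_endsAt_of_endCount_eq_zero h0 hl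

section law

variable {r : ℝ} {μ : Measure ℝ} [IsProbabilityMeasure μ] [IsProbabilityMeasure (expMeasure r)]

lemma ae_recurrent (h : ∀ᵐ p ∂(pathLaw r μ), ∃ j, EndsAt p.1 p.2 j) :
    ∀ᵐ p ∂(pathLaw r μ), Recurrent p :=
  ae_all_iff.2 fun n => (measurePreserving_shiftPath r μ n).quasiMeasurePreserving.ae h

lemma ae_service_nonneg (hμ : ∀ᵐ x ∂μ, 0 ≤ x) : ∀ᵐ p ∂(pathLaw r μ), ∀ j, 0 ≤ p.2 j := by
  refine ae_all_iff.2 fun j => ?_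
  have h1 : MeasurePreserving (fun x : ℕ → ℝ => x j) (seqLaw μ) μ :=
    measurePreserving_eval_infinitePi _ j
  exact (h1.comp measurePreserving_snd).quasiMeasurePreserving.ae hμ

lemma measurableSet_endsAt_loadTwo (j k : ℕ) :
    MeasurableSet {q : ℝ × ((ℕ → ℝ) × (ℕ → ℝ)) | EndsAt q.2.1 q.2.2 j ∧
      endCount q.2.1 q.2.2 j = k ∧ loadTwo q.2.1 q.2.2 j ≤ q.1} :=
  (measurable_snd (measurableSet_endsAt j)).inter
    ((measurable_snd (measurable_endCount j (measurableSet_singleton k))).inter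
      (measurableSet_le ((measurable_loadTwo j).comp measurable_snd) measurable_fst))

/-- The idle period after a busy period is exponential and independent of the past. -/
lemma pathLaw_sub_idle (hr : 0 < r) (hμ : ∀ᵐ x ∂μ, 0 ≤ x) (j k : ℕ) (x : ℝ) :
    pathLaw r μ {p | EndsAt p.1 p.2 j ∧ endCount p.1 p.2 j = k ∧
        loadTwo p.1 p.2 j - (p.1 j - loadOne p.1 p.2 j) ≤ x} =
      ∫⁻ s, pathLaw r μ {p | EndsAt p.1 p.2 j ∧ endCount p.1 p.2 j = k ∧
        loadTwo p.1 p.2 j ≤ x + s} ∂(expMeasure r) := by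
  have hX := measurable_loadOne j
  have hY := measurable_loadTwo j
  have hC : MeasurableSet {p : (ℕ → ℝ) × (ℕ → ℝ) | endCount p.1 p.2 j = k} :=
    measurable_endCount j (measurableSet_singleton k)
  have hup : ∀ (s : ℝ) (p : (ℕ → ℝ) × (ℕ → ℝ)),
      loadOne (Function.update p.1 j s) p.2 j = loadOne p.1 p.2 j ∧
      loadTwo (Function.update p.1 j s) p.2 j = loadTwo p.1 p.2 j ∧
      endCount (Function.update p.1 j s) p.2 j = endCount p.1 p.2 j := fun s p =>
    ⟨loadOne_congr (fun i hi => Function.update_of_ne hi.ne _ _) fun _ _ => rfl,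
      loadTwo_congr (fun i hi => Function.update_of_ne hi.ne _ _) fun _ _ => rfl,
      endCount_congr (fun i hi => Function.update_of_ne hi.ne _ _) fun _ _ => rfl⟩
  have hM1 : MeasurableSet {p : (ℕ → ℝ) × (ℕ → ℝ) | EndsAt p.1 p.2 j ∧ endCount p.1 p.2 j = k ∧
        loadTwo p.1 p.2 j - (p.1 j - loadOne p.1 p.2 j) ≤ x} :=
    (measurableSet_endsAt j).inter (hC.inter (measurableSet_le
      (hY.sub (((measurable_pi_apply j).comp measurable_fst).sub hX)) measurable_const))
  -- Fubini after resampling the interarrival time `j`: the loads and the count at `j` depend on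
  -- earlier interarrival times only, so the section over the resampled value can be measured first.
  have key : ∀ A : Set (ℝ × ((ℕ → ℝ) × (ℕ → ℝ))), MeasurableSet A → ∀ B : Set ((ℕ → ℝ) × (ℕ → ℝ)),
      MeasurableSet B → (∀ s p, (Function.update p.1 j s, p.2) ∈ B ↔ (s, p) ∈ A) →
      pathLaw r μ B = ∫⁻ p, expMeasure r {s | (s, p) ∈ A} ∂(pathLaw r μ) := by
    intro A hA B hB hAB
    rw [← (measurePreserving_updatePath r μ j).measure_preimage hB.nullMeasurableSet,
      Measure.prod_apply_symm ((measurePreserving_updatePath r μ j).measurable hB)]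
    refine lintegral_congr fun p => ?_
    congr 1
    ext s
    exact hAB s p
  rw [key {q | loadOne q.2.1 q.2.2 j ≤ q.1 ∧ endCount q.2.1 q.2.2 j = k ∧
      loadTwo q.2.1 q.2.2 j - (q.1 - loadOne q.2.1 q.2.2 j) ≤ x}
    ((measurableSet_le (hX.comp measurable_snd) measurable_fst).inter
      ((measurable_snd hC).inter (measurableSet_le ((hY.comp measurable_snd).sub
        (measurable_fst.sub (hX.comp measurable_snd))) measurable_const))) _ hM1
    fun s p => by simp [EndsAt, hup]]
  have hS : MeasurableSet {q : ℝ × ((ℕ → ℝ) × (ℕ → ℝ)) | endCount q.2.1 q.2.2 j = k ∧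
      loadTwo q.2.1 q.2.2 j ≤ x + q.1} :=
    (measurable_snd hC).inter (measurableSet_le (hY.comp measurable_snd)
      (measurable_const.add measurable_fst))
  have hI : Measurable fun p : (ℕ → ℝ) × (ℕ → ℝ) => expMeasure r (Ici (loadOne p.1 p.2 j)) := by
    simp_rw [expMeasure_Ici hr]
    fun_prop
  have h2 : ∀ s, pathLaw r μ {p | EndsAt p.1 p.2 j ∧ endCount p.1 p.2 j = k ∧
        loadTwo p.1 p.2 j ≤ x + s} =
      ∫⁻ p, {q : ℝ × ((ℕ → ℝ) × (ℕ → ℝ)) | endCount q.2.1 q.2.2 j = k ∧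
        loadTwo q.2.1 q.2.2 j ≤ x + q.1}.indicator
          (fun q => expMeasure r (Ici (loadOne q.2.1 q.2.2 j))) (s, p) ∂(pathLaw r μ) := by
    intro s
    rw [key {q | loadOne q.2.1 q.2.2 j ≤ q.1 ∧ endCount q.2.1 q.2.2 j = k ∧
        loadTwo q.2.1 q.2.2 j ≤ x + s} _ _ _ fun s p => by simp [EndsAt, hup]]
    · refine lintegral_congr fun p => ?_
      simp only [indicator_apply, mem_ofPred_eq]
      split_ifs with h
      · congr 1
        ext s'
        simp [h]
      · rw [show {s' | loadOne p.1 p.2 j ≤ s' ∧ endCount p.1 p.2 j = k ∧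
          loadTwo p.1 p.2 j ≤ x + s} = ∅ from eq_empty_of_forall_notMem fun s' hs => h hs.2,
          measure_empty]
    · exact (measurableSet_le (hX.comp measurable_snd) measurable_fst).inter
        ((measurable_snd hC).inter (measurableSet_le (hY.comp measurable_snd) measurable_const))
    · exact (measurableSet_endsAt j).inter (hC.inter (measurableSet_le hY measurable_const))
  simp_rw [h2]
  rw [lintegral_lintegral_swap]
  · refine lintegral_congr_ae ?_
    filter_upwards [ae_service_nonneg hμ] with p hp
    by_cases hk : endCount p.1 p.2 j = k
    · have e1 : {s | loadOne p.1 p.2 j ≤ s ∧ endCount p.1 p.2 j = k ∧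
          loadTwo p.1 p.2 j - (s - loadOne p.1 p.2 j) ≤ x} =
          Ici (loadOne p.1 p.2 j) ∩ Ici (loadOne p.1 p.2 j + (loadTwo p.1 p.2 j - x)) := by
        ext s
        simp only [mem_ofPred_eq, hk, true_and, mem_inter_iff, mem_Ici]
        refine and_congr_right fun _ => ⟨fun h => by linarith, fun h => by linarith⟩
      -- Lack of memory: given that it exceeds the load of Q1, the interarrival time overshoots it
      -- by a fresh exponential time. The load of Q1 is nonnegative, as this requires.
      rw [e1, expMeasure_Ici_inter_Ici hr (loadOne_nonneg hp j), mul_comm]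
      have e2 : ∀ s, {q : ℝ × ((ℕ → ℝ) × (ℕ → ℝ)) | endCount q.2.1 q.2.2 j = k ∧
          loadTwo q.2.1 q.2.2 j ≤ x + q.1}.indicator
            (fun q => expMeasure r (Ici (loadOne q.2.1 q.2.2 j))) (s, p) =
          (Ici (loadTwo p.1 p.2 j - x)).indicator
            (fun _ => expMeasure r (Ici (loadOne p.1 p.2 j))) s := by
        intro s
        simp only [indicator_apply, mem_ofPred_eq, hk, true_and, mem_Ici, sub_le_iff_le_add']
      simp_rw [e2]
      rw [lintegral_indicator measurableSet_Ici, lintegral_const, Measure.restrict_apply_univ,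
        mul_comm]
    · simp [hk]
  · exact ((hI.comp measurable_snd).indicator hS).aemeasurable

/-- Decompose by the index `j` of the last job of the busy period with number `k + 1`. The event for
the past, idle period included, uses coordinates up to `j`, and the maximum of the next busy period
uses coordinates from `j + 1` on. -/
lemma pathLaw_embLoad_succ (hr : 0 < r) (hμ : ∀ᵐ x ∂μ, 0 ≤ x)
    (h : ∀ᵐ p ∂(pathLaw r μ), ∃ j, EndsAt p.1 p.2 j) (k : ℕ) (x : ℝ) :
    pathLaw r μ {p | embLoad (k + 1) p ≤ x} =
      (∫⁻ s, pathLaw r μ {p | embLoad k p ≤ x + s} ∂(expMeasure r)) *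
        pathLaw r μ {p | embLoad 0 p ≤ x} := by
  have hrec := ae_recurrent h
  have hC : ∀ j, MeasurableSet {p : (ℕ → ℝ) × (ℕ → ℝ) | endCount p.1 p.2 j = k} := fun j =>
    measurable_endCount j (measurableSet_singleton k)
  have hE1 : ∀ j, MeasurableSet {p : (ℕ → ℝ) × (ℕ → ℝ) | EndsAt p.1 p.2 j ∧
      endCount p.1 p.2 j = k ∧ loadTwo p.1 p.2 j - (p.1 j - loadOne p.1 p.2 j) ≤ x} := fun j => by
    have hX := measurable_loadOne j
    have hY := measurable_loadTwo j
    exact (measurableSet_endsAt j).inter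
      ((hC j).inter (measurableSet_le
      (hY.sub (((measurable_pi_apply j).comp measurable_fst).sub hX)) measurable_const))
  have hE0 : ∀ j y, MeasurableSet {p : (ℕ → ℝ) × (ℕ → ℝ) | EndsAt p.1 p.2 j ∧
      endCount p.1 p.2 j = k ∧ loadTwo p.1 p.2 j ≤ y} := fun j y =>
    (measurableSet_endsAt j).inter
      ((hC j).inter (measurableSet_le (measurable_loadTwo j) measurable_const))
  have hF : MeasurableSet {p : (ℕ → ℝ) × (ℕ → ℝ) | embLoad 0 p ≤ x} :=
    measurableSet_le (measurable_embLoad 0) measurable_const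
  have hdisj : ∀ T : ℕ → Set ((ℕ → ℝ) × (ℕ → ℝ)),
      (∀ j, T j ⊆ {p | EndsAt p.1 p.2 j ∧ endCount p.1 p.2 j = k}) →
      Pairwise (Function.onFun Disjoint T) := by
    intro T hT i j hij
    refine Set.disjoint_left.2 fun p hi hj => hij ?_
    rw [← nth_eq_of_endsAt (hT i hi).1 (hT i hi).2, nth_eq_of_endsAt (hT j hj).1 (hT j hj).2]
  -- Splicing at `j + 1` turns the intersection into a rectangle for two independent paths.
  have hsplit : ∀ j, pathLaw r μ ({p | EndsAt p.1 p.2 j ∧ endCount p.1 p.2 j = k ∧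
      loadTwo p.1 p.2 j - (p.1 j - loadOne p.1 p.2 j) ≤ x} ∩
        shiftPath (j + 1) ⁻¹' {p | embLoad 0 p ≤ x}) =
      pathLaw r μ {p | EndsAt p.1 p.2 j ∧ endCount p.1 p.2 j = k ∧
        loadTwo p.1 p.2 j - (p.1 j - loadOne p.1 p.2 j) ≤ x} *
        pathLaw r μ {p | embLoad 0 p ≤ x} := by
    intro j
    rw [← Measure.prod_prod, ← (measurePreserving_splicePath r μ (j + 1)).measure_preimage
      ((hE1 j).inter ((measurePreserving_shiftPath r μ (j + 1)).measurable hF)).nullMeasurableSet]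
    congr 1
    ext ⟨p, q⟩
    have e1 : ∀ x y : ℕ → ℝ, ∀ i ≤ j, splice (j + 1) x y i = x i := fun x y i hi => by
      simp [splice, Nat.lt_succ_of_le hi]
    have e2 : ∀ x y : ℕ → ℝ, (fun i => splice (j + 1) x y (j + 1 + i)) = y := fun x y => by
      ext i; simp only [splice, add_tsub_cancel_left, if_neg (show ¬ j + 1 + i < j + 1 by omega)]
    have eX : loadOne (splice (j + 1) p.1 q.1) (splice (j + 1) p.2 q.2) j = loadOne p.1 p.2 j :=
      loadOne_congr (fun i hi => e1 _ _ i hi.le) fun i hi => e1 _ _ i hi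
    have eY : loadTwo (splice (j + 1) p.1 q.1) (splice (j + 1) p.2 q.2) j = loadTwo p.1 p.2 j :=
      loadTwo_congr (fun i hi => e1 _ _ i hi.le) fun i hi => e1 _ _ i hi
    have eC : endCount (splice (j + 1) p.1 q.1) (splice (j + 1) p.2 q.2) j = endCount p.1 p.2 j :=
      endCount_congr (fun i hi => e1 _ _ i hi.le) fun i hi => e1 _ _ i hi.le
    simp only [mem_preimage, mem_inter_iff, mem_ofPred_eq, EndsAt, eX, eY, eC, shiftPath, e2,
      e1 _ _ j le_rfl, mem_prod]
  have hl : pathLaw r μ {p | embLoad (k + 1) p ≤ x} =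
      pathLaw r μ (⋃ j, ({p | EndsAt p.1 p.2 j ∧ endCount p.1 p.2 j = k ∧
        loadTwo p.1 p.2 j - (p.1 j - loadOne p.1 p.2 j) ≤ x} ∩
        shiftPath (j + 1) ⁻¹' {p | embLoad 0 p ≤ x})) := by
    refine measure_congr ?_
    filter_upwards [hrec] with p hp
    refine propext ⟨fun hx => ?_, fun hx => ?_⟩
    · obtain ⟨j, hj, hk⟩ := hp.exists_endsAt k
      have hx' : embLoad (k + 1) p ≤ x := hx
      rw [hp.embLoad_succ hj hk, max_le_iff] at hx'
      exact mem_iUnion.2 ⟨j, ⟨hj, hk, hx'.1⟩, hx'.2⟩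
    · obtain ⟨j, ⟨hj, hk, h1⟩, h2⟩ := mem_iUnion.1 hx
      change embLoad (k + 1) p ≤ x
      rw [hp.embLoad_succ hj hk]
      exact max_le h1 h2
  have hr' : ∀ y, pathLaw r μ {p | embLoad k p ≤ y} =
      ∑' j, pathLaw r μ {p | EndsAt p.1 p.2 j ∧ endCount p.1 p.2 j = k ∧
        loadTwo p.1 p.2 j ≤ y} := by
    intro y
    rw [← measure_iUnion (hdisj _ fun j p hp => ⟨hp.1, hp.2.1⟩) fun j => hE0 j y]
    refine measure_congr ?_
    filter_upwards [hrec] with p hp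
    refine propext ((hp.embLoad_le_iff k y).trans ?_)
    exact ⟨fun ⟨j, hj⟩ => mem_iUnion.2 ⟨j, hj⟩, fun hx => mem_iUnion.1 hx⟩
  rw [hl, measure_iUnion (hdisj _ fun j p hp => ⟨hp.1.1, hp.1.2.1⟩) fun j =>
    (hE1 j).inter ((measurePreserving_shiftPath r μ (j + 1)).measurable hF)]
  simp_rw [hsplit, hr', pathLaw_sub_idle hr hμ]
  rw [ENNReal.tsum_mul_right, lintegral_tsum]
  intro j
  exact (measurable_measure_prodMk_left ((measurable_const.add measurable_fst).prodMk measurable_snd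
    (measurableSet_endsAt_loadTwo j k))).aemeasurable

end law

/-! ### The largest service time in a busy period -/

/-- A busy period of Q1 with initial workload `u` ends before `N` further jobs have arrived, and the
service times of these jobs belong to `B`. -/
def EndsWithin (B : Set ℝ) : ℕ → ℝ → (ℕ → ℝ) × (ℕ → ℝ) → Prop
  | 0, _, _ => False
  | N + 1, u, p => u ≤ p.1 0 ∨ (p.2 0 ∈ B ∧ EndsWithin B N (u - p.1 0 + p.2 0) (shiftPath 1 p))

lemma shiftPath_consSeq (s w : ℝ) (q : (ℕ → ℝ) × (ℕ → ℝ)) :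
    shiftPath 1 (consSeq s q.1, consSeq w q.2) = q := by
  ext i <;> simp [shiftPath, add_comm 1 i, consSeq]

lemma EndsWithin.mono_nat {B : Set ℝ} {N M : ℕ} (hNM : N ≤ M) {u : ℝ} {p : (ℕ → ℝ) × (ℕ → ℝ)}
    (h : EndsWithin B N u p) : EndsWithin B M u p := by
  induction N generalizing M u p with
  | zero => exact h.elim
  | succ N ih =>
    obtain ⟨M, rfl⟩ : ∃ M', M = M' + 1 := ⟨M - 1, by omega⟩
    exact h.imp_right fun h2 => ⟨h2.1, ih (by omega) h2.2⟩

lemma loadOne_consSeq_succ {b v : ℕ → ℝ} {u : ℝ} (hu : b 0 < u) (l : ℕ) :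
    loadOne b (consSeq u v) (l + 1) =
      loadOne (fun i => b (1 + i)) (consSeq (u - b 0 + v 0) fun i => v (1 + i)) l := by
  induction l with
  | zero => simp [loadOne, consSeq, max_eq_left (sub_nonneg.2 hu.le)]
  | succ l ih => rw [loadOne, ih, loadOne, add_comm l 1]; simp [consSeq, add_comm 1 l]

lemma endsAt_consSeq_succ {b v : ℕ → ℝ} {u : ℝ} (hu : b 0 < u) (l : ℕ) :
    EndsAt b (consSeq u v) (l + 1) ↔
      EndsAt (fun i => b (1 + i)) (consSeq (u - b 0 + v 0) fun i => v (1 + i)) l := by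
  rw [EndsAt, loadOne_consSeq_succ hu, EndsAt, add_comm l 1]

/-- Bridge between the recursive description, suited to first step analysis in the residual workload
`u`, and the path description, where `u` is the service time of the first job. -/
lemma exists_endsWithin_iff (B : Set ℝ) (u : ℝ) (p : (ℕ → ℝ) × (ℕ → ℝ)) :
    (∃ N, EndsWithin B N u p) ↔ ∃ l, EndsAt p.1 (consSeq u p.2) l ∧
      (∀ i < l, ¬ EndsAt p.1 (consSeq u p.2) i) ∧ ∀ i < l, p.2 i ∈ B := by
  constructor
  · rintro ⟨N, hN⟩
    induction N generalizing u p with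
    | zero => exact hN.elim
    | succ N ih =>
      by_cases hu : u ≤ p.1 0
      · exact ⟨0, hu, by simp, by simp⟩
      · obtain ⟨h1, h2⟩ := hN.resolve_left hu
        obtain ⟨l, hl, hl', hB⟩ := ih _ _ h2
        have hu' := not_le.1 hu
        refine ⟨l + 1, (endsAt_consSeq_succ hu' l).2 hl, ?_, ?_⟩
        · rintro (_ | i) hi
          · exact hu
          · exact fun hc => hl' i (by omega) ((endsAt_consSeq_succ hu' i).1 hc)
        · rintro (_ | i) hi
          · exact h1
          · have := hB i (by omega)
            rwa [add_comm i 1]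
  · rintro ⟨l, hl, hl', hB⟩
    induction l generalizing u p with
    | zero => exact ⟨1, Or.inl hl⟩
    | succ l ih =>
      have hu : p.1 0 < u := not_le.1 (hl' 0 (Nat.succ_pos l))
      obtain ⟨N, hN⟩ := ih (u - p.1 0 + p.2 0) (shiftPath 1 p) ((endsAt_consSeq_succ hu l).1 hl)
        (fun i hi hc => hl' (i + 1) (by omega) ((endsAt_consSeq_succ hu i).2 hc))
        fun i hi => hB (1 + i) (by omega)
      exact ⟨N + 1, Or.inr ⟨hB 0 (Nat.succ_pos l), hN⟩⟩

lemma embLoad_zero_consSeq_le_iff {u x : ℝ} {p : (ℕ → ℝ) × (ℕ → ℝ)}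
    (h : ∃ j, EndsAt p.1 (consSeq u p.2) j) :
    embLoad 0 (p.1, consSeq u p.2) ≤ x ↔ u ≤ x ∧ ∃ N, EndsWithin (Iic x) N u p := by
  classical
  have hj := Nat.find_spec h
  have hmin : ∀ i < Nat.find h, ¬ EndsAt p.1 (consSeq u p.2) i := fun i hi => Nat.find_min h hi
  have e : embLoad 0 (p.1, consSeq u p.2) = loadTwo p.1 (consSeq u p.2) (Nat.find h) := by
    rw [embLoad, nth_eq_of_endsAt hj]
    unfold endCount
    rw [Nat.count_eq_card_filter_range, Finset.card_eq_zero, Finset.filter_eq_empty_iff]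
    exact fun i hi => hmin i (Finset.mem_range.1 hi)
  rw [e, loadTwo_eq_sup' hmin, Finset.sup'_le_iff, exists_endsWithin_iff]
  constructor
  · refine fun H => ⟨H 0 (by simp), _, hj, hmin, fun i hi => ?_⟩
    exact H (i + 1) (by simpa using hi)
  · rintro ⟨hu, l, hl, hl', hB⟩ i hi
    have hlj : Nat.find h ≤ l := Nat.find_min' h hl
    cases i with
    | zero => exact hu
    | succ i => exact hB i (by have := Finset.mem_range.1 hi; omega)

lemma measurableSet_endsWithin {B : Set ℝ} (hB : MeasurableSet B) (N : ℕ) :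
    MeasurableSet {q : ℝ × ((ℕ → ℝ) × (ℕ → ℝ)) | EndsWithin B N q.1 q.2} := by
  induction N with
  | zero => simp [EndsWithin]
  | succ N ih =>
    have h0 : Measurable fun q : ℝ × ((ℕ → ℝ) × (ℕ → ℝ)) => q.2.1 0 := by fun_prop
    have h1 : Measurable fun q : ℝ × ((ℕ → ℝ) × (ℕ → ℝ)) => q.2.2 0 := by fun_prop
    have h2 : Measurable (shiftPath 1) := by unfold shiftPath; fun_prop
    exact (measurableSet_le measurable_fst h0).union ((h1 hB).inter
      ((((measurable_fst.sub h0).add h1).prodMk (h2.comp measurable_snd)) ih))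

section law

variable {r : ℝ} {μ : Measure ℝ}

/-- The probability that a busy period with initial workload `u` ends before `N` further jobs have
arrived, whose service times belong to `B`. -/
noncomputable def endProb (r : ℝ) (μ : Measure ℝ) (B : Set ℝ) (N : ℕ) (u : ℝ) : ℝ :=
  (pathLaw r μ).real {p | EndsWithin B N u p}

/-- The contribution to the first step equation of the event that a job arrives in the busy
period. -/
noncomputable def stepOp (r : ℝ) (μ : Measure ℝ) (B : Set ℝ) (g : ℝ → ℝ) (u : ℝ) : ℝ :=
  ∫ z, {z : ℝ × ℝ | z.1 < u ∧ z.2 ∈ B}.indicator (fun z => g (u - z.1 + z.2)) z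
    ∂((expMeasure r).prod μ)

lemma endProb_nonneg (B : Set ℝ) (N : ℕ) (u : ℝ) : 0 ≤ endProb r μ B N u := measureReal_nonneg

lemma stepOp_const_mul (B : Set ℝ) (c : ℝ) (g : ℝ → ℝ) (u : ℝ) :
    stepOp r μ B (fun y => c * g y) u = c * stepOp r μ B g u := by
  rw [stepOp, stepOp, ← integral_const_mul]
  congr 1
  ext z
  by_cases h : z.1 < u ∧ z.2 ∈ B <;> simp [h]

lemma expMeasure_real_Ici (hr : 0 < r) {u : ℝ} (hu : 0 ≤ u) :
    (expMeasure r).real (Ici u) = Real.exp (-(r * u)) := by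
  rw [measureReal_def, expMeasure_Ici hr, max_eq_left hu,
    ENNReal.toReal_ofReal (Real.exp_pos _).le]

variable [IsProbabilityMeasure μ] [IsProbabilityMeasure (expMeasure r)]

lemma endProb_le_one (B : Set ℝ) (N : ℕ) (u : ℝ) : endProb r μ B N u ≤ 1 := measureReal_le_one

lemma measurable_endProb {B : Set ℝ} (hB : MeasurableSet B) (N : ℕ) :
    Measurable (endProb r μ B N) :=
  (measurable_measure_prodMk_left (measurableSet_endsWithin hB N)).ennreal_toReal

lemma measurableSet_step (u : ℝ) {B : Set ℝ} (hB : MeasurableSet B) :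
    MeasurableSet {z : ℝ × ℝ | z.1 < u ∧ z.2 ∈ B} :=
  (measurableSet_lt measurable_fst measurable_const).inter (measurable_snd hB)

lemma integrable_step (hμ : ∀ᵐ x ∂μ, 0 ≤ x) {B : Set ℝ} (hB : MeasurableSet B) {g : ℝ → ℝ}
    (hg : Measurable g) {C : ℝ} (hC : ∀ u, 0 ≤ u → |g u| ≤ C) (u : ℝ) :
    Integrable ({z : ℝ × ℝ | z.1 < u ∧ z.2 ∈ B}.indicator (fun z => g (u - z.1 + z.2)))
      ((expMeasure r).prod μ) := by
  refine Integrable.of_bound (C := C) ?_ ?_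
  · exact ((hg.comp (by fun_prop)).indicator (measurableSet_step u hB)).aestronglyMeasurable
  · have h2 : ∀ᵐ z ∂((expMeasure r).prod μ), 0 ≤ z.2 :=
      (measurePreserving_snd (μ := expMeasure r) (ν := μ)).quasiMeasurePreserving.ae hμ
    filter_upwards [h2] with z hz
    by_cases h : z ∈ {z : ℝ × ℝ | z.1 < u ∧ z.2 ∈ B}
    · rw [indicator_of_mem h]
      exact hC _ (by linarith [h.1])
    · rw [indicator_of_notMem h]
      simpa using (abs_nonneg _).trans (hC 0 le_rfl)

lemma stepOp_mono (hμ : ∀ᵐ x ∂μ, 0 ≤ x) {B B' : Set ℝ} (hB : MeasurableSet B)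
    (hB' : MeasurableSet B') (hBB : B ⊆ B') {g g' : ℝ → ℝ}
    (hg : Measurable g) (hg' : Measurable g') {C C' : ℝ} (hC : ∀ u, 0 ≤ u → |g u| ≤ C)
    (hC' : ∀ u, 0 ≤ u → |g' u| ≤ C') (h0 : ∀ u, 0 ≤ u → 0 ≤ g' u) (h : ∀ u, 0 ≤ u → g u ≤ g' u)
    (u : ℝ) : stepOp r μ B g u ≤ stepOp r μ B' g' u := by
  refine integral_mono_ae (integrable_step hμ hB hg hC u) (integrable_step hμ hB' hg' hC' u) ?_
  have h2 : ∀ᵐ z ∂((expMeasure r).prod μ), 0 ≤ z.2 :=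
    (measurePreserving_snd (μ := expMeasure r) (ν := μ)).quasiMeasurePreserving.ae hμ
  filter_upwards [h2] with z hz
  classical
  simp only [indicator_apply, mem_ofPred_eq]
  split_ifs with h1 h2 h3
  · exact h _ (by linarith [h1.1])
  · exact absurd ⟨h1.1, hBB h1.2⟩ h2
  · exact h0 _ (by linarith [h3.1])
  · exact le_rfl

lemma stepOp_sub (hμ : ∀ᵐ x ∂μ, 0 ≤ x) {B : Set ℝ} (hB : MeasurableSet B) {g g' : ℝ → ℝ}
    (hg : Measurable g) (hg' : Measurable g') {C C' : ℝ} (hC : ∀ u, 0 ≤ u → |g u| ≤ C)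
    (hC' : ∀ u, 0 ≤ u → |g' u| ≤ C') (u : ℝ) :
    stepOp r μ B (fun y => g y - g' y) u = stepOp r μ B g u - stepOp r μ B g' u := by
  rw [stepOp, stepOp, stepOp,
    ← integral_sub (integrable_step hμ hB hg hC u) (integrable_step hμ hB hg' hC' u)]
  congr 1
  ext z
  by_cases h : z.1 < u ∧ z.2 ∈ B <;> simp [h]

/-- The first step equation. -/
lemma endProb_succ (hr : 0 < r) {B : Set ℝ} (hB : MeasurableSet B) (N : ℕ) {u : ℝ}
    (hu : 0 ≤ u) :
    endProb r μ B (N + 1) u = Real.exp (-(r * u)) + stepOp r μ B (endProb r μ B N) u := by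
  have hm : MeasurableSet {p : (ℕ → ℝ) × (ℕ → ℝ) | EndsWithin B (N + 1) u p} :=
    measurable_prodMk_left (measurableSet_endsWithin hB (N + 1))
  have hpre := (measurePreserving_consPath r μ).measurable hm
  rw [endProb, measureReal_def, ← (measurePreserving_consPath r μ).measure_preimage
    hm.nullMeasurableSet, Measure.prod_apply hpre, ← integral_toReal
    (measurable_measure_prodMk_left hpre).aemeasurable (by simp)]
  have e : ∀ z : ℝ × ℝ, (pathLaw r μ (Prod.mk z ⁻¹' ((fun p : (ℝ × ℝ) × ((ℕ → ℝ) × (ℕ → ℝ)) =>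
      (consSeq p.1.1 p.2.1, consSeq p.1.2 p.2.2)) ⁻¹'
        {p : (ℕ → ℝ) × (ℕ → ℝ) | EndsWithin B (N + 1) u p}))).toReal =
      (Ici u ×ˢ univ).indicator (fun _ => (1 : ℝ)) z + {z : ℝ × ℝ | z.1 < u ∧ z.2 ∈ B}.indicator
        (fun z => endProb r μ B N (u - z.1 + z.2)) z := by
    intro z
    have : Prod.mk z ⁻¹' ((fun p : (ℝ × ℝ) × ((ℕ → ℝ) × (ℕ → ℝ)) =>
      (consSeq p.1.1 p.2.1, consSeq p.1.2 p.2.2)) ⁻¹'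
        {p : (ℕ → ℝ) × (ℕ → ℝ) | EndsWithin B (N + 1) u p}) =
        {q | u ≤ z.1 ∨ (z.2 ∈ B ∧ EndsWithin B N (u - z.1 + z.2) q)} := by
      ext q
      simp only [mem_preimage, mem_ofPred_eq, EndsWithin, shiftPath_consSeq]
      rfl
    rw [this]
    by_cases h1 : u ≤ z.1
    · simp [h1, not_lt.2 h1]
    · by_cases h2 : z.2 ∈ B
      · simp [h1, not_le.1 h1, h2, endProb, measureReal_def]
      · simp [h1, h2]
  simp_rw [e]
  have hI : MeasurableSet (Ici u ×ˢ (univ : Set ℝ)) := measurableSet_Ici.prod MeasurableSet.univ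
  rw [integral_add]
  · rw [integral_indicator_const _ hI, measureReal_prod_prod, expMeasure_real_Ici hr hu]
    simp [stepOp]
  · exact (integrable_const _).indicator hI
  · refine Integrable.of_bound (C := 1) (((measurable_endProb hB N).comp
      (by fun_prop)).indicator (measurableSet_step u hB)).aestronglyMeasurable
      (Filter.Eventually.of_forall fun z => ?_)
    classical
    rw [indicator_apply]
    split_ifs
    · rw [Real.norm_eq_abs, abs_of_nonneg (endProb_nonneg _ _ _)]
      exact endProb_le_one _ _ _
    · simp

/-- On exponentials the step operator factors into an integral over the interarrival time, which is
elementary, and a Laplace transform of the service law restricted to `B`. The factor `1 - q` is kept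
on the left so that `q = 1` is allowed. -/
lemma stepOp_exp (hr : 0 < r) {B : Set ℝ} (hB : MeasurableSet B) (q : ℝ) {u : ℝ} (hu : 0 ≤ u) :
    (1 - q) * stepOp r μ B (fun y => Real.exp (-(r * q * y))) u =
      (Real.exp (-(r * q * u)) - Real.exp (-(r * u))) * ∫ w in B, Real.exp (-(r * q * w)) ∂μ := by
  have e : ∀ z : ℝ × ℝ, {z : ℝ × ℝ | z.1 < u ∧ z.2 ∈ B}.indicator
      (fun z => Real.exp (-(r * q * (u - z.1 + z.2)))) z =
      (Iio u).indicator (fun s => Real.exp (-(r * q * (u - s)))) z.1 *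
        B.indicator (fun w => Real.exp (-(r * q * w))) z.2 := by
    intro z
    by_cases h1 : z.1 < u <;> by_cases h2 : z.2 ∈ B <;> simp [h1, h2, ← Real.exp_add]
    ring
  rw [stepOp]
  simp_rw [e]
  rw [integral_prod_mul, integral_indicator hB, ← mul_assoc]
  congr 1
  rw [integral_expMeasure hr]
  have e2 : ∫ x in Ioi 0, r * Real.exp (-(r * x)) *
      (Iio u).indicator (fun s => Real.exp (-(r * q * (u - s)))) x =
      ∫ x in (0 : ℝ)..u, r * Real.exp (-(r * x) + -(r * q * (u - x))) := by
    rw [intervalIntegral.integral_of_le hu, ← integral_Ioc_eq_integral_Ioo.symm,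
      ← Ioi_inter_Iio, ← setIntegral_indicator measurableSet_Iio]
    refine integral_congr_ae (Filter.Eventually.of_forall fun x => ?_)
    by_cases h : x < u
    · simp [h, Real.exp_add, mul_assoc]
    · simp [h]
  rw [e2, ← intervalIntegral.integral_const_mul]
  have hd : ∀ x ∈ uIcc 0 u, HasDerivAt (fun x => -Real.exp (-(r * x) + -(r * q * (u - x))))
      ((1 - q) * (r * Real.exp (-(r * x) + -(r * q * (u - x))))) x := by
    intro x _
    have h1 : HasDerivAt (fun x => -(r * x) + -(r * q * (u - x))) (-(r * 1) + -(r * q * (-1))) x :=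
      (((hasDerivAt_id x).const_mul r).neg).add
        ((((hasDerivAt_id x).const_sub u).const_mul (r * q)).neg)
    exact h1.exp.neg.congr_deriv (by ring)
  rw [intervalIntegral.integral_eq_sub_of_hasDerivAt hd
    (Continuous.intervalIntegrable (by fun_prop) _ _)]
  simp
  ring

end law

lemma abs_exp_neg_le {c : ℝ} (hc : 0 ≤ c) {u : ℝ} (hu : 0 ≤ u) : |Real.exp (-(c * u))| ≤ 1 := by
  rw [abs_of_pos (Real.exp_pos _), Real.exp_le_one_iff]
  exact neg_nonpos.2 (mul_nonneg hc hu)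

/-- Integrate exp(-x) ≥ 1 - x and use load at most 1. Strictness comes from strict convexity, since
a positive mean excludes a service law concentrated at 0. Hence the critical load is covered. -/
lemma one_sub_lt_integral_exp {r : ℝ} {μ : Measure ℝ} [IsProbabilityMeasure μ] (hr : 0 < r)
    (hμ : ∀ᵐ x ∂μ, 0 ≤ x) (hint : Integrable (fun x => x) μ)
    (hpos : 0 < ∫ x, x ∂μ) (hρ : r * ∫ x, x ∂μ ≤ 1) {q : ℝ} (hq : 0 < q) :
    1 - q < ∫ w, Real.exp (-(r * q * w)) ∂μ := by
  have hrq : 0 < r * q := mul_pos hr hq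
  have hi : Integrable (fun w => Real.exp (-(r * q * w))) μ :=
    Integrable.of_bound (by fun_prop) (C := 1) (hμ.mono fun w hw => abs_exp_neg_le hrq.le hw)
  have hi1 : Integrable (fun w => 1 - r * q * w) μ :=
    (integrable_const 1).sub (hint.const_mul _)
  have hi2 : Integrable (fun w => Real.exp (-(r * q * w)) - (1 - r * q * w)) μ := hi.sub hi1
  have hnn : ∀ w : ℝ, 0 ≤ Real.exp (-(r * q * w)) - (1 - r * q * w) := fun w => by
    linarith [Real.add_one_le_exp (-(r * q * w))]
  have hp : 0 < ∫ w, (Real.exp (-(r * q * w)) - (1 - r * q * w)) ∂μ := by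
    refine lt_of_le_of_ne (integral_nonneg hnn) fun h0 => ?_
    have h1 := (integral_eq_zero_iff_of_nonneg hnn hi2).1 h0.symm
    have h2 : (fun x : ℝ => x) =ᵐ[μ] 0 := by
      filter_upwards [h1] with w hw
      by_contra hne
      have hne' : w ≠ 0 := hne
      have := Real.add_one_lt_exp (x := -(r * q * w)) (neg_ne_zero.2 (mul_ne_zero hrq.ne' hne'))
      have hw' : Real.exp (-(r * q * w)) - (1 - r * q * w) = 0 := hw
      linarith
    rw [integral_congr_ae h2] at hpos
    simp at hpos
  have e1 : ∫ w, (1 - r * q * w) ∂μ = 1 - r * q * ∫ x, x ∂μ := by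
    rw [integral_sub (integrable_const 1) (hint.const_mul _), integral_const_mul]
    simp
  rw [integral_sub hi hi1, e1] at hp
  nlinarith

section law

variable {r : ℝ} {μ : Measure ℝ} [IsProbabilityMeasure μ] [IsProbabilityMeasure (expMeasure r)]

lemma abs_endProb_le (B : Set ℝ) (N : ℕ) (u : ℝ) : |endProb r μ B N u| ≤ 1 := by
  rw [abs_of_nonneg (endProb_nonneg _ _ _)]
  exact endProb_le_one _ _ _

lemma stepOp_one (hr : 0 < r) {u : ℝ} (hu : 0 ≤ u) :
    stepOp r μ univ (fun _ => 1) u = 1 - Real.exp (-(r * u)) := by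
  have := stepOp_exp (μ := μ) hr MeasurableSet.univ 0 hu
  simpa using this

/-- Comparison of the hitting probabilities with the exponential solution of the first step
equation. -/
lemma exp_sub_endProb_bounds (hr : 0 < r) (hμ : ∀ᵐ x ∂μ, 0 ≤ x) {B : Set ℝ} (hB : MeasurableSet B)
    {q : ℝ} (hq0 : 0 ≤ q) (hq : 1 - q = ∫ w in B, Real.exp (-(r * q * w)) ∂μ) (N : ℕ) :
    ∀ u, 0 ≤ u → 0 ≤ Real.exp (-(r * q * u)) - endProb r μ B N u ∧
      Real.exp (-(r * q * u)) - endProb r μ B N u ≤ 1 - endProb r μ univ N u := by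
  have hrq : 0 ≤ r * q := mul_nonneg hr.le hq0
  have hg : Measurable fun y : ℝ => Real.exp (-(r * q * y)) := by fun_prop
  have hfix : ∀ u, 0 ≤ u → Real.exp (-(r * q * u)) =
      Real.exp (-(r * u)) + stepOp r μ B (fun y => Real.exp (-(r * q * y))) u := by
    intro u hu
    have h := stepOp_exp (μ := μ) hr hB q hu
    rw [← hq] at h
    -- For `q = 1` the factor cannot be cancelled. Then the integral over `B` vanishes, so `B` is a
    -- null set and the step term is zero.
    by_cases h1 : 1 - q = 0
    · have : q = 1 := by linarith
      subst this
      have hz : stepOp r μ B (fun y => Real.exp (-(r * 1 * y))) u = 0 := by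
        have hB0 : μ B = 0 := by
          have h0 : ∫ w in B, Real.exp (-(r * 1 * w)) ∂μ = 0 := by linarith
          by_contra hne
          have : NeZero (μ.restrict B) := ⟨by rwa [Ne, Measure.restrict_eq_zero]⟩
          have hint : Integrable (fun w => Real.exp (-(r * 1 * w))) (μ.restrict B) :=
            Integrable.of_bound hg.aestronglyMeasurable (C := 1)
              (ae_restrict_of_ae (hμ.mono fun w hw => abs_exp_neg_le hrq hw))
          exact (integral_exp_pos (μ := μ.restrict B) (f := fun w => -(r * 1 * w)) hint).ne' h0
        rw [stepOp, integral_eq_zero_of_ae]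
        have h2 : ∀ᵐ z ∂((expMeasure r).prod μ), z.2 ∉ B :=
          (measurePreserving_snd (μ := expMeasure r) (ν := μ)).quasiMeasurePreserving.ae
            (measure_eq_zero_iff_ae_notMem.1 hB0)
        filter_upwards [h2] with z hz
        simp [hz]
      rw [hz]; simp
    · have := mul_left_cancel₀ h1 (h.trans (mul_comm _ _))
      linarith
  induction N with
  | zero =>
    intro u hu
    have := abs_exp_neg_le hrq hu
    rw [abs_of_pos (Real.exp_pos _)] at this
    simp [endProb, EndsWithin, this, (Real.exp_pos _).le]
  | succ N ih =>
    intro u hu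
    have hb : ∀ u, 0 ≤ u → |Real.exp (-(r * q * u)) - endProb r μ B N u| ≤ 2 := fun u hu =>
      (abs_sub _ _).trans (by linarith [abs_exp_neg_le hrq hu, abs_endProb_le (r := r) (μ := μ) B N u])
    have hb' : ∀ u, 0 ≤ u → |1 - endProb r μ univ N u| ≤ 2 := fun u hu =>
      (abs_sub _ _).trans (by
        rw [abs_one]; linarith [abs_endProb_le (r := r) (μ := μ) univ N u])
    have hm := measurable_endProb (r := r) (μ := μ) hB N
    have hm' := measurable_endProb (r := r) (μ := μ) MeasurableSet.univ N
    -- Both differences evolve by a step operator without source term, and the operator for `B` is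
    -- dominated by the one for `univ`.
    have e1 : Real.exp (-(r * q * u)) - endProb r μ B (N + 1) u =
        stepOp r μ B (fun y => Real.exp (-(r * q * y)) - endProb r μ B N y) u := by
      rw [stepOp_sub hμ hB hg hm (fun _ h => abs_exp_neg_le hrq h) fun u _ => abs_endProb_le B N u,
        endProb_succ hr hB N hu, hfix u hu]
      ring
    have e2 : 1 - endProb r μ univ (N + 1) u =
        stepOp r μ univ (fun y => 1 - endProb r μ univ N y) u := by
      rw [stepOp_sub hμ MeasurableSet.univ measurable_const hm' (C := 1) (fun _ _ => by simp)
        fun u _ => abs_endProb_le univ N u, endProb_succ hr MeasurableSet.univ N hu,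
        stepOp_one hr hu]
      ring
    rw [e1, e2]
    refine ⟨integral_nonneg_of_ae ?_, stepOp_mono
      (g := fun y => Real.exp (-(r * q * y)) - endProb r μ B N y)
      (g' := fun y => 1 - endProb r μ univ N y) hμ hB MeasurableSet.univ (subset_univ _)
      (hg.sub hm) (measurable_const.sub hm') hb hb' ?_ (fun y hy => (ih y hy).2) u⟩
    · have h2 : ∀ᵐ z ∂((expMeasure r).prod μ), 0 ≤ z.2 :=
        (measurePreserving_snd (μ := expMeasure r) (ν := μ)).quasiMeasurePreserving.ae hμ
      filter_upwards [h2] with z hz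
      by_cases h : z.1 < u ∧ z.2 ∈ B
      · have := (ih (u - z.1 + z.2) (by linarith [h.1])).1
        simpa [h] using this
      · simp [h]
    · exact fun y _ => sub_nonneg.2 (endProb_le_one _ _ _)

/-- Since `1 - q` is less than the full Laplace transform, the exponential solves the step equation
with a damping factor θ < 1 in front of the operator. Iterating from zero then loses at most θ^N. -/
lemma exp_sub_pow_le_endProb (hr : 0 < r) (hμ : ∀ᵐ x ∂μ, 0 ≤ x) {q : ℝ} (hq0 : 0 < q)
    (hq1 : q < 1) (hc : 1 - q < ∫ w, Real.exp (-(r * q * w)) ∂μ) (N : ℕ) :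
    ∀ u, 0 ≤ u → Real.exp (-(r * q * u)) -
      ((1 - q) / ∫ w, Real.exp (-(r * q * w)) ∂μ) ^ N ≤ endProb r μ univ N u := by
  have hrq : 0 ≤ r * q := (mul_pos hr hq0).le
  have hg : Measurable fun y : ℝ => Real.exp (-(r * q * y)) := by fun_prop
  set c := ∫ w, Real.exp (-(r * q * w)) ∂μ with hcdef
  have hc0 : 0 < c := lt_trans (by linarith) hc
  set θ := (1 - q) / c with hθdef
  have hθ0 : 0 < θ := div_pos (by linarith) hc0
  have hθ1 : θ ≤ 1 := (div_le_one hc0).2 hc.le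
  have hfix : ∀ u, 0 ≤ u → Real.exp (-(r * q * u)) =
      Real.exp (-(r * u)) + θ * stepOp r μ univ (fun y => Real.exp (-(r * q * y))) u := by
    intro u hu
    have h := stepOp_exp (μ := μ) hr MeasurableSet.univ q hu
    rw [setIntegral_univ, ← hcdef] at h
    have : θ * stepOp r μ univ (fun y => Real.exp (-(r * q * y))) u =
        Real.exp (-(r * q * u)) - Real.exp (-(r * u)) := by
      rw [hθdef, div_mul_eq_mul_div, h, mul_div_assoc, div_self hc0.ne', mul_one]
    linarith
  induction N with
  | zero =>
    intro u hu
    have := abs_exp_neg_le hrq hu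
    rw [abs_of_pos (Real.exp_pos _)] at this
    simpa using this.trans (le_add_of_nonneg_left (endProb_nonneg _ _ _))
  | succ N ih =>
    intro u hu
    have hm := measurable_endProb (r := r) (μ := μ) MeasurableSet.univ N
    have h1 : stepOp r μ univ (fun y => Real.exp (-(r * q * y)) - θ ^ N) u ≤
        stepOp r μ univ (endProb r μ univ N) u := by
      refine stepOp_mono hμ MeasurableSet.univ MeasurableSet.univ (subset_univ _) (hg.sub_const _) hm
        (C := 2) (fun y hy => (abs_sub _ _).trans ?_) (fun y _ => abs_endProb_le _ _ _)
        (fun y _ => endProb_nonneg _ _ _) ih u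
      have : |θ ^ N| ≤ 1 := by
        rw [abs_of_pos (pow_pos hθ0 N)]; exact pow_le_one₀ hθ0.le hθ1
      linarith [abs_exp_neg_le hrq hy]
    rw [stepOp_sub hμ MeasurableSet.univ hg measurable_const
      (fun _ h => abs_exp_neg_le hrq h) (fun _ _ => le_rfl)] at h1
    have h2 : stepOp r μ univ (fun _ => θ ^ N) u = θ ^ N * (1 - Real.exp (-(r * u))) := by
      rw [← stepOp_one (μ := μ) hr hu, ← stepOp_const_mul]; simp
    have h3 : 0 ≤ stepOp r μ univ (endProb r μ univ N) u :=
      integral_nonneg fun z => indicator_nonneg (fun _ _ => endProb_nonneg _ _ _) _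
    rw [endProb_succ hr MeasurableSet.univ N hu, hfix u hu]
    have h4 : θ ^ N * (1 - Real.exp (-(r * u))) ≤ θ ^ N :=
      mul_le_of_le_one_right (pow_pos hθ0 N).le (by linarith [Real.exp_pos (-(r * u))])
    have h5 : θ * (stepOp r μ univ (fun y => Real.exp (-(r * q * y))) u - θ ^ N) ≤
        θ * stepOp r μ univ (endProb r μ univ N) u :=
      mul_le_mul_of_nonneg_left (by linarith) hθ0.le
    have h6 : θ * stepOp r μ univ (endProb r μ univ N) u ≤ stepOp r μ univ (endProb r μ univ N) u :=
      mul_le_of_le_one_left h3 hθ1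
    rw [pow_succ]
    linarith

lemma tendsto_endProb (B : Set ℝ) (u : ℝ) :
    Tendsto (fun N => endProb r μ B N u) atTop
      (𝓝 ((pathLaw r μ).real {p | ∃ N, EndsWithin B N u p})) := by
  have h : Monotone fun N => {p : (ℕ → ℝ) × (ℕ → ℝ) | EndsWithin B N u p} :=
    fun N M hNM p hp => EndsWithin.mono_nat hNM hp
  have e : {p : (ℕ → ℝ) × (ℕ → ℝ) | ∃ N, EndsWithin B N u p} = ⋃ N, {p | EndsWithin B N u p} := by
    ext p; simp
  rw [e]
  exact (ENNReal.tendsto_toReal (measure_ne_top _ _)).comp (tendsto_measure_iUnion_atTop h)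

/-- Busy periods end almost surely: let N → ∞ in `exp_sub_pow_le_endProb` for fixed `q`, then `q` ↓
0. No strict stability is needed. -/
lemma tendsto_endProb_univ (hr : 0 < r) (hμ : ∀ᵐ x ∂μ, 0 ≤ x) (hint : Integrable (fun x => x) μ)
    (hpos : 0 < ∫ x, x ∂μ) (hρ : r * ∫ x, x ∂μ ≤ 1) {u : ℝ} (hu : 0 ≤ u) :
    Tendsto (fun N => endProb r μ univ N u) atTop (𝓝 1) := by
  have hlim := tendsto_endProb (r := r) (μ := μ) univ u
  suffices h : (pathLaw r μ).real {p | ∃ N, EndsWithin univ N u p} = 1 by rwa [h] at hlim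
  refine le_antisymm measureReal_le_one ?_
  have h1 : ∀ q, 0 < q → q < 1 → Real.exp (-(r * q * u)) ≤
      (pathLaw r μ).real {p | ∃ N, EndsWithin univ N u p} := by
    intro q hq0 hq1
    have hc := one_sub_lt_integral_exp hr hμ hint hpos hρ hq0
    have hc0 : 0 < ∫ w, Real.exp (-(r * q * w)) ∂μ := lt_trans (by linarith) hc
    have hθ : Tendsto (fun N : ℕ => ((1 - q) / ∫ w, Real.exp (-(r * q * w)) ∂μ) ^ N) atTop (𝓝 0) :=
      tendsto_pow_atTop_nhds_zero_of_lt_one (div_nonneg (by linarith) hc0.le)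
        ((div_lt_one hc0).2 hc)
    have := le_of_tendsto_of_tendsto' (hθ.const_sub (Real.exp (-(r * q * u)))) hlim
      fun N => exp_sub_pow_le_endProb hr hμ hq0 hq1 hc N u hu
    simpa using this
  have h2 : Tendsto (fun q => Real.exp (-(r * q * u))) (𝓝[>] 0) (𝓝 1) := by
    have : Continuous fun q => Real.exp (-(r * q * u)) := by fun_prop
    simpa using (this.tendsto 0).mono_left nhdsWithin_le_nhds
  refine le_of_tendsto h2 ?_
  filter_upwards [Ioo_mem_nhdsGT (show (0 : ℝ) < 1 by norm_num)] with q hq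
  exact h1 q hq.1 hq.2

lemma ae_exists_endsAt (hr : 0 < r) (hμ : ∀ᵐ x ∂μ, 0 ≤ x) (hint : Integrable (fun x => x) μ)
    (hpos : 0 < ∫ x, x ∂μ) (hρ : r * ∫ x, x ∂μ ≤ 1) :
    ∀ᵐ p ∂(pathLaw r μ), ∃ j, EndsAt p.1 p.2 j := by
  have hm : MeasurableSet {p : (ℕ → ℝ) × (ℕ → ℝ) | ∃ j, EndsAt p.1 p.2 j} := by
    rw [Set.ofPred_exists]; exact MeasurableSet.iUnion measurableSet_endsAt
  rw [← (measurePreserving_consService r μ).map_eq, ae_map_iff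
    (measurePreserving_consService r μ).measurable.aemeasurable hm]
  refine Measure.ae_prod_iff_ae_ae ((measurePreserving_consService r μ).measurable hm) |>.2 ?_
  filter_upwards [hμ] with u hu
  have h1 := tendsto_nhds_unique (tendsto_endProb (r := r) (μ := μ) univ u)
    (tendsto_endProb_univ hr hμ hint hpos hρ hu)
  have hm2 : MeasurableSet {p : (ℕ → ℝ) × (ℕ → ℝ) | ∃ N, EndsWithin univ N u p} := by
    rw [Set.ofPred_exists]
    exact MeasurableSet.iUnion fun N =>
      measurable_prodMk_left (measurableSet_endsWithin MeasurableSet.univ N)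
  have h2 : ∀ᵐ p ∂(pathLaw r μ), ∃ N, EndsWithin univ N u p := by
    refine (mem_ae_iff_prob_eq_one hm2).2 ?_
    rwa [measureReal_def, ENNReal.toReal_eq_one_iff] at h1
  filter_upwards [h2] with p hp
  obtain ⟨l, hl, -⟩ := (exists_endsWithin_iff univ u p).1 hp
  exact ⟨l, hl⟩

/-- The distribution of the largest service time in a busy period. -/
lemma pathLaw_embLoad_zero (hr : 0 < r) (hμ : ∀ᵐ x ∂μ, 0 ≤ x) (hint : Integrable (fun x => x) μ)
    (hpos : 0 < ∫ x, x ∂μ) (hρ : r * ∫ x, x ∂μ ≤ 1) (x : ℝ) {q : ℝ} (hq0 : 0 ≤ q)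
    (hq : 1 - q = ∫ w in Iic x, Real.exp (-(r * q * w)) ∂μ) :
    (pathLaw r μ).real {p | embLoad 0 p ≤ x} = 1 - q := by
  have hm : MeasurableSet {p : (ℕ → ℝ) × (ℕ → ℝ) | embLoad 0 p ≤ x} :=
    measurableSet_le (measurable_embLoad 0) measurable_const
  have hpre := (measurePreserving_consService r μ).measurable hm
  rw [measureReal_def, ← (measurePreserving_consService r μ).measure_preimage hm.nullMeasurableSet,
    Measure.prod_apply hpre, ← integral_toReal (measurable_measure_prodMk_left hpre).aemeasurable
    (by simp), hq, ← integral_indicator measurableSet_Iic]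
  have hfin := ae_exists_endsAt hr hμ hint hpos hρ
  have hmE : MeasurableSet {p : (ℕ → ℝ) × (ℕ → ℝ) | ∃ j, EndsAt p.1 p.2 j} := by
    rw [Set.ofPred_exists]; exact MeasurableSet.iUnion measurableSet_endsAt
  rw [← (measurePreserving_consService r μ).map_eq, ae_map_iff
    (measurePreserving_consService r μ).measurable.aemeasurable hmE] at hfin
  have hfin2 := Measure.ae_ae_of_ae_prod hfin
  refine integral_congr_ae ?_
  filter_upwards [hμ, hfin2] with u hu hf
  by_cases hux : u ≤ x
  · rw [indicator_of_mem (show u ∈ Iic x from hux)]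
    -- The gap between the exponential and the truncated probability is at most the probability that
    -- the busy period has not yet ended, which tends to 0. This works for any nonnegative solution
    -- `q`, so uniqueness of `q` need not be proved separately.
    have h1 : Tendsto (fun N => endProb r μ (Iic x) N u) atTop (𝓝 (Real.exp (-(r * q * u)))) := by
      have hb := fun N => exp_sub_endProb_bounds hr hμ (measurableSet_Iic (a := x)) hq0 hq N u hu
      have h0 := squeeze_zero (fun N => (hb N).1) (fun N => (hb N).2)
        (by simpa using (tendsto_endProb_univ hr hμ hint hpos hρ hu).const_sub 1)
      simpa using h0.const_sub (Real.exp (-(r * q * u)))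
    rw [← tendsto_nhds_unique (tendsto_endProb _ _) h1, measureReal_def]
    congr 1
    refine measure_congr ?_
    filter_upwards [hf] with p hp
    refine propext ((embLoad_zero_consSeq_le_iff hp).trans ?_)
    exact and_iff_right hux
  · rw [indicator_of_notMem (show u ∉ Iic x from hux)]
    rw [measure_eq_zero_iff_ae_notMem.2, ENNReal.toReal_zero]
    filter_upwards [hf] with p hp hc
    exact hux ((embLoad_zero_consSeq_le_iff hp).1 hc).1

end law

/-- Intermediate values suffice: `pathLaw_embLoad_zero` identifies the law from whichever solution
is found. -/
lemma exists_fixedPoint {r : ℝ} {μ : Measure ℝ} [IsProbabilityMeasure μ] (hr : 0 < r) (hμ : ∀ᵐ x ∂μ, 0 ≤ x) (x : ℝ) :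
    ∃ q ∈ Icc (0 : ℝ) 1, 1 - q = ∫ w in Iic x, Real.exp (-(r * q * w)) ∂μ := by
  have hcont : ContinuousOn (fun q => 1 - q - ∫ w in Iic x, Real.exp (-(r * q * w)) ∂μ)
      (Icc 0 1) := by
    refine ContinuousOn.sub (by fun_prop) ?_
    refine continuousOn_of_dominated (bound := fun _ => 1) (fun q _ => by fun_prop) ?_
      (integrable_const _) (Filter.Eventually.of_forall fun w => by fun_prop)
    intro q hq
    exact ae_restrict_of_ae (hμ.mono fun w hw => abs_exp_neg_le (mul_nonneg hr.le hq.1) hw)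
  have h0 : (0 : ℝ) ∈ Icc ((fun q => 1 - q - ∫ w in Iic x, Real.exp (-(r * q * w)) ∂μ) 1)
      ((fun q => 1 - q - ∫ w in Iic x, Real.exp (-(r * q * w)) ∂μ) 0) := by
    constructor
    · have : 0 ≤ ∫ w in Iic x, Real.exp (-(r * 1 * w)) ∂μ :=
        integral_nonneg fun w => (Real.exp_pos _).le
      simp only
      linarith
    · simp
  obtain ⟨q, hq, h⟩ := intermediate_value_Icc' (zero_le_one' ℝ) hcont h0
  exact ⟨q, hq, by simpa [sub_eq_zero] using h⟩

/-! ### The law of the embedded workloads -/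

section system

variable {Ω : Type*} [MeasurableSpace Ω] {P : Measure Ω}

variable {A V : ℕ → Ω → ℝ} {r : ℝ}

/-- The path that drives the embedded chain. -/
def pathOf (A V : ℕ → Ω → ℝ) (ω : Ω) : (ℕ → ℝ) × (ℕ → ℝ) :=
  (fun j => A (j + 1) ω, fun j => V j ω)

lemma aemeasurable_pathOf (hA : IsPoissonArrivals P A r)
    (hV : ∀ i, IdentDistrib (V i) (V 0) P P) : AEMeasurable (pathOf A V) P :=
  (aemeasurable_pi_lambda _ fun j => (hA.1 (j + 1)).aemeasurable).prodMk
    (aemeasurable_pi_lambda _ fun j => (hV j).aemeasurable_fst)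

/-- The data of one tandem queue with stable or critical first queue. -/
structure IsTandem (P : Measure Ω) (A V : ℕ → Ω → ℝ) (r : ℝ) : Prop where
  rate_pos : 0 < r
  arrivals : IsPoissonArrivals P A r
  ident : ∀ i, IdentDistrib (V i) (V 0) P P
  indep : iIndepFun V P
  indep_arrivals : IndepFun (fun ω j => V j ω) (fun ω j => A j ω) P
  nonneg : ∀ i, ∀ᵐ ω ∂P, 0 ≤ V i ω
  mean_pos : 0 < ∫ ω, V 0 ω ∂P
  load_le_one : r * ∫ ω, V 0 ω ∂P ≤ 1

namespace IsTandem

variable (h : IsTandem P A V r)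

include h

lemma isProbabilityMeasure_exp : IsProbabilityMeasure (expMeasure r) :=
  isProbabilityMeasure_expMeasure h.rate_pos

lemma ae_map_nonneg : ∀ᵐ x ∂(P.map (V 0)), 0 ≤ x :=
  (ae_map_iff (h.ident 0).aemeasurable_fst measurableSet_Ici).2 (h.nonneg 0)

lemma integral_map_id : ∫ x, x ∂(P.map (V 0)) = ∫ ω, V 0 ω ∂P :=
  integral_map (h.ident 0).aemeasurable_fst aestronglyMeasurable_id

lemma integrable_service : Integrable (V 0) P := by
  by_contra hc
  exact absurd (integral_undef hc) h.mean_pos.ne'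

lemma integrable_map_id : Integrable (fun x => x) (P.map (V 0)) :=
  (integrable_map_measure aestronglyMeasurable_id (h.ident 0).aemeasurable_fst).2
    h.integrable_service

end IsTandem

variable [IsProbabilityMeasure P]

/-- The terms truncated at 1 are integrable with positive mean, so the strong law already makes the
truncated sums diverge. -/
lemma tendsto_sum_atTop_of_iid {X : ℕ → Ω → ℝ} (hindep : iIndepFun X P)
    (hident : ∀ i, IdentDistrib (X i) (X 0) P P) (hnn : ∀ i, ∀ᵐ ω ∂P, 0 ≤ X i ω)
    (hpos : ¬ X 0 =ᵐ[P] 0) :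
    ∀ᵐ ω ∂P, Tendsto (fun n => ∑ i ∈ Finset.range n, X i ω) atTop atTop := by
  have hφ : Measurable fun x : ℝ => min x 1 := by fun_prop
  have hint : Integrable (fun ω => min (X 0 ω) 1) P := by
    refine Integrable.of_bound (C := 1)
      (hφ.comp_aemeasurable (hident 0).aemeasurable_fst).aestronglyMeasurable ?_
    filter_upwards [hnn 0] with ω h
    rw [Real.norm_eq_abs, abs_of_nonneg (le_min h zero_le_one)]
    exact min_le_right _ _
  have hmean : 0 < ∫ ω, min (X 0 ω) 1 ∂P := by
    have h0 : 0 ≤ᵐ[P] fun ω => min (X 0 ω) 1 := by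
      filter_upwards [hnn 0] with ω h using le_min h zero_le_one
    refine lt_of_le_of_ne (integral_nonneg_of_ae h0) fun h => hpos ?_
    filter_upwards [(integral_eq_zero_iff_of_nonneg_ae h0 hint).1 h.symm] with ω hω
    have hω' : min (X 0 ω) 1 = 0 := hω
    rcases min_choice (X 0 ω) 1 with h1 | h1
    · exact h1.symm.trans hω'
    · rw [h1] at hω'; exact absurd hω' one_ne_zero
  have hlln := strong_law_ae_real (fun i ω => min (X i ω) 1) hint
    (fun i j hij => (hindep.indepFun hij).comp hφ hφ) (fun i => (hident i).comp hφ)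
  filter_upwards [hlln, ae_all_iff.2 hnn] with ω h1 h2
  have h3 : Tendsto (fun n : ℕ => ∑ i ∈ Finset.range n, min (X i ω) 1) atTop atTop := by
    refine (Tendsto.pos_mul_atTop hmean h1 tendsto_natCast_atTop_atTop).congr' ?_
    filter_upwards [eventually_gt_atTop 0] with n hn
    have : (n : ℝ) ≠ 0 := Nat.cast_ne_zero.2 hn.ne'
    field_simp
  exact tendsto_atTop_mono (fun n => Finset.sum_le_sum fun i _ => min_le_left _ _) h3

/-- The interarrival times enter with index shifted by one: `A 0` only delays the start and does not
influence the embedded workloads. -/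
lemma map_pathOf (hA : IsPoissonArrivals P A r) (hV : ∀ i, IdentDistrib (V i) (V 0) P P)
    (hVi : iIndepFun V P) (hAV : IndepFun (fun ω j => V j ω) (fun ω j => A j ω) P) :
    P.map (pathOf A V) = pathLaw r (P.map (V 0)) := by
  have hAm : AEMeasurable (fun ω j => A (j + 1) ω) P :=
    aemeasurable_pi_lambda _ fun j => (hA.1 (j + 1)).aemeasurable
  have hVm : AEMeasurable (fun ω j => V j ω) P :=
    aemeasurable_pi_lambda _ fun j => (hV j).aemeasurable_fst
  have hind : IndepFun (fun ω j => A (j + 1) ω) (fun ω j => V j ω) P :=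
    (hAV.comp measurable_id (ψ := fun (a : ℕ → ℝ) (j : ℕ) => a (j + 1)) (by fun_prop)).symm
  have h1 : P.map (fun ω j => A (j + 1) ω) = seqLaw (expMeasure r) := by
    rw [(hA.2.precomp (add_left_injective 1)).map_fun_eq_infinitePi_map₀ hAm]
    simp only [(hA.1 _).map_eq, seqLaw]
  have h2 : P.map (fun ω j => V j ω) = seqLaw (P.map (V 0)) := by
    rw [hVi.map_fun_eq_infinitePi_map₀ hVm]
    simp only [fun i => (hV i).map_eq, seqLaw]
  rw [pathLaw, ← h1, ← h2]
  exact (indepFun_iff_map_prod_eq_prod_map_map hAm hVm).1 hind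

lemma ae_regularPath (hr : 0 < r) (hA : IsPoissonArrivals P A r)
    (hV : ∀ i, IdentDistrib (V i) (V 0) P P) (hVi : iIndepFun V P)
    (hVn : ∀ i, ∀ᵐ ω ∂P, 0 ≤ V i ω) (hVp : 0 < ∫ ω, V 0 ω ∂P) :
    ∀ᵐ ω ∂P, RegularPath (fun j => A j ω) (fun j => V j ω) := by
  have hApos : ∀ j, ∀ᵐ ω ∂P, 0 < A j ω := fun j => by
    have := ae_expMeasure_pos hr
    rw [← (hA.1 j).map_eq] at this
    exact ae_of_ae_map (hA.1 j).aemeasurable this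
  have hAid : ∀ j, IdentDistrib (A j) (A 0) P P := fun j =>
    ⟨(hA.1 j).aemeasurable, (hA.1 0).aemeasurable, by rw [(hA.1 j).map_eq, (hA.1 0).map_eq]⟩
  have hA0 : ¬ A 0 =ᵐ[P] 0 := fun h => by
    obtain ⟨ω, h1, h2⟩ := (h.and (hApos 0)).exists
    exact h2.ne' h1
  have hV0 : ¬ V 0 =ᵐ[P] 0 := fun h => by
    rw [integral_congr_ae h] at hVp
    simp at hVp
  filter_upwards [ae_all_iff.2 hApos, ae_all_iff.2 hVn,
    tendsto_sum_atTop_of_iid hA.2 hAid (fun j => (hApos j).mono fun _ h => h.le) hA0,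
    tendsto_sum_atTop_of_iid hVi hV hVn hV0] with ω h1 h2 h3 h4
  exact ⟨h1, h2, h3.comp (tendsto_add_atTop_nat 1), h4⟩

lemma RegularPath.largestJob_eq {a v : ℕ → ℝ} (h : RegularPath a v) :
    largestJob a v = embLoad 0 (fun i => a (i + 1), v) := by
  classical
  have hm : ∀ i < Nat.nth (EndsAt (fun i => a (i + 1)) v) 0, ¬ EndsAt (fun i => a (i + 1)) v i :=
    fun i hi hc => by
      rw [Nat.nth_zero] at hi
      exact Nat.notMem_of_lt_sInf hi hc
  unfold largestJob
  rw [embLoad, loadTwo_eq_sup' hm]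
  simp_rw [h.lastJob_eq]

lemma monotone_maxCDF : Monotone (maxCDF P A V) := fun _ _ hxy =>
  measureReal_mono fun _ hω => le_trans hω hxy

namespace IsTandem

variable (h : IsTandem P A V r)

include h

lemma isProbabilityMeasure_map : IsProbabilityMeasure (P.map (V 0)) :=
  Measure.isProbabilityMeasure_map (h.ident 0).aemeasurable_fst

lemma ae_pathLaw_exists_endsAt : ∀ᵐ p ∂(pathLaw r (P.map (V 0))), ∃ j, EndsAt p.1 p.2 j := by
  have := h.isProbabilityMeasure_exp
  have := h.isProbabilityMeasure_map
  refine ae_exists_endsAt h.rate_pos h.ae_map_nonneg h.integrable_map_id ?_ ?_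
  · rw [h.integral_map_id]; exact h.mean_pos
  · rw [h.integral_map_id]; exact h.load_le_one

lemma ae_R_succ : ∀ᵐ ω ∂P, ∀ k, R A V (k + 1) ω = embLoad k (pathOf A V ω) := by
  filter_upwards [ae_regularPath h.rate_pos h.arrivals h.ident h.indep h.nonneg h.mean_pos]
    with ω hω k
  exact hω.embeddedWorkload_succ k

lemma ae_largestJob : ∀ᵐ ω ∂P,
    largestJob (fun j => A j ω) (fun j => V j ω) = embLoad 0 (pathOf A V ω) := by
  filter_upwards [ae_regularPath h.rate_pos h.arrivals h.ident h.indep h.nonneg h.mean_pos]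
    with ω hω
  exact hω.largestJob_eq

lemma aemeasurable_R (k : ℕ) : AEMeasurable (R A V k) P := by
  cases k with
  | zero => exact aemeasurable_const
  | succ k =>
    refine ((measurable_embLoad k).comp_aemeasurable
      (aemeasurable_pathOf h.arrivals h.ident)).congr ?_
    filter_upwards [h.ae_R_succ] with ω hω
    exact (hω k).symm

lemma measureReal_embLoad_pathOf (k : ℕ) (x : ℝ) :
    P.real {ω | embLoad k (pathOf A V ω) ≤ x} =
      (pathLaw r (P.map (V 0))).real {p | embLoad k p ≤ x} := by
  rw [← map_pathOf h.arrivals h.ident h.indep h.indep_arrivals,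
    map_measureReal_apply_of_aemeasurable (aemeasurable_pathOf h.arrivals h.ident)
      (measurableSet_le (measurable_embLoad k) measurable_const)]
  rfl

lemma measureReal_R_succ (k : ℕ) (x : ℝ) : P.real {ω | R A V (k + 1) ω ≤ x} =
    (pathLaw r (P.map (V 0))).real {p | embLoad k p ≤ x} := by
  rw [← h.measureReal_embLoad_pathOf]
  refine measureReal_congr ?_
  filter_upwards [h.ae_R_succ] with ω hω
  change (R A V (k + 1) ω ≤ x) = (embLoad k (pathOf A V ω) ≤ x)
  rw [hω]

lemma maxCDF_eq_measureReal_R (x : ℝ) : maxCDF P A V x = P.real {ω | R A V 1 ω ≤ x} := by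
  refine measureReal_congr ?_
  filter_upwards [h.ae_R_succ, h.ae_largestJob] with ω h1 h2
  change (largestJob (fun j => A j ω) (fun j => V j ω) ≤ x) = (R A V 1 ω ≤ x)
  rw [h1 0, h2]

lemma maxCDF_eq (x : ℝ) {q : ℝ} (hq0 : 0 ≤ q)
    (hq : 1 - q = ∫ w in Iic x, Real.exp (-(r * q * w)) ∂(P.map (V 0))) :
    maxCDF P A V x = 1 - q := by
  have := h.isProbabilityMeasure_exp
  have := h.isProbabilityMeasure_map
  rw [h.maxCDF_eq_measureReal_R, h.measureReal_R_succ]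
  refine pathLaw_embLoad_zero h.rate_pos h.ae_map_nonneg h.integrable_map_id ?_ ?_ x hq0 hq
  · rw [h.integral_map_id]; exact h.mean_pos
  · rw [h.integral_map_id]; exact h.load_le_one

/-- The defining equation of the distribution of the largest service time in a busy period. -/
lemma one_sub_maxCDF_mem (x : ℝ) : 1 - maxCDF P A V x ∈ Icc (0 : ℝ) 1 ∧
    maxCDF P A V x =
      ∫ w in Iic x, Real.exp (-(r * (1 - maxCDF P A V x) * w)) ∂(P.map (V 0)) := by
  have := h.isProbabilityMeasure_map
  obtain ⟨q, hq, hq'⟩ := exists_fixedPoint h.rate_pos h.ae_map_nonneg x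
  rw [h.maxCDF_eq x hq.1 hq', sub_sub_cancel]
  exact ⟨hq, hq'⟩

lemma ae_R_nonneg (k : ℕ) : ∀ᵐ ω ∂P, 0 ≤ R A V k ω := by
  cases k with
  | zero => exact Filter.Eventually.of_forall fun _ => le_rfl
  | succ k =>
    filter_upwards [h.ae_R_succ, ae_all_iff.2 h.nonneg] with ω h1 h2
    rw [h1]
    exact (h2 _).trans (le_loadTwo (pathOf A V ω).1 (pathOf A V ω).2 _)

/-- The start `R_0 = 0` fits the same recursion because `x` is nonnegative: the integrand is then 1
and the first workload has the law of the maximum. -/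
lemma measureReal_R_recursion (k : ℕ) {x : ℝ} (hx : 0 ≤ x) :
    P.real {ω | R A V (k + 1) ω ≤ x} =
      maxCDF P A V x * ∫ s, P.real {ω | R A V k ω ≤ x + s} ∂(expMeasure r) := by
  have := h.isProbabilityMeasure_exp
  have := h.isProbabilityMeasure_map
  cases k with
  | zero =>
    have e : ∫ s, P.real {ω | R A V 0 ω ≤ x + s} ∂(expMeasure r) =
        ∫ _, (1 : ℝ) ∂(expMeasure r) := by
      refine integral_congr_ae ?_
      filter_upwards [ae_expMeasure_pos h.rate_pos] with s hs
      have : {ω | R A V 0 ω ≤ x + s} = univ :=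
        eq_univ_of_forall fun ω => show (0 : ℝ) ≤ x + s by linarith
      rw [this, probReal_univ]
    rw [e, zero_add, h.maxCDF_eq_measureReal_R]
    simp
  | succ k =>
    rw [h.maxCDF_eq_measureReal_R, h.measureReal_R_succ, measureReal_def,
      pathLaw_embLoad_succ h.rate_pos h.ae_map_nonneg h.ae_pathLaw_exists_endsAt,
      ENNReal.toReal_mul, mul_comm, h.measureReal_R_succ 0]
    congr 1
    have hm : Measurable fun s => pathLaw r (P.map (V 0)) {p | embLoad k p ≤ x + s} := by
      have hs : MeasurableSet {q : ℝ × ((ℕ → ℝ) × (ℕ → ℝ)) | embLoad k q.2 ≤ x + q.1} :=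
        measurableSet_le ((measurable_embLoad k).comp measurable_snd)
          (measurable_const.add measurable_fst)
      exact measurable_measure_prodMk_left hs
    rw [← integral_toReal hm.aemeasurable (by simp)]
    refine integral_congr_ae (Filter.Eventually.of_forall fun s => ?_)
    exact (h.measureReal_R_succ k (x + s)).symm

end IsTandem

end system

/-! ### The recursion operator and its fixed point -/

/-- The fixed point of the recursion for the distributions of the embedded workloads, where `Q` is
the tail of the largest service time in a busy period. -/
noncomputable def fixedPoint (r : ℝ) (Q : ℝ → ℝ) (x : ℝ) : ℝ :=
  (1 - Q x) * Real.exp (-(r * ∫ y in Ioi x, Q y))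

/-- Tails that are integrable at infinity. -/
structure IntegrableTail (Q : ℝ → ℝ) : Prop where
  anti : Antitone Q
  nonneg : ∀ x, 0 ≤ Q x
  le_one : ∀ x, Q x ≤ 1
  integrable : ∀ x, IntegrableOn Q (Ioi x)

namespace IntegrableTail

variable {Q : ℝ → ℝ} (hQ : IntegrableTail Q) {r : ℝ}

include hQ

lemma integral_nonneg (x : ℝ) : 0 ≤ ∫ y in Ioi x, Q y :=
  MeasureTheory.integral_nonneg fun y => hQ.nonneg y

lemma antitone_integral : Antitone fun x => ∫ y in Ioi x, Q y := fun _ _ hxy =>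
  setIntegral_mono_set (hQ.integrable _) (Filter.Eventually.of_forall fun y => hQ.nonneg y)
    (Ioi_subset_Ioi hxy).eventuallyLE

lemma fixedPoint_nonneg (x : ℝ) : 0 ≤ fixedPoint r Q x :=
  mul_nonneg (sub_nonneg.2 (hQ.le_one x)) (Real.exp_pos _).le

lemma exp_le_one (hr : 0 ≤ r) (x : ℝ) : Real.exp (-(r * ∫ y in Ioi x, Q y)) ≤ 1 :=
  Real.exp_le_one_iff.2 (neg_nonpos.2 (mul_nonneg hr (hQ.integral_nonneg x)))

lemma fixedPoint_le_one (hr : 0 ≤ r) (x : ℝ) : fixedPoint r Q x ≤ 1 :=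
  mul_le_one₀ (by linarith [hQ.nonneg x]) (Real.exp_pos _).le (hQ.exp_le_one hr x)

lemma measurable_fixedPoint : Measurable (fixedPoint r Q) := by
  have h1 := hQ.anti.measurable
  have h2 := hQ.antitone_integral.measurable
  unfold fixedPoint
  fun_prop

/-- The function -exp(-r s) E(s) is a primitive of the integrand, since E' = r Q(x + s) E. This
holds off the countably many discontinuities of the monotone `Q`, which suffices for a continuous
primitive. -/
lemma integral_fixedPoint (hr : 0 < r) (x : ℝ) :
    ∫ s, fixedPoint r Q (x + s) ∂(expMeasure r) = Real.exp (-(r * ∫ y in Ioi x, Q y)) := by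
  have hloc : ∀ a b, IntervalIntegrable Q volume a b := fun a b => hQ.anti.intervalIntegrable
  have hH : ∀ s, 0 ≤ s → ∫ y in Ioi (x + s), Q y =
      (∫ y in Ioi x, Q y) - ∫ y in x..(x + s), Q y := fun s hs => by
    rw [eq_sub_iff_add_eq', intervalIntegral.integral_interval_add_Ioi (hQ.integrable _)
      (hQ.integrable _)]
  set K := ∫ y in Ioi x, Q y with hK
  set E : ℝ → ℝ := fun s => Real.exp (-(r * (K - ∫ y in x..(x + s), Q y))) with hE
  have hfix : ∀ s, 0 ≤ s → fixedPoint r Q (x + s) = (1 - Q (x + s)) * E s := fun s hs => by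
    rw [fixedPoint, hH s hs]
  rw [integral_expMeasure hr]
  have hcontH : Continuous fun s => ∫ y in x..(x + s), Q y :=
    (intervalIntegral.continuous_primitive hloc x).comp (by fun_prop)
  have hEc : Continuous E := by fun_prop
  have hint : IntegrableOn (fun s => r * Real.exp (-(r * s)) * fixedPoint r Q (x + s)) (Ioi 0) := by
    have h1 : IntegrableOn (fun s => r * Real.exp (-(r * s))) (Ioi 0) := by
      have := (integrableOn_exp_mul_Ioi (neg_lt_zero.2 hr) 0).const_mul r
      simpa [neg_mul, IntegrableOn] using this
    refine h1.mono' ?_ (Filter.Eventually.of_forall fun s => ?_)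
    · have := (hQ.measurable_fixedPoint (r := r)).comp (measurable_const_add x)
      exact (Measurable.mul (by fun_prop) this).aestronglyMeasurable
    · have h2 : 0 ≤ r * Real.exp (-(r * s)) := by positivity
      rw [Real.norm_eq_abs, abs_of_nonneg (mul_nonneg h2 (hQ.fixedPoint_nonneg _))]
      exact mul_le_of_le_one_right h2 (hQ.fixedPoint_le_one hr.le _)
  have hlim := intervalIntegral_tendsto_integral_Ioi 0 hint tendsto_id
  refine tendsto_nhds_unique hlim ?_
  have hcount : ({s | ¬ ContinuousAt Q (x + s)}).Countable := by
    have h1 := hQ.anti.countable_not_continuousAt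
    exact h1.preimage (add_right_injective x)
  have hev : ∀ T, 0 ≤ T → ∫ s in (0 : ℝ)..T, r * Real.exp (-(r * s)) * fixedPoint r Q (x + s) =
      -(Real.exp (-(r * T)) * E T) + Real.exp (-(r * K)) := by
    intro T hT
    have e0 : ∫ s in (0 : ℝ)..T, r * Real.exp (-(r * s)) * fixedPoint r Q (x + s) =
        ∫ s in (0 : ℝ)..T, r * Real.exp (-(r * s)) * ((1 - Q (x + s)) * E s) := by
      refine intervalIntegral.integral_congr fun s hs => ?_
      rw [uIcc_of_le hT] at hs
      simp only [hfix s hs.1]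
    rw [e0, integral_eq_of_hasDerivAt_off_countable_of_le
      (fun s => -(Real.exp (-(r * s)) * E s)) _ hT hcount (by fun_prop) ?_ ?_]
    · simp [hE]
    · intro s hs
      have hQc : ContinuousAt Q (x + s) := not_not.1 hs.2
      have h1 : HasDerivAt (fun s => ∫ y in x..(x + s), Q y) (Q (x + s)) s := by
        have h2 := intervalIntegral.integral_hasDerivAt_right (hloc x (x + s))
          (hQ.anti.measurable.stronglyMeasurable.stronglyMeasurableAtFilter) hQc
        exact h2.comp_const_add x s
      have h3 : HasDerivAt E (E s * -(r * -Q (x + s))) s :=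
        (((h1.const_sub K).const_mul r).neg).exp
      have h4 : HasDerivAt (fun s => Real.exp (-(r * s))) (Real.exp (-(r * s)) * -(r * 1)) s :=
        (((hasDerivAt_id s).const_mul r).neg).exp
      exact (h4.mul h3).neg.congr_deriv (by ring)
    · refine IntervalIntegrable.congr (f := fun s => r * Real.exp (-(r * s)) *
        fixedPoint r Q (x + s)) ?_ ?_
      · intro s hs
        rw [uIoc_of_le hT] at hs
        simp only [hfix s hs.1.le]
      · exact (intervalIntegrable_iff_integrableOn_Ioc_of_le hT).2
          (hint.mono_set Ioc_subset_Ioi_self)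
  have h0 : Tendsto (fun T => Real.exp (-(r * T)) * E T) atTop (𝓝 0) := by
    have h1 : Tendsto (fun T => Real.exp (-(r * T))) atTop (𝓝 0) :=
      Real.tendsto_exp_neg_atTop_nhds_zero.comp (tendsto_id.const_mul_atTop hr)
    refine squeeze_zero' (Filter.Eventually.of_forall fun T => by positivity) ?_ h1
    filter_upwards [eventually_ge_atTop 0] with T hT
    refine mul_le_of_le_one_right (Real.exp_pos _).le ?_
    have := hQ.exp_le_one hr.le (x + T)
    rwa [hH T hT] at this
  have h2 := h0.neg.add_const (Real.exp (-(r * K)))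
  rw [neg_zero, zero_add] at h2
  refine h2.congr' ?_
  filter_upwards [eventually_ge_atTop 0] with T hT
  exact (hev T hT).symm

end IntegrableTail

/-- The tail `q`, set to zero from `b` on. -/
noncomputable def cutTail (q : ℝ → ℝ) (b x : ℝ) : ℝ := if x < b then q x else 0

lemma integrableTail_cutTail {q : ℝ → ℝ} (hq : Antitone q) (h0 : ∀ x, 0 ≤ q x)
    (h1 : ∀ x, q x ≤ 1) (b : ℝ) : IntegrableTail (cutTail q b) := by
  have hanti : Antitone (cutTail q b) := fun x y hxy => by
    unfold cutTail
    split_ifs with h2 h3 h3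
    · exact hq hxy
    · exact absurd (hxy.trans_lt h2) h3
    · exact h0 x
    · exact le_rfl
  have hnn : ∀ x, 0 ≤ cutTail q b x := fun x => by
    unfold cutTail; split_ifs; exacts [h0 x, le_rfl]
  have hle : ∀ x, cutTail q b x ≤ 1 := fun x => by
    unfold cutTail; split_ifs; exacts [h1 x, zero_le_one]
  refine ⟨hanti, hnn, hle, fun x => ?_⟩
  have hz : ∀ y ∈ Ioi x \ Ioo x b, cutTail q b y = 0 := fun y hy => by
    unfold cutTail
    rw [if_neg fun hc => hy.2 ⟨hy.1, hc⟩]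
  refine IntegrableOn.of_forall_sdiff_eq_zero (s := Ioo x b) ?_ measurableSet_Ioi hz
  exact Measure.integrableOn_of_bounded (M := 1) (by simp) hanti.measurable.aestronglyMeasurable
    (Filter.Eventually.of_forall fun y => by
      rw [Real.norm_eq_abs, abs_of_nonneg (hnn y)]; exact hle y)

lemma integral_cutTail (q : ℝ → ℝ) {x b : ℝ} (hxb : x ≤ b) :
    ∫ y in Ioi x, cutTail q b y = ∫ y in x..b, q y := by
  have : cutTail q b = (Iio b).indicator q := by
    ext y; simp [cutTail, indicator_apply]
  rw [this, setIntegral_indicator measurableSet_Iio, Ioi_inter_Iio,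
    intervalIntegral.integral_of_le hxb, integral_Ioc_eq_integral_Ioo]

/-! ### Comparison bounds for solutions of the recursion. -/

section recursion

variable {r : ℝ}

lemma integral_exp_expMeasure (hr : 0 < r) {c : ℝ} (hc : c < r) :
    ∫ s, Real.exp (c * s) ∂(expMeasure r) = r / (r - c) := by
  rw [integral_expMeasure hr]
  have : ∀ s, r * Real.exp (-(r * s)) * Real.exp (c * s) = r * Real.exp (-(r - c) * s) := fun s => by
    rw [mul_assoc, ← Real.exp_add]; congr 2; ring
  simp_rw [this]
  rw [integral_const_mul, integral_exp_mul_Ioi (by linarith), mul_zero, Real.exp_zero, neg_div_neg_eq,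
    mul_one_div]

lemma integrable_exp_expMeasure (hr : 0 < r) {c : ℝ} (hc : c < r) :
    Integrable (fun s => Real.exp (c * s)) (expMeasure r) := by
  by_contra h
  have h1 := integral_exp_expMeasure hr hc
  rw [integral_undef h] at h1
  exact (div_pos hr (sub_pos.2 hc)).ne h1

/-- Solutions of the recursion for the distribution functions of the embedded workloads. -/
structure IsRecursion (r : ℝ) (q : ℝ → ℝ) (G : ℕ → ℝ → ℝ) : Prop where
  rate_pos : 0 < r
  anti : Antitone q
  nonneg : ∀ x, 0 ≤ q x
  le_one : ∀ x, q x ≤ 1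
  mono : ∀ k, Monotone (G k)
  G_nonneg : ∀ k x, 0 ≤ G k x
  G_le_one : ∀ k x, G k x ≤ 1
  zero : ∀ x, 0 ≤ x → G 0 x = 1
  succ : ∀ k x, 0 ≤ x → G (k + 1) x = (1 - q x) * ∫ s, G k (x + s) ∂(expMeasure r)

namespace IsRecursion

variable {q : ℝ → ℝ} {G : ℕ → ℝ → ℝ} (h : IsRecursion r q G)

include h

lemma integrable (k : ℕ) (x : ℝ) : Integrable (fun s => G k (x + s)) (expMeasure r) := by
  have := isProbabilityMeasure_expMeasure h.rate_pos
  refine Integrable.of_bound (C := 1) ((h.mono k).measurable.comp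
    (measurable_const_add x)).aestronglyMeasurable (Filter.Eventually.of_forall fun s => ?_)
  rw [Real.norm_eq_abs, abs_of_nonneg (h.G_nonneg k _)]
  exact h.G_le_one k _

lemma integrable_fixedPoint {Q : ℝ → ℝ} (hQ : IntegrableTail Q) (x : ℝ) :
    Integrable (fun s => fixedPoint r Q (x + s)) (expMeasure r) := by
  have := isProbabilityMeasure_expMeasure h.rate_pos
  refine Integrable.of_bound (C := 1) (hQ.measurable_fixedPoint.comp
    (measurable_const_add x)).aestronglyMeasurable (Filter.Eventually.of_forall fun s => ?_)
  rw [Real.norm_eq_abs, abs_of_nonneg (hQ.fixedPoint_nonneg _)]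
  exact hQ.fixedPoint_le_one h.rate_pos.le _

/-- The recursion is monotone and starts from 1, which lies above the fixed point. -/
lemma fixedPoint_le (hq : IntegrableTail q) (k : ℕ) : ∀ x, 0 ≤ x → fixedPoint r q x ≤ G k x := by
  induction k with
  | zero => exact fun x hx => (h.zero x hx).symm ▸ hq.fixedPoint_le_one h.rate_pos.le x
  | succ k ih =>
    intro x hx
    rw [h.succ k x hx, fixedPoint, ← hq.integral_fixedPoint h.rate_pos]
    refine mul_le_mul_of_nonneg_left (integral_mono_ae (h.integrable_fixedPoint hq x)
      (h.integrable k x) ?_) (sub_nonneg.2 (h.le_one x))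
    filter_upwards [ae_expMeasure_pos h.rate_pos] with s hs
    exact ih _ (by linarith)

/-- Exponentials are eigenfunctions of averaging over an exponential shift, with eigenvalue `r / (r
- c)`. Error terms of this shape reproduce themselves along the recursion. -/
lemma integral_error {c b : ℝ} (hc : c < r) (k : ℕ) (x : ℝ) :
    Integrable (fun s => Real.exp (c * (x + s - b)) * (r / (r - c)) ^ k) (expMeasure r) ∧
    ∫ s, Real.exp (c * (x + s - b)) * (r / (r - c)) ^ k ∂(expMeasure r) =
      Real.exp (c * (x - b)) * (r / (r - c)) ^ (k + 1) := by
  have e : ∀ s, Real.exp (c * (x + s - b)) * (r / (r - c)) ^ k =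
      Real.exp (c * (x - b)) * (r / (r - c)) ^ k * Real.exp (c * s) := fun s => by
    rw [show c * (x + s - b) = c * (x - b) + c * s by ring, Real.exp_add]; ring
  simp_rw [e]
  refine ⟨(integrable_exp_expMeasure h.rate_pos hc).const_mul _, ?_⟩
  rw [integral_const_mul, integral_exp_expMeasure h.rate_pos hc, pow_succ]
  ring

/-- Beyond the cut `b` the error term is at least 1 because `c ≥ 0`, and nothing is to be shown.
Below `b` the cut tail equals `q`, so the recursion step preserves the bound. -/
lemma lower_bound {c : ℝ} (hc0 : 0 ≤ c) (hc : c < r) (b : ℝ) (k : ℕ) : ∀ x, 0 ≤ x →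
    fixedPoint r (cutTail q b) x - Real.exp (c * (x - b)) * (r / (r - c)) ^ k ≤ G k x := by
  have hQ := integrableTail_cutTail h.anti h.nonneg h.le_one b
  have hr := h.rate_pos
  have hrc : 0 < r - c := sub_pos.2 hc
  have h1 : 1 ≤ r / (r - c) := (one_le_div hrc).2 (by linarith)
  induction k with
  | zero =>
    intro x hx
    rw [h.zero x hx]
    have := hQ.fixedPoint_le_one h.rate_pos.le x
    have : 0 < Real.exp (c * (x - b)) * (r / (r - c)) ^ 0 := by positivity
    linarith
  | succ k ih =>
    intro x hx
    by_cases hxb : x < b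
    · have e := h.integral_error (b := b) hc k x
      have h2 : Real.exp (-(r * ∫ y in Ioi x, cutTail q b y)) -
          Real.exp (c * (x - b)) * (r / (r - c)) ^ (k + 1) ≤ ∫ s, G k (x + s) ∂(expMeasure r) := by
        rw [← hQ.integral_fixedPoint h.rate_pos, ← e.2,
          ← integral_sub (h.integrable_fixedPoint hQ x) e.1]
        refine integral_mono_ae ((h.integrable_fixedPoint hQ x).sub e.1) (h.integrable k x) ?_
        filter_upwards [ae_expMeasure_pos h.rate_pos] with s hs
        exact ih _ (by linarith)
      rw [h.succ k x hx, fixedPoint, cutTail, if_pos hxb]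
      have h3 := mul_le_mul_of_nonneg_left h2 (sub_nonneg.2 (h.le_one x))
      have h4 : 0 ≤ Real.exp (c * (x - b)) * (r / (r - c)) ^ (k + 1) := by positivity
      nlinarith [h.nonneg x]
    · have h2 : 1 ≤ Real.exp (c * (x - b)) :=
        Real.one_le_exp (mul_nonneg hc0 (sub_nonneg.2 (not_lt.1 hxb)))
      have h3 : 1 ≤ Real.exp (c * (x - b)) * (r / (r - c)) ^ (k + 1) :=
        one_le_mul_of_one_le_of_one_le h2 (one_le_pow₀ h1)
      linarith [hQ.fixedPoint_le_one h.rate_pos.le x, h.G_nonneg (k + 1) x]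

/-- Here `c ≤ 0` makes the error term at least 1 below `b` at the start, while beyond `b` the cut
fixed point equals 1. The cut tail is at most `q`, so the recursion step preserves the bound. -/
lemma upper_bound {c : ℝ} (hc : c ≤ 0) (b : ℝ) (k : ℕ) : ∀ x, 0 ≤ x →
    G k x ≤ fixedPoint r (cutTail q b) x + Real.exp (c * (x - b)) * (r / (r - c)) ^ k := by
  have hQ := integrableTail_cutTail h.anti h.nonneg h.le_one b
  have hr := h.rate_pos
  have hcr : c < r := hc.trans_lt h.rate_pos
  have hrc : 0 < r - c := sub_pos.2 hcr
  induction k with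
  | zero =>
    intro x hx
    rw [h.zero x hx, pow_zero, mul_one]
    by_cases hxb : x < b
    · have h2 : 1 ≤ Real.exp (c * (x - b)) :=
        Real.one_le_exp (mul_nonneg_of_nonpos_of_nonpos hc (by linarith))
      linarith [hQ.fixedPoint_nonneg (r := r) x]
    · have h3 : ∫ y in Ioi x, cutTail q b y = 0 := by
        refine (setIntegral_congr_fun measurableSet_Ioi fun y hy => ?_).trans
          (integral_zero _ _)
        have hy' : x < y := hy
        exact if_neg (by linarith [not_lt.1 hxb])
      rw [fixedPoint, h3, cutTail, if_neg hxb]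
      simpa using (Real.exp_pos _).le
  | succ k ih =>
    intro x hx
    have e := h.integral_error (b := b) hcr k x
    have h2 : ∫ s, G k (x + s) ∂(expMeasure r) ≤ Real.exp (-(r * ∫ y in Ioi x, cutTail q b y)) +
        Real.exp (c * (x - b)) * (r / (r - c)) ^ (k + 1) := by
      rw [← hQ.integral_fixedPoint h.rate_pos, ← e.2,
        ← integral_add (h.integrable_fixedPoint hQ x) e.1]
      refine integral_mono_ae (h.integrable k x) ((h.integrable_fixedPoint hQ x).add e.1) ?_
      filter_upwards [ae_expMeasure_pos h.rate_pos] with s hs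
      exact ih _ (by linarith)
    rw [h.succ k x hx, fixedPoint]
    have h3 := mul_le_mul_of_nonneg_left h2 (sub_nonneg.2 (h.le_one x))
    have h4 : 0 ≤ Real.exp (c * (x - b)) * (r / (r - c)) ^ (k + 1) := by positivity
    have h5 : cutTail q b x ≤ q x := by
      unfold cutTail; split_ifs; exacts [le_rfl, h.nonneg x]
    have h6 := Real.exp_pos (-(r * ∫ y in Ioi x, cutTail q b y))
    nlinarith [h.nonneg x]

/-- Convergence to the steady state. -/
lemma tendsto_fixedPoint (hq : IntegrableTail q) {x : ℝ} (hx : 0 ≤ x) :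
    Tendsto (fun k => G k x) atTop (𝓝 (fixedPoint r q x)) := by
  have hr := h.rate_pos
  refine tendsto_order.2 ⟨fun a ha => Filter.Eventually.of_forall fun k =>
    ha.trans_le (h.fixedPoint_le hq k x hx), fun a ha => ?_⟩
  have h1 : Tendsto (fun b => fixedPoint r (cutTail q b) x) atTop (𝓝 (fixedPoint r q x)) := by
    have h2 := intervalIntegral_tendsto_integral_Ioi x (hq.integrable x) tendsto_id
    have h3 : Tendsto (fun b => (1 - q x) * Real.exp (-(r * ∫ y in x..b, q y))) atTop
        (𝓝 (fixedPoint r q x)) :=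
      ((Real.continuous_exp.tendsto _).comp (h2.const_mul r).neg).const_mul (1 - q x)
    refine h3.congr' ?_
    filter_upwards [eventually_gt_atTop x] with b hb
    rw [fixedPoint, integral_cutTail q hb.le, cutTail, if_pos hb]
  obtain ⟨b, hb⟩ := (h1.eventually (gt_mem_nhds ha)).exists
  -- The cut `b` is now fixed. With `c = -1` the eigenvalue is `r / (r + 1) < 1`, so the error
  -- vanishes as `k` grows.
  have h4 : Tendsto (fun k : ℕ => fixedPoint r (cutTail q b) x +
      Real.exp (-1 * (x - b)) * (r / (r - -1)) ^ k) atTop (𝓝 (fixedPoint r (cutTail q b) x)) := by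
    have := ((tendsto_pow_atTop_nhds_zero_of_lt_one (r := r / (r - -1)) (by
      apply div_nonneg <;> linarith) ((div_lt_one (by linarith)).2 (by linarith))).const_mul
        (Real.exp (-1 * (x - b)))).const_add (fixedPoint r (cutTail q b) x)
    simpa using this
  filter_upwards [h4.eventually (gt_mem_nhds hb)] with k hk
  exact (h.upper_bound (by norm_num) b k x hx).trans_lt hk

end IsRecursion

end recursion

/-! ### Scaling limit of the recursion. -/

section scaling

variable {r : ℕ → ℝ} {q : ℕ → ℝ → ℝ} {G : ℕ → ℕ → ℝ → ℝ} {lam : ℝ} {g : ℝ → ℝ}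

lemma antitoneOn_of_tendsto (hq : ∀ n, Antitone (q n))
    (hg : ∀ y, 0 < y → Tendsto (fun n : ℕ => n * q n (n * y)) atTop (𝓝 (g y))) :
    AntitoneOn g (Ioi 0) := fun x hx y hy hxy =>
  le_of_tendsto_of_tendsto' (hg y hy) (hg x hx) fun n =>
    mul_le_mul_of_nonneg_left (hq n (mul_le_mul_of_nonneg_left hxy n.cast_nonneg)) n.cast_nonneg

lemma intervalIntegrable_of_antitoneOn (hg : AntitoneOn g (Ioi 0)) {x b : ℝ} (hx : 0 < x)
    (hb : x ≤ b) : IntervalIntegrable g volume x b := by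
  refine (hg.mono fun y hy => ?_).intervalIntegrable
  rw [uIcc_of_le hb] at hy
  exact hx.trans_le hy.1

lemma tendsto_integral_of_antitoneOn (hg : AntitoneOn g (Ioi 0)) {x b : ℝ} (hx : 0 < x)
    (hb : x < b) : Tendsto (fun z => ∫ y in x..z, g y) (𝓝 b) (𝓝 (∫ y in x..b, g y)) := by
  -- Freezing `g` to the left of `x` makes it antitone on the whole line, hence locally integrable
  -- with a continuous primitive.
  have hg' : Antitone fun y => g (max y x) := fun y z hyz =>
    hg (lt_max_of_lt_right hx) (lt_max_of_lt_right hx) (max_le_max_right x hyz)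
  have e : ∀ z, x ≤ z → ∫ y in x..z, g (max y x) = ∫ y in x..z, g y := fun z hz => by
    refine intervalIntegral.integral_congr fun y hy => ?_
    rw [uIcc_of_le hz] at hy
    simp only [max_eq_left hy.1]
  have hc := intervalIntegral.continuous_primitive (fun a b => hg'.intervalIntegrable
    (a := a) (b := b) (μ := volume)) x
  have h1 := hc.tendsto b
  rw [e b hb.le] at h1
  refine h1.congr' ?_
  filter_upwards [Ioi_mem_nhds hb] with z hz
  exact e z (le_of_lt hz)

lemma tendsto_zero_of_tendsto_mul {y : ℝ} {q : ℕ → ℝ} (h : Tendsto (fun n : ℕ => n * q n) atTop (𝓝 y)) :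
    Tendsto q atTop (𝓝 0) := by
  have h1 := h.mul (tendsto_inv_atTop_nhds_zero_nat (𝕜 := ℝ))
  rw [mul_zero] at h1
  refine h1.congr' ?_
  filter_upwards [eventually_gt_atTop 0] with n hn
  have : (n : ℝ) ≠ 0 := Nat.cast_ne_zero.2 hn.ne'
  field_simp

lemma tendsto_integral_scaled (hq : ∀ n, Antitone (q n)) (hq0 : ∀ n x, 0 ≤ q n x)
    (hg : ∀ y, 0 < y → Tendsto (fun n : ℕ => n * q n (n * y)) atTop (𝓝 (g y))) {x b : ℝ}
    (hx : 0 < x) (hb : x ≤ b) :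
    Tendsto (fun n : ℕ => ∫ y in x..b, n * q n (n * y)) atTop (𝓝 (∫ y in x..b, g y)) := by
  refine intervalIntegral.tendsto_integral_filter_of_dominated_convergence (fun _ => g x + 1)
    (Filter.Eventually.of_forall fun n => ?_) ?_ (by simp) (Filter.Eventually.of_forall fun y hy => ?_)
  · exact (((hq n).measurable.comp (measurable_const_mul (n : ℝ))).const_mul
      (n : ℝ)).aestronglyMeasurable
  · filter_upwards [(hg x hx).eventually (gt_mem_nhds (lt_add_one _))] with n hn
    refine Filter.Eventually.of_forall fun y hy => ?_
    rw [uIoc_of_le hb] at hy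
    rw [Real.norm_eq_abs, abs_of_nonneg (mul_nonneg n.cast_nonneg (hq0 _ _))]
    exact (mul_le_mul_of_nonneg_left (hq n (mul_le_mul_of_nonneg_left hy.1.le n.cast_nonneg))
      n.cast_nonneg).trans hn.le
  · rw [uIoc_of_le hb] at hy
    exact hg y (hx.trans hy.1)

lemma tendsto_fixedPoint_cutTail (hr : Tendsto r atTop (𝓝 lam)) (hq : ∀ n, Antitone (q n))
    (hq0 : ∀ n x, 0 ≤ q n x)
    (hg : ∀ y, 0 < y → Tendsto (fun n : ℕ => n * q n (n * y)) atTop (𝓝 (g y))) {x b : ℝ}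
    (hx : 0 < x) (hb : x < b) :
    Tendsto (fun n : ℕ => fixedPoint (r n) (cutTail (q n) (n * b)) (n * x)) atTop
      (𝓝 (Real.exp (-(lam * ∫ y in x..b, g y)))) := by
  have h1 := tendsto_integral_scaled hq hq0 hg hx hb.le
  have h2 : Tendsto (fun n : ℕ => (1 - q n (n * x)) *
      Real.exp (-(r n * ∫ y in x..b, n * q n (n * y)))) atTop
      (𝓝 ((1 - 0) * Real.exp (-(lam * ∫ y in x..b, g y)))) :=
    ((tendsto_zero_of_tendsto_mul (hg x hx)).const_sub 1).mul
      ((Real.continuous_exp.tendsto _).comp (hr.mul h1).neg)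
  rw [sub_zero, one_mul] at h2
  refine h2.congr' ?_
  filter_upwards [eventually_gt_atTop 0] with n hn
  have hn' : (0 : ℝ) < n := Nat.cast_pos.2 hn
  have hxb : (n : ℝ) * x < n * b := mul_lt_mul_of_pos_left hb hn'
  rw [fixedPoint, integral_cutTail _ hxb.le, cutTail, if_pos hxb,
    ← intervalIntegral.mul_integral_comp_mul_left, intervalIntegral.integral_const_mul]

/-- By 1 + u ≤ exp u, the power of the eigenvalue for `c / n` is at most exp(⌊nt⌋ (c/n) / (r_n -
c/n)), which tends to exp(t c / λ). The sign of `c` is free, so both comparison bounds can use this.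
-/
lemma error_bound (hlam : 0 < lam) (hr : Tendsto r atTop (𝓝 lam)) {t : ℝ} (ht : 0 ≤ t)
    (x b c : ℝ) {η : ℝ} (hη : Real.exp (c * (x - b) + t * c / lam) < η) :
    ∀ᶠ n : ℕ in atTop, c / n < r n ∧
      Real.exp (c / n * (n * x - n * b)) * (r n / (r n - c / n)) ^ ⌊(n : ℝ) * t⌋₊ < η := by
  have h1 : Tendsto (fun n : ℕ => c / (n : ℝ)) atTop (𝓝 0) := tendsto_const_div_atTop_nhds_zero_nat c
  have h2 : Tendsto (fun n : ℕ => r n - c / n) atTop (𝓝 lam) := by simpa using hr.sub h1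
  have h3 : Tendsto (fun n : ℕ => (⌊(n : ℝ) * t⌋₊ : ℝ) / n) atTop (𝓝 t) := by
    simpa [mul_comm, Function.comp_def] using (tendsto_nat_floor_mul_div_atTop ht).comp tendsto_natCast_atTop_atTop
  have h4 : Tendsto (fun n : ℕ => Real.exp (c * (x - b) +
      (⌊(n : ℝ) * t⌋₊ : ℝ) / n * c / (r n - c / n))) atTop
      (𝓝 (Real.exp (c * (x - b) + t * c / lam))) :=
    (Real.continuous_exp.tendsto _).comp (((h3.mul_const c).div h2 hlam.ne').const_add _)
  filter_upwards [h2.eventually (lt_mem_nhds hlam), h4.eventually (gt_mem_nhds hη),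
    eventually_gt_atTop 0, hr.eventually (lt_mem_nhds hlam)] with n hn1 hn2 hn0 hrn
  refine ⟨sub_pos.1 hn1, lt_of_le_of_lt ?_ hn2⟩
  have hn' : (n : ℝ) ≠ 0 := Nat.cast_ne_zero.2 hn0.ne'
  have e1 : c / n * (n * x - n * b) = c * (x - b) := by field_simp
  have e2 : r n / (r n - c / n) ≤ Real.exp (c / n / (r n - c / n)) := by
    have h5 := Real.add_one_le_exp (c / n / (r n - c / n))
    have h6 : r n / (r n - c / n) = c / n / (r n - c / n) + 1 := by
      rw [div_add_one hn1.ne']; congr 1; ring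
    rwa [h6]
  rw [e1, Real.exp_add]
  refine mul_le_mul_of_nonneg_left ?_ (Real.exp_pos _).le
  refine (pow_le_pow_left₀ (div_nonneg hrn.le hn1.le) e2 _).trans (le_of_eq ?_)
  rw [← Real.exp_nat_mul]
  congr 1
  ring

/-- Convergence of the scaled distribution functions of the embedded workloads. -/
lemma tendsto_scaled (h : ∀ n, IsRecursion (r n) (q n) (G n)) (hlam : 0 < lam)
    (hr : Tendsto r atTop (𝓝 lam))
    (hg : ∀ y, 0 < y → Tendsto (fun n : ℕ => n * q n (n * y)) atTop (𝓝 (g y))) {t x : ℝ}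
    (ht : 0 ≤ t) (hx : 0 < x) :
    Tendsto (fun n : ℕ => G n ⌊(n : ℝ) * t⌋₊ (n * x)) atTop
      (𝓝 (Real.exp (-(lam * ∫ y in x..(x + t / lam), g y)))) := by
  have hq : ∀ n, Antitone (q n) := fun n => (h n).anti
  have hq0 : ∀ n x, 0 ≤ q n x := fun n => (h n).nonneg
  have hanti := antitoneOn_of_tendsto hq hg
  rcases ht.eq_or_lt with rfl | htpos
  · have e : ∀ n : ℕ, G n ⌊(n : ℝ) * 0⌋₊ (n * x) = 1 := fun n => by
      rw [mul_zero, Nat.floor_zero, (h n).zero _ (mul_nonneg n.cast_nonneg hx.le)]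
    simp only [e]
    simp
  -- The limiting error is exp(c (b₀ - b)). It is small for `b` beyond `b₀` and `c` large positive
  -- (lower bound), and for `b` before `b₀` and `c` large negative (upper bound). Continuity of the
  -- limit in `b` at `b₀` closes the gap.
  set b₀ := x + t / lam with hb₀
  have hxb : x < b₀ := lt_add_of_pos_right _ (div_pos htpos hlam)
  have hL : Tendsto (fun z => Real.exp (-(lam * ∫ y in x..z, g y))) (𝓝 b₀)
      (𝓝 (Real.exp (-(lam * ∫ y in x..b₀, g y)))) := by
    have h1 := tendsto_integral_of_antitoneOn hanti hx hxb
    exact (Real.continuous_exp.tendsto _).comp (h1.const_mul lam).neg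
  have herr : ∀ ε > 0, ∀ η > 0, ∃ d > 0, Real.exp (-(d * ε)) < η := fun ε hε η hη => by
    have h1 : Tendsto (fun d => Real.exp (-(d * ε))) atTop (𝓝 0) :=
      Real.tendsto_exp_neg_atTop_nhds_zero.comp (tendsto_id.atTop_mul_const hε)
    obtain ⟨d, h2, h3⟩ := ((h1.eventually (gt_mem_nhds hη)).and (eventually_gt_atTop 0)).exists
    exact ⟨d, h3, h2⟩
  refine tendsto_order.2 ⟨fun a ha => ?_, fun a ha => ?_⟩
  · obtain ⟨b, hb1, hb2⟩ : ∃ b, a < Real.exp (-(lam * ∫ y in x..b, g y)) ∧ b₀ < b :=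
      (((hL.eventually (lt_mem_nhds ha)).filter_mono nhdsWithin_le_nhds).and
        (self_mem_nhdsWithin (s := Ioi b₀))).exists
    obtain ⟨m, hm1, hm2⟩ := exists_between hb1
    obtain ⟨d, hd0, hd⟩ := herr (b - b₀) (sub_pos.2 hb2) (m - a) (sub_pos.2 hm1)
    have e : d * (x - b) + t * d / lam = -(d * (b - b₀)) := by rw [hb₀]; ring
    filter_upwards [error_bound hlam hr ht x b d (e ▸ hd), (tendsto_fixedPoint_cutTail hr hq hq0 hg
      hx (hxb.trans hb2)).eventually (lt_mem_nhds hm2)] with n hn1 hn2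
    have h1 := (h n).lower_bound (div_nonneg hd0.le n.cast_nonneg) hn1.1 (n * b)
      ⌊(n : ℝ) * t⌋₊ (n * x) (mul_nonneg n.cast_nonneg hx.le)
    linarith [hn1.2]
  · obtain ⟨b, ⟨hb1, hb3⟩, hb2⟩ : ∃ b, (Real.exp (-(lam * ∫ y in x..b, g y)) < a ∧ x < b) ∧
        b < b₀ :=
      ((((hL.eventually (gt_mem_nhds ha)).and (lt_mem_nhds hxb)).filter_mono
        nhdsWithin_le_nhds).and (self_mem_nhdsWithin (s := Iio b₀))).exists
    obtain ⟨m, hm1, hm2⟩ := exists_between hb1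
    obtain ⟨d, hd0, hd⟩ := herr (b₀ - b) (sub_pos.2 hb2) (a - m) (sub_pos.2 hm2)
    have e : -d * (x - b) + t * -d / lam = -(d * (b₀ - b)) := by rw [hb₀]; ring
    filter_upwards [error_bound hlam hr ht x b (-d) (e ▸ hd), (tendsto_fixedPoint_cutTail hr hq hq0
      hg hx hb3).eventually (gt_mem_nhds hm1)] with n hn1 hn2
    have h1 := (h n).upper_bound (div_nonpos_of_nonpos_of_nonneg (neg_nonpos.2 hd0.le)
      n.cast_nonneg) (n * b) ⌊(n : ℝ) * t⌋₊ (n * x) (mul_nonneg n.cast_nonneg hx.le)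
    linarith [hn1.2]

end scaling

/-! ### Regularly varying tails -/

section potter

variable {f : ℝ → ℝ} {ν : ℝ}

/-- At a zero of `f` the quotient f(x)/f(x) has the default value 0, whereas regular variation with
c = 1 forces it to tend to 1. So `f` is positive arbitrarily far out, hence everywhere. -/
lemma RegularlyVarying.pos_of_antitone (h : RegularlyVarying f ν) (hf : Antitone f)
    (h0 : ∀ x, 0 ≤ f x) (x : ℝ) : 0 < f x := by
  have h1 := h 1 one_pos
  rw [Real.one_rpow] at h1
  obtain ⟨y, hy, hxy⟩ := ((h1.eventually (lt_mem_nhds one_pos)).and (eventually_ge_atTop x)).exists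
  refine lt_of_lt_of_le ((h0 y).lt_of_ne fun hne => ?_) (hf hxy)
  simp [← hne] at hy

/-- The growth of `f` on dyadic scales. -/
structure Doubling (f : ℝ → ℝ) (p q z : ℝ) : Prop where
  one_le : 1 ≤ z
  lower : ∀ x, z ≤ x → f x ≤ 2 ^ q * f (2 * x)
  upper : ∀ x, z ≤ x → f (2 * x) ≤ 2 ^ (-p) * f x

/-- Only the ratio at scale 2 is used: its limit 2^(-ν) lies strictly between 2^(-q) and 2^(-p). -/
lemma RegularlyVarying.exists_doubling (h : RegularlyVarying f (-ν)) (hpos : ∀ x, 0 < f x)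
    {p q : ℝ} (hp : p < ν) (hq : ν < q) : ∃ z, Doubling f p q z := by
  have h1 := h 2 two_pos
  have hp' : (2 : ℝ) ^ (-ν) < 2 ^ (-p) := Real.rpow_lt_rpow_of_exponent_lt one_lt_two (by linarith)
  have hq' : (2 : ℝ) ^ (-q) < 2 ^ (-ν) := Real.rpow_lt_rpow_of_exponent_lt one_lt_two (by linarith)
  obtain ⟨z, hz⟩ := eventually_atTop.1 ((h1.eventually (gt_mem_nhds hp')).and
    (h1.eventually (lt_mem_nhds hq')))
  refine ⟨max z 1, le_max_right _ _, fun x hx => ?_, fun x hx => ?_⟩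
  · have h2 := (lt_div_iff₀ (hpos x)).1 (hz x ((le_max_left _ _).trans hx)).2
    rw [Real.rpow_neg two_pos.le, inv_mul_lt_iff₀ (by positivity)] at h2
    exact h2.le
  · exact ((div_lt_iff₀ (hpos x)).1 (hz x ((le_max_left _ _).trans hx)).1).le

namespace Doubling

variable {p q z : ℝ} (h : Doubling f p q z)

include h

lemma le_two_pow_mul {x : ℝ} (hx : z ≤ x) (n : ℕ) : z ≤ 2 ^ n * x :=
  hx.trans (le_mul_of_one_le_left (by linarith [h.one_le]) (one_le_pow₀ one_le_two))

lemma lower_pow {x : ℝ} (hx : z ≤ x) (n : ℕ) : f x ≤ (2 ^ n : ℝ) ^ q * f (2 ^ n * x) := by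
  induction n with
  | zero => simp
  | succ n ih =>
    refine ih.trans ?_
    have h1 := h.lower _ (h.le_two_pow_mul hx n)
    calc (2 ^ n : ℝ) ^ q * f (2 ^ n * x)
        ≤ (2 ^ n : ℝ) ^ q * (2 ^ q * f (2 * (2 ^ n * x))) := by gcongr
      _ = (2 ^ (n + 1) : ℝ) ^ q * f (2 ^ (n + 1) * x) := by
        rw [pow_succ, Real.mul_rpow (by positivity) two_pos.le, ← mul_assoc]
        congr 2; ring

lemma upper_pow {x : ℝ} (hx : z ≤ x) (n : ℕ) : f (2 ^ n * x) ≤ (2 ^ n : ℝ) ^ (-p) * f x := by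
  induction n with
  | zero => simp
  | succ n ih =>
    calc f (2 ^ (n + 1) * x) = f (2 * (2 ^ n * x)) := by congr 1; ring
      _ ≤ 2 ^ (-p) * f (2 ^ n * x) := h.upper _ (h.le_two_pow_mul hx n)
      _ ≤ 2 ^ (-p) * ((2 ^ n : ℝ) ^ (-p) * f x) := by gcongr
      _ = (2 ^ (n + 1) : ℝ) ^ (-p) * f x := by
        rw [pow_succ, Real.mul_rpow (by positivity) two_pos.le]; ring

/-- Bracket `w / x` between consecutive powers of 2 and iterate the doubling inequality; rounding up
costs the factor 2. -/
lemma le_rpow_mul (hf : Antitone f) (h0 : ∀ x, 0 ≤ f x) (hq : 0 ≤ q) {x w : ℝ} (hx : z ≤ x)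
    (hw : x ≤ w) : f x ≤ (2 * (w / x)) ^ q * f w := by
  have hx0 : 0 < x := by linarith [h.one_le]
  obtain ⟨n, hn1, hn2⟩ := exists_nat_pow_near ((one_le_div hx0).2 hw) one_lt_two
  refine (h.lower_pow hx (n + 1)).trans ?_
  have hw0 : 0 < w := hx0.trans_le hw
  have h1 : w ≤ 2 ^ (n + 1) * x := ((div_lt_iff₀ hx0).1 hn2).le
  have h2 : (2 : ℝ) ^ (n + 1) ≤ 2 * (w / x) := by rw [pow_succ']; linarith
  exact mul_le_mul (Real.rpow_le_rpow (by positivity) h2 hq) (hf h1) (h0 _) (by positivity)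

lemma upper_potter (hf : Antitone f) (h0 : ∀ x, 0 ≤ f x) (hp : 0 ≤ p) {x u : ℝ} (hx : z ≤ x)
    (hu : 1 ≤ u) : f (u * x) ≤ 2 ^ p * u ^ (-p) * f x := by
  have hx0 : 0 < x := by linarith [h.one_le]
  obtain ⟨n, hn1, hn2⟩ := exists_nat_pow_near hu one_lt_two
  have h1 : f (u * x) ≤ f (2 ^ n * x) := hf (by gcongr)
  refine (h1.trans (h.upper_pow hx n)).trans (mul_le_mul_of_nonneg_right ?_ (h0 _))
  have h2 : u / 2 ≤ 2 ^ n := by rw [div_le_iff₀ two_pos, ← pow_succ]; exact hn2.le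
  refine (Real.rpow_le_rpow_of_nonpos (by linarith) h2 (by linarith)).trans (le_of_eq ?_)
  rw [Real.div_rpow (by linarith) two_pos.le, Real.rpow_neg two_pos.le, div_inv_eq_mul, mul_comm]

lemma lower_potter (hf : Antitone f) (hpos : ∀ x, 0 < f x) (h1 : ∀ x, f x ≤ 1) (hq : 0 ≤ q)
    {x u : ℝ} (hx : z ≤ x) (hu0 : 0 < u) (hu : u ≤ 1) :
    f (u * x) ≤ 2 ^ q / f z * u ^ (-q) * f x := by
  have hz0 : 0 < z := by linarith [h.one_le]
  have hx0 : 0 < x := hz0.trans_le hx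
  have e : (2 / u) ^ q = 2 ^ q * u ^ (-q) := by
    rw [Real.div_rpow two_pos.le hu0.le, Real.rpow_neg hu0.le, div_eq_mul_inv]
  have key : 2 ^ q / f z * u ^ (-q) * f x = (2 / u) ^ q * f x / f z := by rw [e]; ring
  rw [key, le_div_iff₀ (hpos z)]
  rcases le_total z (u * x) with hc | hc
  · have h2 := h.le_rpow_mul hf (fun x => (hpos x).le) hq hc (mul_le_of_le_one_left hx0.le hu)
    have e2 : 2 * (x / (u * x)) = 2 / u := by field_simp
    rw [e2] at h2
    exact (mul_le_of_le_one_right (hpos _).le (h1 z)).trans h2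
  -- Below the threshold `z` doubling is not available. Instead `f ≤ 1` is used at `u * x`, and `f
  -- z` is compared with `f x`; this is the origin of the constant `1 / f z`.
  · have h2 := h.le_rpow_mul hf (fun x => (hpos x).le) hq le_rfl hx
    refine (mul_le_of_le_one_left (hpos z).le (h1 _)).trans (h2.trans
      (mul_le_mul_of_nonneg_right (Real.rpow_le_rpow (by positivity) ?_ hq) (hpos x).le))
    rw [div_eq_mul_inv 2 u]
    refine mul_le_mul_of_nonneg_left ?_ two_pos.le
    rw [div_le_iff₀ hz0, ← div_eq_inv_mul, le_div_iff₀ hu0, mul_comm]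
    exact hc

end Doubling

/-- Potter's bounds. -/
structure PotterBound (f : ℝ → ℝ) (p q C z : ℝ) : Prop where
  nonneg : 0 ≤ C
  upper : ∀ x u, z ≤ x → 1 ≤ u → f (x * u) / f x ≤ C * u ^ (-p)
  lower : ∀ x u, z ≤ x → 0 < u → u ≤ 1 → f (x * u) / f x ≤ C * u ^ (-q)

lemma RegularlyVarying.exists_potterBound (h : RegularlyVarying f (-ν)) (hf : Antitone f)
    (h0 : ∀ x, 0 ≤ f x) (h1 : ∀ x, f x ≤ 1) {p q : ℝ} (hp0 : 0 ≤ p) (hp : p < ν) (hq : ν < q) :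
    ∃ C z, PotterBound f p q C z := by
  have hpos := h.pos_of_antitone hf h0
  obtain ⟨z, hz⟩ := h.exists_doubling hpos hp hq
  refine ⟨2 ^ q / f z, z, div_nonneg (by positivity) (h0 z), fun x u hx hu => ?_,
    fun x u hx hu0 hu => ?_⟩
  · rw [div_le_iff₀ (hpos x), mul_comm x]
    refine (hz.upper_potter hf h0 hp0 hx hu).trans ?_
    have h2 : (2 : ℝ) ^ p ≤ 2 ^ q / f z := by
      rw [le_div_iff₀ (hpos z)]
      refine (mul_le_of_le_one_right (by positivity) (h1 z)).trans ?_
      exact Real.rpow_le_rpow_of_exponent_le one_le_two (by linarith)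
    have := h0 x
    gcongr
  · rw [div_le_iff₀ (hpos x), mul_comm x]
    exact hz.lower_potter hf hpos h1 (by linarith) hx hu0 hu

end potter

/-! ### The equations for the tail of the largest service time and for `κ` -/

/-- The weight `1 - e ^ (-θ s)` on `(0, 1]`, continued by `1`. -/
noncomputable def weight (θ s : ℝ) : ℝ := if s ≤ 1 then 1 - Real.exp (-(θ * s)) else 1

lemma weight_nonneg {θ s : ℝ} (hθ : 0 ≤ θ) (hs : 0 ≤ s) : 0 ≤ weight θ s := by
  unfold weight
  split_ifs
  · exact sub_nonneg.2 (Real.exp_le_one_iff.2 (neg_nonpos.2 (mul_nonneg hθ hs)))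
  · exact zero_le_one

lemma weight_mono {θ θ' s : ℝ} (hθ : θ ≤ θ') (hs : 0 ≤ s) : weight θ s ≤ weight θ' s := by
  unfold weight
  split_ifs
  · gcongr
  · exact le_rfl

lemma measurable_weight (θ : ℝ) : Measurable (weight θ) :=
  Measurable.ite measurableSet_Iic (by fun_prop) measurable_const

/-- An integrable function that bounds `min 1 s` times the tails allowed by Potter's bounds. -/
noncomputable def envelope (p q s : ℝ) : ℝ := if s ≤ 1 then s ^ (1 - q) else s ^ (-p)

lemma integrableOn_envelope {p q : ℝ} (hp : 1 < p) (hq : q < 2) :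
    IntegrableOn (envelope p q) (Ioi 0) := by
  rw [← Ioc_union_Ioi_eq_Ioi zero_le_one, integrableOn_union]
  constructor
  · have h1 : IntegrableOn (fun s : ℝ => s ^ (1 - q)) (Ioc 0 1) := by
      rw [← intervalIntegrable_iff_integrableOn_Ioc_of_le zero_le_one]
      exact intervalIntegral.intervalIntegrable_rpow' (by linarith)
    exact h1.congr_fun (fun s hs => (if_pos hs.2).symm) measurableSet_Ioc
  · have h1 : IntegrableOn (fun s : ℝ => s ^ (-p)) (Ioi 1) :=
      integrableOn_Ioi_rpow_of_lt (by linarith) one_pos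
    exact h1.congr_fun (fun s hs => (if_neg (not_le.2 hs)).symm) measurableSet_Ioi

lemma weight_mul_le {p q C θ s : ℝ} {φ : ℝ → ℝ} (hθ : 0 ≤ θ) (hs : 0 < s) (hφ : 0 ≤ φ s)
    (h1 : 1 ≤ s → φ s ≤ C * s ^ (-p)) (h2 : s ≤ 1 → φ s ≤ C * s ^ (-q)) :
    weight θ s * φ s ≤ (1 + θ) * C * envelope p q s := by
  unfold weight envelope
  split_ifs with h
  · have e : s ^ (1 - q) = s * s ^ (-q) := by
      rw [sub_eq_add_neg, Real.rpow_add hs, Real.rpow_one]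
    have h3 := Real.add_one_le_exp (-(θ * s))
    calc (1 - Real.exp (-(θ * s))) * φ s ≤ ((1 + θ) * s) * (C * s ^ (-q)) :=
          mul_le_mul (by nlinarith) (h2 h) hφ (by positivity)
      _ = _ := by rw [e]; ring
  · rw [one_mul]
    have h3 := h1 (not_le.1 h).le
    have h4 : 0 ≤ C * s ^ (-p) := hφ.trans h3
    nlinarith

/-- The left side of the equation for the scaled tail of the largest service time. -/
noncomputable def balance (a r : ℝ) (φ : ℝ → ℝ) (k : ℝ) : ℝ :=
  k * a + r * k * (∫ s in Ioi 0, weight (r * k) s * φ s) - Real.exp (-(r * k))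

lemma balance_mono {a r : ℝ} {φ : ℝ → ℝ} (ha : 0 ≤ a) (hr : 0 ≤ r) (hφ : ∀ s, 0 ≤ φ s)
    (hint : ∀ k, 0 ≤ k → IntegrableOn (fun s => weight (r * k) s * φ s) (Ioi 0)) {k k' : ℝ}
    (hk : 0 ≤ k) (hkk : k ≤ k') : balance a r φ k ≤ balance a r φ k' := by
  have h1 : ∫ s in Ioi 0, weight (r * k) s * φ s ≤ ∫ s in Ioi 0, weight (r * k') s * φ s :=
    setIntegral_mono_on (hint k hk) (hint k' (hk.trans hkk)) measurableSet_Ioi fun s hs =>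
      mul_le_mul_of_nonneg_right (weight_mono (by gcongr) (le_of_lt hs)) (hφ s)
  have h2 : 0 ≤ ∫ s in Ioi 0, weight (r * k) s * φ s := setIntegral_nonneg measurableSet_Ioi
    fun s hs => mul_nonneg (weight_nonneg (mul_nonneg hr hk) (le_of_lt hs)) (hφ s)
  have h3 : 0 ≤ r * k' := mul_nonneg hr (hk.trans hkk)
  unfold balance
  gcongr

/-! ### The Pareto distribution -/

lemma paretoMeasure_eq_withDensity (ν : ℝ) : paretoMeasure 1 ν = volume.withDensity
    fun x => ENNReal.ofReal ((Ici 1).indicator (fun x => ν * x ^ (-(ν + 1))) x) := by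
  rw [paretoMeasure]
  congr 1
  ext x
  classical
  simp [paretoPDF, paretoPDFReal, indicator_apply]

lemma measurable_paretoDensity (ν : ℝ) : Measurable fun x =>
    ENNReal.ofReal ((Ici (1 : ℝ)).indicator (fun x => ν * x ^ (-(ν + 1))) x) :=
  (Measurable.indicator (by fun_prop) measurableSet_Ici).ennreal_ofReal

lemma integral_paretoMeasure {ν : ℝ} (hν : 0 < ν) (g : ℝ → ℝ) :
    ∫ u, g u ∂(paretoMeasure 1 ν) = ∫ u in Ioi 1, ν * u ^ (-(ν + 1)) * g u := by
  rw [paretoMeasure_eq_withDensity, integral_withDensity_eq_integral_toReal_smul, ← integral_Ici_eq_integral_Ioi,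
    ← integral_indicator measurableSet_Ici]
  · refine integral_congr_ae (Filter.Eventually.of_forall fun x => ?_)
    by_cases hx : x ∈ Ici (1 : ℝ)
    · have hx0 : 0 ≤ ν * x ^ (-(ν + 1)) :=
        mul_nonneg hν.le (Real.rpow_nonneg (zero_le_one.trans hx) _)
      simp only [indicator_of_mem hx, ENNReal.toReal_ofReal hx0, smul_eq_mul]
    · simp [indicator_of_notMem hx]
  · exact measurable_paretoDensity ν
  · exact Filter.Eventually.of_forall fun x => ENNReal.ofReal_lt_top

/-- The Laplace transform of the Pareto distribution. -/
noncomputable def paretoLaplace (ν θ : ℝ) : ℝ := ∫ u, Real.exp (-(θ * u)) ∂(paretoMeasure 1 ν)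

lemma integrableOn_exp_mul_rpow {θ : ℝ} (hθ : 0 ≤ θ) {p : ℝ} (hp : 1 < p) :
    IntegrableOn (fun u : ℝ => Real.exp (-(θ * u)) * u ^ (-p)) (Ioi 1) := by
  have h1 : IntegrableOn (fun s : ℝ => s ^ (-p)) (Ioi 1) :=
    integrableOn_Ioi_rpow_of_lt (by linarith) one_pos
  refine h1.mono' (Measurable.aestronglyMeasurable (by fun_prop)) ?_
  refine (ae_restrict_iff' measurableSet_Ioi).2 (Filter.Eventually.of_forall fun u hu => ?_)
  have hu0 : (0 : ℝ) < u := one_pos.trans hu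
  rw [Real.norm_eq_abs, abs_of_nonneg (by positivity)]
  exact mul_le_of_le_one_left (by positivity)
    (Real.exp_le_one_iff.2 (neg_nonpos.2 (mul_nonneg hθ hu0.le)))

/-- Integration by parts: the transform is expressed through the tail u^(-ν) instead of the density,
since `balance` is written in terms of tails. -/
lemma paretoLaplace_eq {ν θ : ℝ} (hν : 1 < ν) (hθ : 0 ≤ θ) : paretoLaplace ν θ =
    Real.exp (-θ) - θ * ∫ u in Ioi 1, Real.exp (-(θ * u)) * u ^ (-ν) := by
  have i1 := (integrableOn_exp_mul_rpow hθ hν).const_mul θ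
  have i2 := (integrableOn_exp_mul_rpow hθ (by linarith : 1 < ν + 1)).const_mul ν
  have hd : ∀ u ∈ Ioi (1 : ℝ), HasDerivAt (fun u => -(Real.exp (-(θ * u)) * u ^ (-ν)))
      (θ * (Real.exp (-(θ * u)) * u ^ (-ν)) + ν * (Real.exp (-(θ * u)) * u ^ (-(ν + 1)))) u := by
    intro u hu
    have hu0 : u ≠ 0 := (one_pos.trans hu).ne'
    have h1 : HasDerivAt (fun u => Real.exp (-(θ * u))) (Real.exp (-(θ * u)) * (-(θ * 1))) u :=
      (((hasDerivAt_id u).const_mul θ).neg).exp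
    have h2 := Real.hasDerivAt_rpow_const (x := u) (p := -ν) (Or.inl hu0)
    refine (h1.mul h2).neg.congr_deriv ?_
    rw [show -ν - 1 = -(ν + 1) by ring]
    ring
  have hlim : Tendsto (fun u => -(Real.exp (-(θ * u)) * u ^ (-ν))) atTop (𝓝 0) := by
    rw [← neg_zero]
    refine Tendsto.neg ?_
    refine squeeze_zero' ?_ ?_ (tendsto_rpow_neg_atTop (by linarith : 0 < ν))
    · filter_upwards [eventually_ge_atTop 0] with u hu
      positivity
    · filter_upwards [eventually_ge_atTop 0] with u hu
      exact mul_le_of_le_one_left (by positivity)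
        (Real.exp_le_one_iff.2 (neg_nonpos.2 (mul_nonneg hθ hu)))
  have hc : ContinuousWithinAt (fun u => -(Real.exp (-(θ * u)) * u ^ (-ν))) (Ici 1) 1 := by
    refine ContinuousAt.continuousWithinAt ?_
    exact ((Continuous.continuousAt (by fun_prop)).mul
      (Real.continuousAt_rpow_const _ _ (Or.inl one_ne_zero))).neg
  have h := integral_Ioi_of_hasDerivAt_of_tendsto hc hd (i1.add i2) hlim
  have i3 : ∫ u in Ioi 1, θ * (Real.exp (-(θ * u)) * u ^ (-ν)) +
      ν * (Real.exp (-(θ * u)) * u ^ (-(ν + 1))) =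
      (∫ u in Ioi 1, θ * (Real.exp (-(θ * u)) * u ^ (-ν))) +
      ∫ u in Ioi 1, ν * (Real.exp (-(θ * u)) * u ^ (-(ν + 1))) := integral_add i1 i2
  rw [i3, integral_const_mul, Real.one_rpow, mul_one, mul_one, zero_sub, neg_neg] at h
  rw [paretoLaplace, integral_paretoMeasure (by linarith)]
  have e : ∫ u in Ioi 1, ν * u ^ (-(ν + 1)) * Real.exp (-(θ * u)) =
      ∫ u in Ioi 1, ν * (Real.exp (-(θ * u)) * u ^ (-(ν + 1))) := by
    congr 1; ext u; ring
  rw [e]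
  linarith

/-- The integral representation of the power function of exponent `ν`. -/
lemma mul_integral_one_sub_exp_mul_rpow {ν θ : ℝ} (hν : 1 < ν) (hν' : ν < 2) (hθ : 0 < θ) :
    IntegrableOn (fun u : ℝ => (1 - Real.exp (-(θ * u))) * u ^ (-ν)) (Ioi 0) ∧
    θ * ∫ u in Ioi 0, (1 - Real.exp (-(θ * u))) * u ^ (-ν) = -Real.Gamma (1 - ν) * θ ^ ν := by
  have hν1 : 1 - ν ≠ 0 := by linarith
  have hexp : ∀ u, 0 ≤ u → 0 ≤ 1 - Real.exp (-(θ * u)) ∧ 1 - Real.exp (-(θ * u)) ≤ 1 ∧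
      1 - Real.exp (-(θ * u)) ≤ θ * u := fun u hu => by
    have h1 := Real.add_one_le_exp (-(θ * u))
    have h2 : Real.exp (-(θ * u)) ≤ 1 :=
      Real.exp_le_one_iff.2 (neg_nonpos.2 (mul_nonneg hθ.le hu))
    have h3 := Real.exp_pos (-(θ * u))
    refine ⟨?_, ?_, ?_⟩ <;> linarith
  have i1 : IntegrableOn (fun u : ℝ => (1 - Real.exp (-(θ * u))) * u ^ (-ν)) (Ioi 0) := by
    refine ((integrableOn_envelope hν hν').const_mul (1 + θ)).mono'
      (Measurable.aestronglyMeasurable (by fun_prop)) ?_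
    refine (ae_restrict_iff' measurableSet_Ioi).2 (Filter.Eventually.of_forall fun u hu => ?_)
    have hu0 : (0 : ℝ) < u := hu
    obtain ⟨h1, h2, h3⟩ := hexp u hu0.le
    rw [Real.norm_eq_abs, abs_of_nonneg (by positivity), envelope]
    split_ifs with h
    · have e : u ^ (1 - ν) = u * u ^ (-ν) := by
        rw [sub_eq_add_neg, Real.rpow_add hu0, Real.rpow_one]
      rw [e, ← mul_assoc]
      gcongr
      nlinarith
    · gcongr
      linarith
  have hG := Real.integral_rpow_mul_exp_neg_mul_Ioi (a := 2 - ν) (r := θ) (by linarith) hθ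
  have hGpos : 0 < (1 / θ) ^ (2 - ν) * Real.Gamma (2 - ν) :=
    mul_pos (by positivity) (Real.Gamma_pos_of_pos (by linarith))
  have i2 : IntegrableOn (fun u : ℝ => u ^ (2 - ν - 1) * Real.exp (-(θ * u))) (Ioi 0) := by
    by_contra hcon
    rw [integral_undef hcon] at hG
    exact hGpos.ne hG
  refine ⟨i1, ?_⟩
  -- This primitive vanishes at infinity because 1 - ν < 0, and at 0 because 1 - exp(-θu) ≤ θu and 2
  -- - ν > 0. So the integral reduces to that of Γ(2 - ν) = (1 - ν) Γ(1 - ν).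
  have hd : ∀ u ∈ Ioi (0 : ℝ), HasDerivAt
      (fun u => (1 - Real.exp (-(θ * u))) * u ^ (1 - ν) / (1 - ν))
      ((1 - Real.exp (-(θ * u))) * u ^ (-ν) +
        θ / (1 - ν) * (u ^ (2 - ν - 1) * Real.exp (-(θ * u)))) u := by
    intro u hu
    have hu0 : u ≠ 0 := (ne_of_gt hu)
    have h1 : HasDerivAt (fun u => 1 - Real.exp (-(θ * u)))
        (-(Real.exp (-(θ * u)) * (-(θ * 1)))) u :=
      (((hasDerivAt_id u).const_mul θ).neg).exp.const_sub 1
    have h2 := Real.hasDerivAt_rpow_const (x := u) (p := 1 - ν) (Or.inl hu0)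
    refine ((h1.mul h2).div_const (1 - ν)).congr_deriv ?_
    rw [show 1 - ν - 1 = -ν by ring, show 2 - ν - 1 = 1 - ν by ring]
    field_simp
    ring
  have hnorm : ∀ u : ℝ, 0 ≤ u → ‖(1 - Real.exp (-(θ * u))) * u ^ (1 - ν) / (1 - ν)‖ =
      (1 - Real.exp (-(θ * u))) * u ^ (1 - ν) / (ν - 1) := fun u hu => by
    have h2 : 0 ≤ (1 - Real.exp (-(θ * u))) * u ^ (1 - ν) :=
      mul_nonneg (hexp u hu).1 (Real.rpow_nonneg hu _)
    rw [norm_div, Real.norm_eq_abs, abs_of_nonneg h2, Real.norm_eq_abs,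
      abs_of_neg (by linarith : 1 - ν < 0), neg_sub]
  have hlim : Tendsto (fun u => (1 - Real.exp (-(θ * u))) * u ^ (1 - ν) / (1 - ν)) atTop
      (𝓝 0) := by
    have h1 := (tendsto_rpow_neg_atTop (by linarith : 0 < ν - 1)).div_const (ν - 1)
    rw [zero_div] at h1
    refine squeeze_zero_norm' ?_ h1
    filter_upwards [eventually_ge_atTop 0] with u hu
    rw [hnorm u hu, neg_sub]
    have : 0 < ν - 1 := by linarith
    gcongr
    exact mul_le_of_le_one_left (by positivity) (hexp u hu).2.1
  have hc : ContinuousWithinAt (fun u => (1 - Real.exp (-(θ * u))) * u ^ (1 - ν) / (1 - ν))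
      (Ici 0) 0 := by
    have h1 : Tendsto (fun u : ℝ => θ * u ^ (2 - ν) / (ν - 1)) (𝓝[Ici 0] 0) (𝓝 0) := by
      have h2 := ((Real.continuousAt_rpow_const 0 (2 - ν) (Or.inr (by linarith))).tendsto.const_mul
        θ).div_const (ν - 1)
      rw [Real.zero_rpow (by linarith), mul_zero, zero_div] at h2
      exact h2.mono_left nhdsWithin_le_nhds
    have h3 : (1 - Real.exp (-(θ * 0))) * (0 : ℝ) ^ (1 - ν) / (1 - ν) = 0 := by simp
    rw [ContinuousWithinAt, h3]
    refine squeeze_zero_norm' ?_ h1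
    filter_upwards [self_mem_nhdsWithin] with u hu
    rw [hnorm u hu]
    refine div_le_div_of_nonneg_right ?_ (by linarith)
    rcases (show (0 : ℝ) ≤ u from hu).eq_or_lt with rfl | hu0
    · rw [Real.zero_rpow hν1, Real.zero_rpow (by linarith : 2 - ν ≠ 0)]
      simp
    · rw [show 2 - ν = 1 + (1 - ν) by ring, Real.rpow_add hu0, Real.rpow_one, ← mul_assoc]
      gcongr
      exact (hexp u hu0.le).2.2
  have h := integral_Ioi_of_hasDerivAt_of_tendsto hc hd (i1.add (i2.const_mul _)) hlim
  have i3 : ∫ u in Ioi 0, (1 - Real.exp (-(θ * u))) * u ^ (-ν) +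
        θ / (1 - ν) * (u ^ (2 - ν - 1) * Real.exp (-(θ * u))) =
      (∫ u in Ioi 0, (1 - Real.exp (-(θ * u))) * u ^ (-ν)) +
      ∫ u in Ioi 0, θ / (1 - ν) * (u ^ (2 - ν - 1) * Real.exp (-(θ * u))) :=
    integral_add i1 (i2.const_mul _)
  rw [i3, integral_const_mul, hG] at h
  have hGam : Real.Gamma (2 - ν) = (1 - ν) * Real.Gamma (1 - ν) := by
    rw [← Real.Gamma_add_one hν1]; congr 1; ring
  have hpow : θ ^ ν = θ * (θ * (1 / θ) ^ (2 - ν)) := by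
    rw [one_div, Real.inv_rpow hθ.le, ← Real.rpow_neg hθ.le, neg_sub, ← mul_assoc, ← sq,
      ← Real.rpow_two, ← Real.rpow_add hθ]
    congr 1; ring
  have h0 : (1 - Real.exp (-(θ * 0))) * (0 : ℝ) ^ (1 - ν) / (1 - ν) = 0 := by simp
  rw [h0, hGam] at h
  have h4 : ∫ u in Ioi 0, (1 - Real.exp (-(θ * u))) * u ^ (-ν) =
      -(θ * (1 / θ) ^ (2 - ν) * Real.Gamma (1 - ν)) := by
    have e : θ / (1 - ν) * ((1 / θ) ^ (2 - ν) * ((1 - ν) * Real.Gamma (1 - ν))) =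
      θ * (1 / θ) ^ (2 - ν) * Real.Gamma (1 - ν) := by field_simp
    rw [e] at h
    linarith
  rw [h4, hpow]
  ring

/-! ### The function `κ` -/

lemma Gamma_one_sub_neg {ν : ℝ} (hν : 1 < ν) (hν' : ν < 2) : Real.Gamma (1 - ν) < 0 := by
  have h1 : Real.Gamma (2 - ν) = (1 - ν) * Real.Gamma (1 - ν) := by
    rw [← Real.Gamma_add_one (by linarith : 1 - ν ≠ 0)]; congr 1; ring
  have h2 := Real.Gamma_pos_of_pos (by linarith : 0 < 2 - ν)
  rw [h1] at h2
  exact neg_of_mul_pos_right h2 (by linarith)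

lemma paretoLaplace_zero {ν : ℝ} (hν : 0 < ν) : paretoLaplace ν 0 = 1 := by
  have := isProbabilityMeasure_paretoMeasure one_pos hν
  simp [paretoLaplace]

section laplace

variable {ν : ℝ}

lemma ae_paretoMeasure_one_le : ∀ᵐ u ∂(paretoMeasure 1 ν), 1 ≤ u := by
  rw [paretoMeasure_eq_withDensity, ae_withDensity_iff (measurable_paretoDensity ν)]
  refine Filter.Eventually.of_forall fun x hx => ?_
  by_contra hcon
  exact hx (by simp [indicator_of_notMem, hcon])

lemma ae_exp_pareto_le_one {θ : ℝ} (hθ : 0 ≤ θ) :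
    ∀ᵐ u ∂(paretoMeasure 1 ν), ‖Real.exp (-(θ * u))‖ ≤ 1 := by
  filter_upwards [ae_paretoMeasure_one_le] with u hu
  rw [Real.norm_eq_abs, abs_of_pos (Real.exp_pos _)]
  exact Real.exp_le_one_iff.2 (neg_nonpos.2 (mul_nonneg hθ (by linarith)))

lemma integrable_exp_pareto (hν : 0 < ν) {θ : ℝ} (hθ : 0 ≤ θ) :
    Integrable (fun u => Real.exp (-(θ * u))) (paretoMeasure 1 ν) := by
  have := isProbabilityMeasure_paretoMeasure one_pos hν
  exact (integrable_const 1).mono' (Measurable.aestronglyMeasurable (by fun_prop))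
    (ae_exp_pareto_le_one hθ)

lemma paretoLaplace_anti (hν : 0 < ν) : AntitoneOn (paretoLaplace ν) (Ici 0) := by
  intro a ha b hb hab
  refine integral_mono_ae (integrable_exp_pareto hν hb) (integrable_exp_pareto hν ha) ?_
  filter_upwards [ae_paretoMeasure_one_le] with u hu
  have : 0 ≤ u := by linarith
  show Real.exp (-(b * u)) ≤ Real.exp (-(a * u))
  gcongr

lemma continuousOn_paretoLaplace (hν : 0 < ν) : ContinuousOn (paretoLaplace ν) (Ici 0) := by
  have := isProbabilityMeasure_paretoMeasure one_pos hν
  refine continuousOn_of_dominated (bound := fun _ => 1)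
    (fun θ _ => Measurable.aestronglyMeasurable (by fun_prop))
    (fun θ hθ => ae_exp_pareto_le_one hθ) (integrable_const 1)
    (Filter.Eventually.of_forall fun u => Continuous.continuousOn (by fun_prop))

end laplace

/-- The function whose positive zero is `κ`. -/
noncomputable def kappaFun (lam ν a k : ℝ) : ℝ :=
  k * a + -Real.Gamma (1 - ν) * (lam * k) ^ ν - paretoLaplace ν (lam * k)

section kappa

variable {lam ν γ a y k : ℝ}

/-- Multiplication by the positive number -Γ(1 - ν) brings the equation to a form whose left side
increases in `k`. -/
lemma kappaEq_iff (hν : 1 < ν) (hν' : ν < 2) :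
    KappaEq lam ν γ y k ↔ kappaFun lam ν (γ * y ^ (ν - 1)) k = 0 := by
  have h1 := (Gamma_one_sub_neg hν hν').ne
  rw [KappaEq, kappaFun, ← paretoLaplace]
  set E := paretoLaplace ν (lam * k)
  set p := (lam * k) ^ ν
  constructor
  · intro h
    rw [← h]
    field_simp
    ring
  · intro h
    have h2 : E = k * (γ * y ^ (ν - 1)) + -Real.Gamma (1 - ν) * p := by linarith
    rw [h2]
    field_simp
    ring

/-- The weight is 1 - exp(-θs) on all of (0, ∞) plus exp(-θs) on (1, ∞). The first part gives the
power with the Gamma factor; the second combines with exp(-θ) into the Laplace transform of the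
Pareto law. -/
lemma balance_rpow_eq_kappaFun (hlam : 0 < lam) (hν : 1 < ν) (hν' : ν < 2) (hk : 0 < k) :
    balance a lam (fun s => s ^ (-ν)) k = kappaFun lam ν a k := by
  have hθ : 0 < lam * k := mul_pos hlam hk
  obtain ⟨i1, h1⟩ := mul_integral_one_sub_exp_mul_rpow hν hν' hθ
  have i2 := integrableOn_exp_mul_rpow hθ.le hν
  have i3 : IntegrableOn ((Ioi 1).indicator fun u : ℝ => Real.exp (-(lam * k * u)) * u ^ (-ν))
      (Ioi 0) := ((integrable_indicator_iff measurableSet_Ioi).2 i2).integrableOn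
  have e : ∫ s in Ioi 0, weight (lam * k) s * s ^ (-ν) =
      (∫ u in Ioi 0, (1 - Real.exp (-(lam * k * u))) * u ^ (-ν)) +
      ∫ u in Ioi 1, Real.exp (-(lam * k * u)) * u ^ (-ν) := by
    have e1 : ∫ u in Ioi 1, Real.exp (-(lam * k * u)) * u ^ (-ν) = ∫ u in Ioi (0 : ℝ),
        (Ioi 1).indicator (fun u : ℝ => Real.exp (-(lam * k * u)) * u ^ (-ν)) u := by
      rw [setIntegral_indicator measurableSet_Ioi,
        inter_eq_self_of_subset_right (Ioi_subset_Ioi zero_le_one)]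
    rw [e1, ← integral_add i1 i3]
    refine setIntegral_congr_fun measurableSet_Ioi fun s _ => ?_
    by_cases hs : s ≤ 1
    · have hs' : s ∉ Ioi (1 : ℝ) := not_lt.2 hs
      simp only [weight, if_pos hs, indicator_of_notMem hs', add_zero]
    · have hs' : s ∈ Ioi (1 : ℝ) := not_le.1 hs
      simp only [weight, if_neg hs, indicator_of_mem hs']
      ring
  rw [balance, kappaFun, e, paretoLaplace_eq hν hθ.le, ← h1]
  ring

lemma kappaFun_strictMonoOn (hlam : 0 < lam) (hν : 1 < ν) (hν' : ν < 2) (ha : 0 ≤ a) :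
    StrictMonoOn (kappaFun lam ν a) (Ici 0) := by
  intro k hk k' hk' hkk
  have hk : 0 ≤ k := hk
  have h1 := paretoLaplace_anti (by linarith : 0 < ν) (mul_nonneg hlam.le hk)
    (mul_nonneg hlam.le hk') (mul_le_mul_of_nonneg_left hkk.le hlam.le)
  have h2 : -Real.Gamma (1 - ν) * (lam * k) ^ ν < -Real.Gamma (1 - ν) * (lam * k') ^ ν :=
    mul_lt_mul_of_pos_left (Real.rpow_lt_rpow (by positivity) (by gcongr) (by linarith))
      (neg_pos.2 (Gamma_one_sub_neg hν hν'))
  have h3 : k * a ≤ k' * a := by gcongr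
  unfold kappaFun
  linarith

lemma exists_kappaFun_eq_zero (hlam : 0 < lam) (hν : 1 < ν) (hν' : ν < 2) (ha : 0 ≤ a) :
    ∃ k, 0 < k ∧ kappaFun lam ν a k = 0 := by
  have hν0 : 0 < ν := by linarith
  have hc := neg_pos.2 (Gamma_one_sub_neg hν hν')
  have h0 : kappaFun lam ν a 0 = -1 := by
    simp [kappaFun, Real.zero_rpow hν0.ne', paretoLaplace_zero hν0]
  obtain ⟨K, hK0, hK⟩ : ∃ K, 0 < K ∧ 1 ≤ -Real.Gamma (1 - ν) * (lam * K) ^ ν := by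
    -- Chosen so that the power term equals 1, which is at least the Laplace transform; `kappaFun`
    -- is then nonnegative there, while it is -1 at 0.
    refine ⟨(1 / -Real.Gamma (1 - ν)) ^ (1 / ν) / lam, by positivity, ?_⟩
    rw [mul_div_cancel₀ _ hlam.ne', ← Real.rpow_mul (by positivity), one_div_mul_cancel hν0.ne',
      Real.rpow_one, mul_one_div_cancel hc.ne']
  have hK1 : 0 ≤ kappaFun lam ν a K := by
    have h1 := paretoLaplace_anti hν0 (self_mem_Ici (a := (0 : ℝ))) (mul_nonneg hlam.le hK0.le)
      (mul_nonneg hlam.le hK0.le)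
    rw [paretoLaplace_zero hν0] at h1
    have h2 : 0 ≤ K * a := by positivity
    unfold kappaFun
    linarith
  have hcont : ContinuousOn (kappaFun lam ν a) (Icc 0 K) := by
    have h1 : ContinuousOn (fun k => paretoLaplace ν (lam * k)) (Icc 0 K) :=
      (continuousOn_paretoLaplace hν0).comp (Continuous.continuousOn (by fun_prop))
        fun k hk => mul_nonneg hlam.le hk.1
    have h2 : Continuous fun k => k * a + -Real.Gamma (1 - ν) * (lam * k) ^ ν := by
      have : Continuous fun k => (lam * k) ^ ν :=
        (Real.continuous_rpow_const hν0.le).comp (by fun_prop)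
      fun_prop
    exact h2.continuousOn.sub h1
  obtain ⟨k, hk, hk0⟩ := intermediate_value_Icc hK0.le hcont
    (show (0 : ℝ) ∈ Icc _ _ from ⟨by rw [h0]; norm_num, hK1⟩)
  refine ⟨k, hk.1.lt_of_ne fun h => ?_, hk0⟩
  rw [← h, h0] at hk0
  norm_num at hk0

lemma pos_and_kappaEq_iff (hlam : 0 < lam) (hν : 1 < ν) (hν' : ν < 2) (hγ : 0 ≤ γ) (hy : 0 < y) :
    (0 < k ∧ KappaEq lam ν γ y k) ↔ k = kappa lam ν γ y := by
  have ha : 0 ≤ γ * y ^ (ν - 1) := by positivity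
  obtain ⟨k₀, h0, h1⟩ := exists_kappaFun_eq_zero hlam hν hν' ha
  have hset : ∀ k, (0 < k ∧ KappaEq lam ν γ y k) ↔ k = k₀ := by
    intro k
    rw [kappaEq_iff hν hν']
    constructor
    · rintro ⟨h2, h3⟩
      exact (kappaFun_strictMonoOn hlam hν hν' ha).injOn h2.le h0.le (h3.trans h1.symm)
    · rintro rfl
      exact ⟨h0, h1⟩
  have hk : kappa lam ν γ y = k₀ := by
    rw [kappa, show {k : ℝ | 0 < k ∧ KappaEq lam ν γ y k} = {k₀} from Set.ext hset, csInf_singleton]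
  rw [hset, hk]

lemma kappa_pos (hlam : 0 < lam) (hν : 1 < ν) (hν' : ν < 2) (hγ : 0 ≤ γ) (hy : 0 < y) :
    0 < kappa lam ν γ y := ((pos_and_kappaEq_iff hlam hν hν' hγ hy).2 rfl).1

lemma kappaFun_kappa (hlam : 0 < lam) (hν : 1 < ν) (hν' : ν < 2) (hγ : 0 ≤ γ) (hy : 0 < y) :
    kappaFun lam ν (γ * y ^ (ν - 1)) (kappa lam ν γ y) = 0 :=
  (kappaEq_iff hν hν').1 ((pos_and_kappaEq_iff hlam hν hν' hγ hy).2 rfl).2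

/-- A larger `y` raises the linear coefficient of an increasing function of `k`, so the zero moves
left. -/
lemma kappa_antitoneOn (hlam : 0 < lam) (hν : 1 < ν) (hν' : ν < 2) (hγ : 0 ≤ γ) :
    AntitoneOn (kappa lam ν γ) (Ioi 0) := by
  intro x (hx : 0 < x) y (hy : 0 < y) hxy
  have hkx := kappa_pos hlam hν hν' hγ hx
  have hky := kappa_pos hlam hν hν' hγ hy
  have ha : 0 ≤ γ * x ^ (ν - 1) := by positivity
  refine (kappaFun_strictMonoOn hlam hν hν' ha).le_iff_le hky.le hkx.le |>.1 ?_
  rw [kappaFun_kappa hlam hν hν' hγ hx, ← kappaFun_kappa hlam hν hν' hγ hy]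
  have h1 : x ^ (ν - 1) ≤ y ^ (ν - 1) := Real.rpow_le_rpow hx.le hxy (by linarith)
  unfold kappaFun
  gcongr

lemma kappa_div_antitoneOn (hlam : 0 < lam) (hν : 1 < ν) (hν' : ν < 2) (hγ : 0 ≤ γ) :
    AntitoneOn (fun y => kappa lam ν γ y / y) (Ioi 0) := fun x (hx : 0 < x) y (hy : 0 < y) hxy =>
  div_le_div₀ (kappa_pos hlam hν hν' hγ hx).le (kappa_antitoneOn hlam hν hν' hγ hx hy hxy) hx hxy

lemma kappa_zero_eq : kappa lam ν 0 y = kappa lam ν 0 1 := by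
  simp [kappa, KappaEq]

/-- Drop the Gamma term, which is nonnegative, and bound the Laplace transform by 1. The exponent -ν
< -1 makes the bound integrable at infinity. -/
lemma kappa_le (hlam : 0 < lam) (hν : 1 < ν) (hν' : ν < 2) (hγ : 0 < γ) (hy : 0 < y) :
    kappa lam ν γ y / y ≤ 1 / γ * y ^ (-ν) := by
  have hk := kappa_pos hlam hν hν' hγ.le hy
  have h1 := kappaFun_kappa hlam hν hν' hγ.le hy
  have h2 := paretoLaplace_anti (by linarith : 0 < ν) (self_mem_Ici (a := (0 : ℝ)))
    (mul_nonneg hlam.le hk.le) (mul_nonneg hlam.le hk.le)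
  rw [paretoLaplace_zero (by linarith)] at h2
  have h3 : 0 ≤ -Real.Gamma (1 - ν) * (lam * kappa lam ν γ y) ^ ν :=
    mul_nonneg (neg_pos.2 (Gamma_one_sub_neg hν hν')).le (by positivity)
  unfold kappaFun at h1
  have h4 : kappa lam ν γ y * (γ * y ^ (ν - 1)) ≤ 1 := by linarith
  have h5 : y ^ (-ν) = (y ^ (ν - 1))⁻¹ * y⁻¹ := by
    rw [← Real.rpow_neg hy.le, ← Real.rpow_neg_one, ← Real.rpow_add hy]; congr 1; ring
  rw [h5, div_eq_mul_inv, ← mul_assoc]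
  refine mul_le_mul_of_nonneg_right ?_ (by positivity)
  rw [one_div, ← mul_inv, ← one_div, le_div_iff₀ (by positivity)]
  exact h4

lemma integrableOn_kappa_div (hlam : 0 < lam) (hν : 1 < ν) (hν' : ν < 2) (hγ : 0 < γ) {x : ℝ}
    (hx : 0 < x) : IntegrableOn (fun y => kappa lam ν γ y / y) (Ioi x) := by
  have h1 : IntegrableOn (fun s : ℝ => 1 / γ * s ^ (-ν)) (Ioi x) :=
    (integrableOn_Ioi_rpow_of_lt (by linarith) hx).const_mul _
  refine h1.mono' (aemeasurable_restrict_of_antitoneOn measurableSet_Ioi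
    ((kappa_div_antitoneOn hlam hν hν' hγ.le).mono
      (Ioi_subset_Ioi hx.le))).aestronglyMeasurable ?_
  refine (ae_restrict_iff' measurableSet_Ioi).2 (Filter.Eventually.of_forall fun u hu => ?_)
  have hu0 : 0 < u := hx.trans hu
  rw [Real.norm_eq_abs, abs_of_nonneg (div_pos (kappa_pos hlam hν hν' hγ.le hu0) hu0).le]
  exact kappa_le hlam hν hν' hγ hu0

end kappa

/-! ### The tail of the largest service time, scaled -/

section equation

variable {μ : Measure ℝ} [IsProbabilityMeasure μ]

lemma antitone_measureReal_Ioi : Antitone fun u => μ.real (Ioi u) := fun _ _ hxy =>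
  measureReal_mono (Ioi_subset_Ioi hxy)

/-- Layer-cake formula for 1 - exp(-θ min(w, z)). Replacing `w` by the minimum adds the mass beyond
`z`, which is the boundary term. -/
lemma integral_exp_Iic (h0 : ∀ᵐ x ∂μ, 0 ≤ x) {θ z : ℝ} (hθ : 0 ≤ θ) (hz : 0 ≤ z) :
    ∫ w in Iic z, Real.exp (-(θ * w)) ∂μ = 1 - μ.real (Ioi z) * Real.exp (-(θ * z)) -
      θ * ∫ u in Ioc 0 z, Real.exp (-(θ * u)) * μ.real (Ioi u) := by
  have hg : ∀ b : ℝ, ∫ t in (0 : ℝ)..b, θ * Real.exp (-(θ * t)) = 1 - Real.exp (-(θ * b)) := by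
    intro b
    have hd : ∀ t ∈ uIcc 0 b, HasDerivAt (fun t => -Real.exp (-(θ * t)))
        (θ * Real.exp (-(θ * t))) t := fun t _ => by
      have h1 : HasDerivAt (fun u => Real.exp (-(θ * u))) (Real.exp (-(θ * t)) * (-(θ * 1))) t :=
        (((hasDerivAt_id t).const_mul θ).neg).exp
      exact h1.neg.congr_deriv (by ring)
    rw [intervalIntegral.integral_eq_sub_of_hasDerivAt hd
      (Continuous.intervalIntegrable (by fun_prop) _ _)]
    simp
    ring
  have hnn : ∀ᵐ w ∂μ, 0 ≤ min w z := h0.mono fun w hw => le_min hw hz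
  have h1 := lintegral_comp_eq_lintegral_meas_lt_mul μ hnn
    (Measurable.aemeasurable (by fun_prop)) (g := fun t => θ * Real.exp (-(θ * t)))
    (fun t _ => Continuous.intervalIntegrable (by fun_prop) _ _)
    (Filter.Eventually.of_forall fun t => by positivity)
  simp only [hg] at h1
  have hYm : Measurable fun w => 1 - Real.exp (-(θ * min w z)) := by fun_prop
  have hY0 : 0 ≤ᵐ[μ] fun w => 1 - Real.exp (-(θ * min w z)) := by
    filter_upwards [hnn] with w hw
    exact sub_nonneg.2 (Real.exp_le_one_iff.2 (neg_nonpos.2 (mul_nonneg hθ hw)))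
  have e1 : ∫ w, (1 - Real.exp (-(θ * min w z))) ∂μ =
      θ * ∫ u in Ioc 0 z, Real.exp (-(θ * u)) * μ.real (Ioi u) := by
    rw [integral_eq_lintegral_of_nonneg_ae hY0 hYm.aestronglyMeasurable, h1,
      ← integral_const_mul]
    have hset : ∀ t, {a : ℝ | t < min a z} = if t < z then Ioi t else ∅ := fun t => by
      ext a
      by_cases h : t < z <;> simp [h]
    have h2 : ∀ t, μ {a : ℝ | t < min a z} * ENNReal.ofReal (θ * Real.exp (-(θ * t))) =
        (Iio z).indicator (fun u => ENNReal.ofReal (θ * (Real.exp (-(θ * u)) * μ.real (Ioi u)))) t := by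
      intro t
      rw [hset]
      by_cases h : t < z
      · have h' : t ∈ Iio z := h
        rw [if_pos h, indicator_of_mem h', ← ofReal_measureReal, ← ENNReal.ofReal_mul
          measureReal_nonneg]
        congr 1; ring
      · have h' : t ∉ Iio z := h
        rw [if_neg h, indicator_of_notMem h']
        simp
    simp only [h2]
    rw [lintegral_indicator measurableSet_Iio, Measure.restrict_restrict measurableSet_Iio,
      integral_eq_lintegral_of_nonneg_ae, inter_comm, Ioi_inter_Iio,
      restrict_Ioo_eq_restrict_Ioc]
    · exact Filter.Eventually.of_forall fun u => by positivity
    · exact (Measurable.mul measurable_const (Measurable.mul (by fun_prop)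
        (antitone_measureReal_Ioi.measurable))).aestronglyMeasurable
  have hint : Integrable (fun w => Real.exp (-(θ * min w z))) μ := by
    refine (integrable_const 1).mono' (Measurable.aestronglyMeasurable (by fun_prop)) ?_
    filter_upwards [hnn] with w hw
    rw [Real.norm_eq_abs, abs_of_pos (Real.exp_pos _)]
    exact Real.exp_le_one_iff.2 (neg_nonpos.2 (mul_nonneg hθ hw))
  rw [integral_sub (integrable_const 1) hint, integral_const, probReal_univ, one_smul,
    ← integral_add_compl (measurableSet_Iic (a := z)) hint] at e1
  have e2 : ∫ w in Iic z, Real.exp (-(θ * min w z)) ∂μ = ∫ w in Iic z, Real.exp (-(θ * w)) ∂μ :=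
    setIntegral_congr_fun measurableSet_Iic fun w hw => by simp only [min_eq_left (mem_Iic.1 hw)]
  have e3 : ∫ w in (Iic z)ᶜ, Real.exp (-(θ * min w z)) ∂μ =
      μ.real (Ioi z) * Real.exp (-(θ * z)) := by
    rw [compl_Iic]
    have : ∫ w in Ioi z, Real.exp (-(θ * min w z)) ∂μ = ∫ _w in Ioi z, Real.exp (-(θ * z)) ∂μ :=
      setIntegral_congr_fun measurableSet_Ioi fun w hw => by
        simp only [min_eq_right (le_of_lt (mem_Ioi.1 hw))]
    rw [this, setIntegral_const, smul_eq_mul]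
  rw [e2, e3] at e1
  linarith

omit [IsProbabilityMeasure μ] in
lemma integrableOn_tail (h0 : ∀ᵐ x ∂μ, 0 ≤ x) (hint : Integrable (fun x => x) μ)
    (hpos : 0 < ∫ x, x ∂μ) : IntegrableOn (fun u => μ.real (Ioi u)) (Ioi 0) ∧
      ∫ u in Ioi 0, μ.real (Ioi u) = ∫ x, x ∂μ := by
  have h1 : ∫ x, x ∂μ = ∫ u in Ioi 0, μ.real (Ioi u) := hint.integral_eq_integral_meas_lt h0
  refine ⟨?_, h1.symm⟩
  by_contra hcon
  rw [h1, integral_undef hcon] at hpos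
  exact hpos.false

/-- After integration by parts, add and subtract r q times the mean, written as the integral of the
tail. This separates the slack 1 - ρ from the weighted tail integral; dividing by the tail at `z`
and substituting u = z s gives `balance`. -/
lemma balance_equation (h0 : ∀ᵐ x ∂μ, 0 ≤ x) (hint : Integrable (fun x => x) μ)
    (hpos : 0 < ∫ x, x ∂μ) {r q z : ℝ} (hr : 0 ≤ r) (hq : 0 ≤ q) (hz : 0 < z)
    (hfz : 0 < μ.real (Ioi z)) (h : 1 - q = ∫ w in Iic z, Real.exp (-(r * q * w)) ∂μ) :
    balance ((1 - r * ∫ x, x ∂μ) / (z * μ.real (Ioi z))) r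
      (fun s => μ.real (Ioi (z * s)) / μ.real (Ioi z)) (z * q) = 0 := by
  obtain ⟨hf, hm⟩ := integrableOn_tail h0 hint hpos
  have hθ : 0 ≤ r * q := mul_nonneg hr hq
  rw [integral_exp_Iic h0 hθ hz.le] at h
  have hfz' : Real.exp (-(r * (z * q))) * μ.real (Ioi z) =
      q - r * q * ∫ u in Ioc 0 z, Real.exp (-(r * q * u)) * μ.real (Ioi u) := by
    rw [show r * (z * q) = r * q * z by ring]
    linarith
  have hif : IntegrableOn (fun u => Real.exp (-(r * q * u)) * μ.real (Ioi u)) (Ioi 0) := by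
    refine hf.mono' (Measurable.aestronglyMeasurable (Measurable.mul (by fun_prop)
        antitone_measureReal_Ioi.measurable)) ?_
    refine (ae_restrict_iff' measurableSet_Ioi).2 (Filter.Eventually.of_forall fun u hu => ?_)
    rw [Real.norm_eq_abs, abs_of_nonneg (by positivity)]
    exact mul_le_of_le_one_left measureReal_nonneg
      (Real.exp_le_one_iff.2 (neg_nonpos.2 (mul_nonneg hθ (le_of_lt hu))))
  have hW : ∫ s in Ioi 0, weight (r * (z * q)) s * (μ.real (Ioi (z * s)) / μ.real (Ioi z)) =
      z⁻¹ * ((∫ x, x ∂μ) - ∫ u in Ioc 0 z, Real.exp (-(r * q * u)) * μ.real (Ioi u)) /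
        μ.real (Ioi z) := by
    obtain ⟨g, hg⟩ : ∃ g : ℝ → ℝ, ∀ u, g u = (μ.real (Ioi u) - (Iic z).indicator
        (fun u => Real.exp (-(r * q * u)) * μ.real (Ioi u)) u) / μ.real (Ioi z) :=
      ⟨_, fun _ => rfl⟩
    have e1 : ∀ s, weight (r * (z * q)) s * (μ.real (Ioi (z * s)) / μ.real (Ioi z)) =
        g (z * s) := by
      intro s
      rw [hg]
      by_cases hs : s ≤ 1
      · have hs' : z * s ∈ Iic z := mul_le_of_le_one_right hz.le hs
        simp only [weight, if_pos hs, indicator_of_mem hs']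
        rw [show r * (z * q) * s = r * q * (z * s) by ring]
        ring
      · have hs' : z * s ∉ Iic z := not_le.2 (lt_mul_of_one_lt_right hz (not_le.1 hs))
        simp only [weight, if_neg hs, indicator_of_notMem hs']
        ring
    rw [setIntegral_congr_fun measurableSet_Ioi fun s _ => e1 s, integral_comp_mul_left_Ioi g 0 hz]
    simp only [hg]
    rw [mul_zero, integral_div, integral_sub hf
      (hif.indicator measurableSet_Iic), hm, setIntegral_indicator measurableSet_Iic,
      Ioi_inter_Iic, smul_eq_mul, mul_div_assoc]
  rw [balance, hW, sub_eq_zero, eq_comm]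
  have e2 : Real.exp (-(r * (z * q))) =
      (q - r * q * ∫ u in Ioc 0 z, Real.exp (-(r * q * u)) * μ.real (Ioi u)) /
        μ.real (Ioi z) := by
    rw [← hfz', mul_div_cancel_right₀ _ hfz.ne']
  rw [e2]
  field_simp
  ring

end equation

/-! ### Passage to the limit in the balance equation. -/

section convergence

variable {f : ℝ → ℝ} {ν p q C z₀ : ℝ}

lemma PotterBound.weight_le (h : PotterBound f p q C z₀) (h0 : ∀ x, 0 ≤ f x) {z θ s : ℝ}
    (hz : z₀ ≤ z) (hθ : 0 ≤ θ) (hs : 0 < s) :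
    ‖weight θ s * (f (z * s) / f z)‖ ≤ (1 + θ) * C * envelope p q s := by
  have hφ : 0 ≤ f (z * s) / f z := div_nonneg (h0 _) (h0 _)
  rw [Real.norm_eq_abs, abs_of_nonneg (mul_nonneg (weight_nonneg hθ hs.le) hφ)]
  exact weight_mul_le (φ := fun s => f (z * s) / f z) hθ hs hφ (fun h1 => h.upper z s hz h1) fun h1 => h.lower z s hz hs h1

lemma measurable_weight_mul (hf : Antitone f) (z θ : ℝ) :
    Measurable fun s => weight θ s * (f (z * s) / f z) :=
  (measurable_weight θ).mul ((hf.measurable.comp (measurable_const_mul z)).div_const _)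

lemma PotterBound.integrableOn_weight (h : PotterBound f p q C z₀) (hf : Antitone f)
    (h0 : ∀ x, 0 ≤ f x) (hp : 1 < p) (hq : q < 2) {z θ : ℝ} (hz : z₀ ≤ z) (hθ : 0 ≤ θ) :
    IntegrableOn (fun s => weight θ s * (f (z * s) / f z)) (Ioi 0) :=
  ((integrableOn_envelope hp hq).const_mul ((1 + θ) * C)).mono'
    (measurable_weight_mul hf z θ).aestronglyMeasurable
    ((ae_restrict_iff' measurableSet_Ioi).2 (Filter.Eventually.of_forall fun _ hs =>
      h.weight_le h0 hz hθ hs))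

lemma continuous_weight (s : ℝ) : Continuous fun θ => weight θ s := by
  unfold weight
  split_ifs <;> fun_prop

/-- Regular variation gives pointwise convergence of the tail ratios, and the envelope from Potter's
bounds dominates: the weight is of order s near 0, which compensates s^(-q) because q < 2. -/
lemma tendsto_balance (h : PotterBound f p q C z₀) (hreg : RegularlyVarying f (-ν))
    (hf : Antitone f) (h0 : ∀ x, 0 ≤ f x) (hp : 1 < p) (hq : q < 2) {r a z : ℕ → ℝ} {lam b k : ℝ}
    (hr0 : ∀ n, 0 ≤ r n) (hr : Tendsto r atTop (𝓝 lam)) (ha : Tendsto a atTop (𝓝 b))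
    (hz : Tendsto z atTop atTop) (hk : 0 ≤ k) :
    Tendsto (fun n => balance (a n) (r n) (fun s => f (z n * s) / f (z n)) k) atTop
      (𝓝 (balance b lam (fun s => s ^ (-ν)) k)) := by
  have h1 : Tendsto (fun n => ∫ s in Ioi 0, weight (r n * k) s * (f (z n * s) / f (z n))) atTop
      (𝓝 (∫ s in Ioi 0, weight (lam * k) s * s ^ (-ν))) := by
    refine tendsto_integral_filter_of_dominated_convergence
      (fun s => (1 + (lam + 1) * k) * C * envelope p q s)
      (Filter.Eventually.of_forall fun n => (measurable_weight_mul hf _ _).aestronglyMeasurable)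
      ?_ ((integrableOn_envelope hp hq).const_mul _) ?_
    · filter_upwards [hz.eventually_ge_atTop z₀, hr.eventually (gt_mem_nhds (lt_add_one lam))]
        with n hn hn1
      refine (ae_restrict_iff' measurableSet_Ioi).2 (Filter.Eventually.of_forall fun s hs => ?_)
      refine (h.weight_le h0 hn (mul_nonneg (hr0 n) hk) hs).trans ?_
      have h2 : 0 ≤ envelope p q s := by
        have : (0 : ℝ) < s := hs
        unfold envelope
        split_ifs <;> positivity
      have := h.nonneg
      gcongr
    · refine (ae_restrict_iff' measurableSet_Ioi).2 (Filter.Eventually.of_forall fun s hs => ?_)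
      refine (((continuous_weight s).tendsto _).comp (hr.mul_const k)).mul ?_
      simpa only [Function.comp_def, mul_comm s] using (hreg s hs).comp hz
  unfold balance
  exact ((ha.const_mul k).add ((hr.mul_const k).mul h1)).sub
    ((Real.continuous_exp.tendsto _).comp (hr.mul_const k).neg)

/-- Pointwise convergence is enough: the sign of the limit at one positive point on each side of κ
passes to `D n`, and monotonicity traps the root. -/
lemma tendsto_root {D : ℕ → ℝ → ℝ} {H : ℝ → ℝ} {k : ℕ → ℝ} {κ : ℝ}
    (hD : ∀ᶠ n in atTop, MonotoneOn (D n) (Ici 0)) (hlim : ∀ x, 0 < x →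
      Tendsto (fun n => D n x) atTop (𝓝 (H x))) (hH : StrictMonoOn H (Ici 0)) (hκ : 0 < κ)
    (hHκ : H κ = 0) (hk : ∀ᶠ n in atTop, 0 ≤ k n ∧ D n (k n) = 0) :
    Tendsto k atTop (𝓝 κ) := by
  refine tendsto_order.2 ⟨fun a ha => ?_, fun a ha => ?_⟩
  · obtain ⟨x, hx1, hx2⟩ := exists_between (max_lt ha hκ)
    have hx0 : 0 < x := (le_max_right _ _).trans_lt hx1
    have h1 : H x < 0 := hHκ ▸ hH hx0.le hκ.le hx2
    filter_upwards [hD, hk, (hlim x hx0).eventually (gt_mem_nhds h1)] with n hn1 hn2 hn3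
    refine (le_max_left a 0).trans_lt (hx1.trans (not_le.1 fun hcon => ?_))
    linarith [hn1 hn2.1 hx0.le hcon]
  · obtain ⟨x, hx1, hx2⟩ := exists_between ha
    have hx0 : 0 < x := hκ.trans hx1
    have h1 : 0 < H x := hHκ ▸ hH hκ.le hx0.le hx1
    filter_upwards [hD, hk, (hlim x hx0).eventually (lt_mem_nhds h1)] with n hn1 hn2 hn3
    refine (not_le.1 fun hcon => ?_ : k n < x).trans hx2
    linarith [hn1 hx0.le hn2.1 hcon]

end convergence

/-! ### Heavy traffic limit of the tail of the largest service time -/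

section tail

variable {Ω : Type*} [MeasurableSpace Ω] {P : Measure Ω} [IsProbabilityMeasure P]

omit [IsProbabilityMeasure P] in
lemma tail_nonneg (X : Ω → ℝ) (x : ℝ) : 0 ≤ tail P X x := measureReal_nonneg

lemma tail_le_one (X : Ω → ℝ) (x : ℝ) : tail P X x ≤ 1 := measureReal_le_one

lemma antitone_tail (X : Ω → ℝ) : Antitone (tail P X) := fun _ _ hxy =>
  measureReal_mono fun _ hω => lt_of_le_of_lt hxy hω

variable {A V : ℕ → Ω → ℝ} {r : ℝ}

namespace IsTandem

variable (h : IsTandem P A V r)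

include h

omit [IsProbabilityMeasure P] in
lemma tail_eq : tail P (V 0) = fun x => (P.map (V 0)).real (Ioi x) :=
  funext fun _ => (map_measureReal_apply_of_aemeasurable (h.ident 0).aemeasurable_fst
    measurableSet_Ioi).symm

lemma isRecursion : IsRecursion r (fun x => 1 - maxCDF P A V x)
    (fun k x => P.real {ω | R A V k ω ≤ x}) where
  rate_pos := h.rate_pos
  anti := fun _ _ hxy => sub_le_sub_left (monotone_maxCDF hxy) 1
  nonneg := fun x => (h.one_sub_maxCDF_mem x).1.1
  le_one := fun x => (h.one_sub_maxCDF_mem x).1.2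
  mono := fun _ _ _ hxy => measureReal_mono fun _ hω => le_trans hω hxy
  G_nonneg := fun _ _ => measureReal_nonneg
  G_le_one := fun _ _ => measureReal_le_one
  zero := fun x hx => by
    rw [show {ω : Ω | R A V 0 ω ≤ x} = univ from eq_univ_of_forall fun ω => hx, probReal_univ]
  succ := fun k x hx => by rw [h.measureReal_R_recursion k hx, sub_sub_cancel]

lemma balance_eq_zero (hf : ∀ x, 0 < tail P (V 0) x) {z : ℝ} (hz : 0 < z) :
    balance ((1 - r * ∫ ω, V 0 ω ∂P) / (z * tail P (V 0) z)) r
      (fun s => tail P (V 0) (z * s) / tail P (V 0) z) (z * (1 - maxCDF P A V z)) = 0 := by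
  have := h.isProbabilityMeasure_map
  obtain ⟨h1, h2⟩ := h.one_sub_maxCDF_mem z
  rw [h.tail_eq] at hf ⊢
  rw [← h.integral_map_id]
  refine balance_equation h.ae_map_nonneg h.integrable_map_id ?_ h.rate_pos.le h1.1 hz (hf z) ?_
  · rw [h.integral_map_id]; exact h.mean_pos
  · rw [sub_sub_cancel]; exact h2

/-- In the balance equation discard the nonnegative integral and bound the exponential by 1; only
the linear term remains. -/
lemma one_sub_maxCDF_le (hf : ∀ x, 0 < tail P (V 0) x) (hload : r * ∫ ω, V 0 ω ∂P < 1) {z : ℝ}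
    (hz : 0 < z) : 1 - maxCDF P A V z ≤ tail P (V 0) z / (1 - r * ∫ ω, V 0 ω ∂P) := by
  have h1 := h.balance_eq_zero hf hz
  have hq := (h.one_sub_maxCDF_mem z).1.1
  have hk : 0 ≤ r * (z * (1 - maxCDF P A V z)) := by have := h.rate_pos; positivity
  have h2 : 0 ≤ ∫ s in Ioi 0, weight (r * (z * (1 - maxCDF P A V z))) s *
      (tail P (V 0) (z * s) / tail P (V 0) z) := setIntegral_nonneg measurableSet_Ioi
    fun s hs => mul_nonneg (weight_nonneg hk (le_of_lt hs)) (div_nonneg (hf _).le (hf _).le)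
  have h3 : Real.exp (-(r * (z * (1 - maxCDF P A V z)))) ≤ 1 :=
    Real.exp_le_one_iff.2 (neg_nonpos.2 hk)
  have h4 := mul_nonneg hk h2
  unfold balance at h1
  have h5 : z * (1 - maxCDF P A V z) * ((1 - r * ∫ ω, V 0 ω ∂P) / (z * tail P (V 0) z)) ≤ 1 := by
    linarith
  have e : z * (1 - maxCDF P A V z) * ((1 - r * ∫ ω, V 0 ω ∂P) / (z * tail P (V 0) z)) =
      (1 - maxCDF P A V z) * (1 - r * ∫ ω, V 0 ω ∂P) / tail P (V 0) z := by
    have := hf z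
    field_simp
  rw [e, div_le_one (hf z)] at h5
  rwa [le_div_iff₀ (sub_pos.2 hload)]

lemma integrableTail (hf : ∀ x, 0 < tail P (V 0) x) (hload : r * ∫ ω, V 0 ω ∂P < 1) :
    IntegrableTail fun x => 1 - maxCDF P A V x where
  anti := h.isRecursion.anti
  nonneg := h.isRecursion.nonneg
  le_one := h.isRecursion.le_one
  integrable := fun x => by
    have hanti : Antitone fun x => 1 - maxCDF P A V x := h.isRecursion.anti
    have h1 : IntegrableOn (fun x => 1 - maxCDF P A V x) (Ioi 0) := by
      have h2 : IntegrableOn (tail P (V 0)) (Ioi 0) := by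
        rw [h.tail_eq]
        exact (integrableOn_tail h.ae_map_nonneg h.integrable_map_id
          (h.integral_map_id ▸ h.mean_pos)).1
      refine (h2.div_const (1 - r * ∫ ω, V 0 ω ∂P)).mono' hanti.measurable.aestronglyMeasurable ?_
      refine (ae_restrict_iff' measurableSet_Ioi).2 (Filter.Eventually.of_forall fun z hz => ?_)
      rw [Real.norm_eq_abs, abs_of_nonneg (h.isRecursion.nonneg z)]
      exact h.one_sub_maxCDF_le hf hload hz
    refine IntegrableOn.mono_set ?_ (Ioi_subset_Ioi (min_le_left x 0))
    rw [← Ioc_union_Ioi_eq_Ioi (min_le_right x 0), integrableOn_union]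
    exact ⟨(intervalIntegrable_iff_integrableOn_Ioc_of_le (min_le_right x 0)).1
      hanti.intervalIntegrable, h1⟩

end IsTandem

end tail

section heavyTraffic

variable {Ω : Type*} [MeasurableSpace Ω] {P : Measure Ω} [IsProbabilityMeasure P]
  {A : ℕ → ℕ → Ω → ℝ} {V : ℕ → Ω → ℝ} {ν γ lam : ℝ} {r : ℕ → ℝ}

/-- A sequence of tandem queues in heavy traffic, with regularly varying service times. -/
structure HeavyTraffic (P : Measure Ω) (A : ℕ → ℕ → Ω → ℝ) (V : ℕ → Ω → ℝ) (ν γ lam : ℝ)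
    (r : ℕ → ℝ) : Prop where
  one_lt : 1 < ν
  lt_two : ν < 2
  nonneg : 0 ≤ γ
  lam_pos : 0 < lam
  tail_reg : RegularlyVarying (tail P (V 0)) (-ν)
  tandem : ∀ n, IsTandem P (A n) V (r n)
  rate : Tendsto r atTop (𝓝 lam)
  load : Tendsto (fun n : ℕ => (1 - r n * ∫ ω, V 0 ω ∂P) / (n * tail P (V 0) n)) atTop (𝓝 γ)

namespace HeavyTraffic

variable (h : HeavyTraffic P A V ν γ lam r)

include h

lemma tail_pos (x : ℝ) : 0 < tail P (V 0) x :=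
  h.tail_reg.pos_of_antitone (antitone_tail _) (tail_nonneg _) x

lemma exists_potterBound : ∃ p q C z, 1 < p ∧ q < 2 ∧ 1 < q ∧
    PotterBound (tail P (V 0)) p q C z := by
  have h1 := h.one_lt
  have h2 := h.lt_two
  -- Midpoints, so that 1 < p < ν < q < 2, as integrability at infinity and at 0 requires.
  obtain ⟨C, z, hC⟩ := h.tail_reg.exists_potterBound (antitone_tail _) (tail_nonneg _)
    (tail_le_one _) (p := (1 + ν) / 2) (q := (ν + 2) / 2) (by linarith) (by linarith) (by linarith)
  exact ⟨_, _, C, z, by linarith, by linarith, by linarith, hC⟩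

lemma tendsto_load {y : ℝ} (hy : 0 < y) :
    Tendsto (fun n : ℕ => (1 - r n * ∫ ω, V 0 ω ∂P) / (n * y * tail P (V 0) (n * y))) atTop
      (𝓝 (γ * y ^ (ν - 1))) := by
  have h1 : Tendsto (fun n : ℕ => tail P (V 0) (n * y) / tail P (V 0) n) atTop (𝓝 (y ^ (-ν))) := by
    simpa only [Function.comp_def, mul_comm y] using
      (h.tail_reg y hy).comp tendsto_natCast_atTop_atTop
  have h2 := (h.load.div_const y).div h1 (by positivity)
  have e : γ / y / y ^ (-ν) = γ * y ^ (ν - 1) := by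
    rw [Real.rpow_neg hy.le, Real.rpow_sub_one hy.ne']
    field_simp
  rw [e] at h2
  refine h2.congr fun n => ?_
  have := h.tail_pos n
  have := h.tail_pos (n * y)
  rcases n.eq_zero_or_pos with rfl | hn
  · simp
  · have : (0 : ℝ) < n := Nat.cast_pos.2 hn
    simp only [Pi.div_apply]
    field_simp

/-- With z = n y, the number z (1 - m(z)) is a zero of the n-th balance function, and these
functions converge to `kappaFun`, whose zero is κ(y). -/
lemma tendsto_mul_one_sub_maxCDF {y : ℝ} (hy : 0 < y) :
    Tendsto (fun n : ℕ => n * (1 - maxCDF P (A n) V (n * y))) atTop (𝓝 (kappa lam ν γ y / y)) := by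
  obtain ⟨p, q, C, z₀, hp, hq, -, hP⟩ := h.exists_potterBound
  have hz : Tendsto (fun n : ℕ => (n : ℝ) * y) atTop atTop :=
    tendsto_natCast_atTop_atTop.atTop_mul_const hy
  have ha : 0 ≤ γ * y ^ (ν - 1) := mul_nonneg h.nonneg (by positivity)
  have h1 : Tendsto (fun n : ℕ => n * y * (1 - maxCDF P (A n) V (n * y))) atTop
      (𝓝 (kappa lam ν γ y)) := by
    refine tendsto_root (D := fun n => balance
      ((1 - r n * ∫ ω, V 0 ω ∂P) / (n * y * tail P (V 0) (n * y))) (r n)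
      (fun s => tail P (V 0) (n * y * s) / tail P (V 0) (n * y)))
      (H := kappaFun lam ν (γ * y ^ (ν - 1))) ?_ (fun k hk => ?_)
      (kappaFun_strictMonoOn h.lam_pos h.one_lt h.lt_two ha)
      (kappa_pos h.lam_pos h.one_lt h.lt_two h.nonneg hy)
      (kappaFun_kappa h.lam_pos h.one_lt h.lt_two h.nonneg hy) ?_
    · filter_upwards [hz.eventually_ge_atTop z₀] with n hn k hk k' _ hkk
      have hr := (h.tandem n).rate_pos.le
      refine balance_mono (div_nonneg (sub_nonneg.2 (h.tandem n).load_le_one)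
        (mul_nonneg (by positivity) (h.tail_pos _).le)) hr (fun s => div_nonneg (h.tail_pos _).le
        (h.tail_pos _).le) (fun k hk => ?_) hk hkk
      exact hP.integrableOn_weight (antitone_tail _) (tail_nonneg _) hp hq hn (mul_nonneg hr hk)
    · rw [← balance_rpow_eq_kappaFun h.lam_pos h.one_lt h.lt_two hk]
      exact tendsto_balance hP h.tail_reg (antitone_tail _) (tail_nonneg _) hp hq
        (fun n => (h.tandem n).rate_pos.le) h.rate (h.tendsto_load hy) hz hk.le
    · filter_upwards [eventually_gt_atTop 0] with n hn
      have hz : 0 < (n : ℝ) * y := mul_pos (Nat.cast_pos.2 hn) hy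
      exact ⟨mul_nonneg hz.le ((h.tandem n).one_sub_maxCDF_mem _).1.1,
        (h.tandem n).balance_eq_zero h.tail_pos hz⟩
  refine (h1.div_const y).congr fun n => ?_
  field_simp

lemma tendsto_measureReal_R {t x : ℝ} (ht : 0 ≤ t) (hx : 0 < x) :
    Tendsto (fun n : ℕ => P.real {ω | R (A n) V ⌊(n : ℝ) * t⌋₊ ω ≤ n * x}) atTop
      (𝓝 (Real.exp (-(lam * ∫ y in x..(x + t / lam), kappa lam ν γ y / y)))) :=
  tendsto_scaled (fun n => (h.tandem n).isRecursion) h.lam_pos h.rate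
    (fun _ hy => h.tendsto_mul_one_sub_maxCDF hy) ht hx

lemma eventually_load_lt_one (hγ : 0 < γ) : ∀ᶠ n in atTop, r n * ∫ ω, V 0 ω ∂P < 1 := by
  filter_upwards [h.load.eventually (lt_mem_nhds hγ)] with n hn
  by_contra hcon
  refine hn.not_ge (div_nonpos_of_nonpos_of_nonneg (by linarith) ?_)
  exact mul_nonneg n.cast_nonneg (h.tail_pos _).le

omit h in
lemma integrableOn_scaled {q : ℝ → ℝ} (hq : IntegrableTail q) {n : ℝ} (hn : 0 < n) (x : ℝ) :
    IntegrableOn (fun s => n * q (n * s)) (Ioi x) := by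
  refine Integrable.const_mul ?_ n
  exact (integrableOn_Ioi_comp_mul_left_iff q x hn).2 (hq.integrable _)

omit h in
lemma integral_scaled (q : ℝ → ℝ) {n : ℝ} (hn : 0 < n) (x : ℝ) :
    ∫ s in Ioi x, n * q (n * s) = ∫ s in Ioi (n * x), q s := by
  rw [integral_const_mul, integral_comp_mul_left_Ioi q x hn, smul_eq_mul,
    mul_inv_cancel_left₀ hn.ne']

/-- The scaled steady-state distribution. -/
lemma tendsto_steadyState {n : ℕ} (hn : 1 ≤ n) (hload : r n * ∫ ω, V 0 ω ∂P < 1) {x : ℝ}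
    (hx : 0 < x) :
    IntegrableOn (fun s : ℝ => n * (1 - maxCDF P (A n) V (n * s))) (Ioi x) ∧
    Tendsto (fun k : ℕ => P.real {ω | R (A n) V k ω / n ≤ x}) atTop
      (𝓝 (maxCDF P (A n) V (n * x) * Real.exp (-(r n *
        ∫ s in Ioi x, n * (1 - maxCDF P (A n) V (n * s)))))) := by
  have hn' : (0 : ℝ) < n := Nat.cast_pos.2 hn
  have hq := (h.tandem n).integrableTail h.tail_pos hload
  refine ⟨integrableOn_scaled hq hn' x, ?_⟩
  rw [integral_scaled (fun x => 1 - maxCDF P (A n) V x) hn']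
  have h1 := (h.tandem n).isRecursion.tendsto_fixedPoint hq (mul_nonneg hn'.le hx.le)
  rw [fixedPoint, sub_sub_cancel] at h1
  refine h1.congr fun k => ?_
  simp only [div_le_iff₀' hn']

/-- Since γ > 0, the inverse of (1 - ρ)/(n F̄(n)) is eventually below 1/γ + 1, so
`one_sub_maxCDF_le` bounds the integrand by a multiple of F̄(ns)/F̄(n). The sum of two powers covers
Potter's bound on both sides of s = 1. -/
lemma tendsto_integral_one_sub_maxCDF (hγ : 0 < γ) {x : ℝ} (hx : 0 < x) :
    Tendsto (fun n : ℕ => ∫ s in Ioi x, n * (1 - maxCDF P (A n) V (n * s))) atTop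
      (𝓝 (∫ y in Ioi x, kappa lam ν γ y / y)) := by
  obtain ⟨p, q, C, z₀, hp, hq, hq1, hP⟩ := h.exists_potterBound
  have hC := hP.nonneg
  refine tendsto_integral_filter_of_dominated_convergence
    (fun s => (1 / γ + 1) * (C * s ^ (-p) + C * s ^ (-q)))
    (Filter.Eventually.of_forall fun n => ?_) ?_ ?_ ?_
  · exact (((h.tandem n).isRecursion.anti.measurable.comp (measurable_const_mul (n : ℝ))).const_mul
      (n : ℝ)).aestronglyMeasurable
  · have hload := (h.load.inv₀ hγ.ne').eventually (gt_mem_nhds (lt_add_one γ⁻¹))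
    filter_upwards [hload, h.eventually_load_lt_one hγ, eventually_gt_atTop 0,
      tendsto_natCast_atTop_atTop.eventually_ge_atTop z₀] with n h1 h2 h3 h4
    refine (ae_restrict_iff' measurableSet_Ioi).2 (Filter.Eventually.of_forall fun s hs => ?_)
    have hs0 : 0 < s := hx.trans hs
    have hn : (0 : ℝ) < n := Nat.cast_pos.2 h3
    have hfn := h.tail_pos n
    rw [Real.norm_eq_abs, abs_of_nonneg (mul_nonneg hn.le ((h.tandem n).isRecursion.nonneg _))]
    have h5 : tail P (V 0) (n * s) / tail P (V 0) n ≤ C * s ^ (-p) + C * s ^ (-q) := by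
      rcases le_total 1 s with hs1 | hs1
      · exact (hP.upper n s h4 hs1).trans (le_add_of_nonneg_right (by positivity))
      · exact (hP.lower n s h4 hs0 hs1).trans (le_add_of_nonneg_left (by positivity))
    have h6 : 0 ≤ tail P (V 0) (n * s) / tail P (V 0) n := div_nonneg (h.tail_pos _).le hfn.le
    have h7 := (h.tandem n).one_sub_maxCDF_le h.tail_pos h2 (mul_pos hn hs0)
    have h8 : (1 - r n * ∫ ω, V 0 ω ∂P) ≠ 0 := (sub_pos.2 h2).ne'
    calc n * (1 - maxCDF P (A n) V (n * s))
        ≤ n * (tail P (V 0) (n * s) / (1 - r n * ∫ ω, V 0 ω ∂P)) := by gcongr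
      _ = ((1 - r n * ∫ ω, V 0 ω ∂P) / (n * tail P (V 0) n))⁻¹ *
          (tail P (V 0) (n * s) / tail P (V 0) n) := by field_simp
      _ ≤ (γ⁻¹ + 1) * (C * s ^ (-p) + C * s ^ (-q)) :=
          mul_le_mul h1.le h5 h6 (by positivity)
      _ = _ := by rw [one_div]
  · have i1 : IntegrableOn (fun s : ℝ => C * s ^ (-p)) (Ioi x) :=
      (integrableOn_Ioi_rpow_of_lt (by linarith) hx).const_mul _
    have i2 : IntegrableOn (fun s : ℝ => C * s ^ (-q)) (Ioi x) :=
      (integrableOn_Ioi_rpow_of_lt (by linarith) hx).const_mul _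
    exact (i1.add i2).const_mul _
  · refine (ae_restrict_iff' measurableSet_Ioi).2 (Filter.Eventually.of_forall fun s hs => ?_)
    exact h.tendsto_mul_one_sub_maxCDF (hx.trans hs)

lemma tendsto_steadyState_limit (hγ : 0 < γ) {x : ℝ} (hx : 0 < x) :
    Tendsto (fun n : ℕ => maxCDF P (A n) V (n * x) * Real.exp (-(r n *
        ∫ s in Ioi x, n * (1 - maxCDF P (A n) V (n * s))))) atTop
      (𝓝 (Real.exp (-(lam * ∫ y in Ioi x, kappa lam ν γ y / y)))) := by
  have h1 := (tendsto_zero_of_tendsto_mul (h.tendsto_mul_one_sub_maxCDF hx)).const_sub 1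
  simp only [sub_sub_cancel, sub_zero] at h1
  have h2 := h1.mul ((Real.continuous_exp.tendsto _).comp
    (h.rate.mul (h.tendsto_integral_one_sub_maxCDF hγ hx)).neg)
  rwa [one_mul] at h2

end HeavyTraffic

end heavyTraffic

/-! ### The limit law -/

/-- Intervals (a, b] with endpoints different from `c` form a π-system containing arbitrarily small
neighbourhoods of every point. One point may be excluded, so nothing has to be known about the
distribution functions at 0. -/
lemma tendsto_of_tendsto_cdf {μ : ℕ → ProbabilityMeasure ℝ} {ν : ProbabilityMeasure ℝ} (c : ℝ)
    (h : ∀ x, x ≠ c → Tendsto (fun n => cdf (μ n : Measure ℝ) x) atTop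
      (𝓝 (cdf (ν : Measure ℝ) x))) : Tendsto μ atTop (𝓝 ν) := by
  have hd : Dense ({c}ᶜ : Set ℝ) := dense_compl_singleton c
  refine (isPiSystem_Ioc_mem ({c}ᶜ : Set ℝ) {c}ᶜ).tendsto_probabilityMeasure_of_tendsto_of_mem
    ?_ ?_ ?_
  · rintro s ⟨a, _, b, _, _, rfl⟩
    exact measurableSet_Ioc
  · intro u hu x hx
    obtain ⟨ε, hε, hsub⟩ := Metric.isOpen_iff.1 hu x hx
    obtain ⟨a, ha, ha1, ha2⟩ := hd.exists_between (sub_lt_self x hε)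
    obtain ⟨b, hb, hb1, hb2⟩ := hd.exists_between (lt_add_of_pos_right x hε)
    refine ⟨Ioc a b, ⟨a, ha, b, hb, ha2.trans hb1, rfl⟩, Ioc_mem_nhds ha2 hb1,
      fun y hy => hsub ?_⟩
    rw [Real.ball_eq_Ioo]
    exact ⟨ha1.trans hy.1, hy.2.trans_lt hb2⟩
  · rintro s ⟨a, ha, b, hb, hab, rfl⟩
    have e : ∀ ρ : ProbabilityMeasure ℝ, ((ρ (Ioc a b) : NNReal) : ℝ) =
        cdf (ρ : Measure ℝ) b - cdf (ρ : Measure ℝ) a := fun ρ => by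
      rw [cdf_eq_real, cdf_eq_real, ← measureReal_sdiff (Iic_subset_Iic.2 hab.le) measurableSet_Iic,
        Iic_sdiff_Iic]
      rfl
    rw [← NNReal.tendsto_coe]
    simp only [e]
    exact (h b hb).sub (h a ha)

/-! ### Integrals of κ(y)/y over a moving window. -/

section primitive

variable {κ : ℝ → ℝ} {d : ℝ}

lemma div_antitoneOn (hκ : AntitoneOn κ (Ioi 0)) (h0 : ∀ y, 0 < y → 0 < κ y) :
    AntitoneOn (fun y => κ y / y) (Ioi 0) := fun x (hx : 0 < x) y (hy : 0 < y) hxy =>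
  div_le_div₀ (h0 x hx).le (hκ hx hy hxy) hx hxy

lemma integral_window_eq (g : ℝ → ℝ) (x : ℝ) :
    ∫ y in x..(x + d), g y = ∫ s in (0 : ℝ)..d, g (x + s) := by
  rw [intervalIntegral.integral_comp_add_left, add_zero]

lemma integral_window_anti {g : ℝ → ℝ} (hg : AntitoneOn g (Ioi 0)) (hd : 0 ≤ d) :
    AntitoneOn (fun x => ∫ y in x..(x + d), g y) (Ioi 0) := by
  intro a (ha : 0 < a) b (hb : 0 < b) hab
  have i : ∀ x, 0 < x → IntervalIntegrable (fun s => g (x + s)) volume 0 d := fun x hx => by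
    have h1 := (intervalIntegrable_of_antitoneOn hg hx (le_add_of_nonneg_right hd)).comp_add_left x
    simpa using h1
  simp only [integral_window_eq]
  refine intervalIntegral.integral_mono_on hd (i b hb) (i a ha) fun s hs => ?_
  exact hg (add_pos_of_pos_of_nonneg ha hs.1) (add_pos_of_pos_of_nonneg hb hs.1)
    (add_le_add_left hab s)

lemma continuousAt_integral_window {g : ℝ → ℝ} (hg : AntitoneOn g (Ioi 0)) (hd : 0 ≤ d) {x : ℝ}
    (hx : 0 < x) : ContinuousAt (fun x => ∫ y in x..(x + d), g y) x := by
  have hc : 0 < x / 2 := half_pos hx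
  have h1 := tendsto_integral_of_antitoneOn hg hc (half_lt_self hx)
  have h2 := (tendsto_integral_of_antitoneOn hg hc ((half_lt_self hx).trans_le
    (le_add_of_nonneg_right hd))).comp ((continuous_add_const d).tendsto x)
  have e : ∀ z, x / 2 < z → ∫ y in z..(z + d), g y =
      (∫ y in (x / 2)..(z + d), g y) - ∫ y in (x / 2)..z, g y := fun z hz =>
    (intervalIntegral.integral_interval_sub_left
      (intervalIntegrable_of_antitoneOn hg hc (by linarith))
      (intervalIntegrable_of_antitoneOn hg hc hz.le)).symm
  have h3 := h2.sub h1
  rw [ContinuousAt, e x (half_lt_self hx)]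
  refine h3.congr' ?_
  filter_upwards [Ioi_mem_nhds (half_lt_self hx)] with z hz
  exact (e z hz).symm

lemma integral_window_const_div (c : ℝ) {x : ℝ} (hx : 0 < x) (hd : 0 ≤ d) :
    ∫ y in x..(x + d), c / y = c * Real.log ((x + d) / x) := by
  simp only [div_eq_mul_inv c]
  rw [intervalIntegral.integral_const_mul, integral_inv_of_pos hx (by linarith)]

/-- For x ≤ 1 the window lies below 1 + d, where κ is at least κ(1 + d). The logarithm diverges as x
↓ 0, so the limit law has no atom at 0. -/
lemma integral_window_lower (hκ : AntitoneOn κ (Ioi 0)) (h0 : ∀ y, 0 < y → 0 < κ y) (hd : 0 ≤ d)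
    {x : ℝ} (hx : 0 < x) (hx1 : x ≤ 1) :
    κ (1 + d) * Real.log ((x + d) / x) ≤ ∫ y in x..(x + d), κ y / y := by
  rw [← integral_window_const_div _ hx hd]
  have hxd : x ≤ x + d := le_add_of_nonneg_right hd
  refine intervalIntegral.integral_mono_on hxd ?_
    (intervalIntegrable_of_antitoneOn (div_antitoneOn hκ h0) hx hxd) fun y hy => ?_
  · refine ContinuousOn.intervalIntegrable fun y hy => ?_
    rw [uIcc_of_le hxd] at hy
    have : y ≠ 0 := (hx.trans_le hy.1).ne'
    exact ContinuousAt.continuousWithinAt (by fun_prop (disch := assumption))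
  · have hy0 : 0 < y := hx.trans_le hy.1
    have := hκ hy0 (show 0 < 1 + d by linarith) (by linarith [hy.2])
    gcongr

lemma integral_window_upper {g : ℝ → ℝ} (hg : AntitoneOn g (Ioi 0)) (hd : 0 ≤ d) {x : ℝ}
    (hx : 0 < x) : ∫ y in x..(x + d), g y ≤ d * g x := by
  have hxd : x ≤ x + d := le_add_of_nonneg_right hd
  calc ∫ y in x..(x + d), g y ≤ ∫ _ in x..(x + d), g x :=
        intervalIntegral.integral_mono_on hxd (intervalIntegrable_of_antitoneOn hg hx hxd) (by simp)
          fun y hy => hg hx (hx.trans_le hy.1) hy.1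
    _ = d * g x := by simp

lemma integral_window_nonneg {g : ℝ → ℝ} (hg : ∀ y, 0 < y → 0 < g y) (hd : 0 ≤ d) {x : ℝ}
    (hx : 0 < x) : 0 ≤ ∫ y in x..(x + d), g y :=
  intervalIntegral.integral_nonneg (le_add_of_nonneg_right hd)
    fun y hy => (hg y (hx.trans_le hy.1)).le

lemma tendsto_integral_window_zero (hκ : AntitoneOn κ (Ioi 0)) (h0 : ∀ y, 0 < y → 0 < κ y)
    (hd : 0 < d) : Tendsto (fun x => ∫ y in x..(x + d), κ y / y) (𝓝[>] 0) atTop := by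
  have h1 : Tendsto (fun x => 1 + d * x⁻¹) (𝓝[>] 0) atTop :=
    tendsto_atTop_add_const_left _ _ (tendsto_inv_nhdsGT_zero.const_mul_atTop hd)
  have h2 := (Real.tendsto_log_atTop.comp h1).const_mul_atTop (h0 (1 + d) (by linarith))
  refine tendsto_atTop_mono' _ ?_ h2
  filter_upwards [Ioo_mem_nhdsGT (zero_lt_one (α := ℝ))] with x hx
  have e : 1 + d * x⁻¹ = (x + d) / x := by
    have := hx.1.ne'
    field_simp
  simp only [Function.comp_apply, e]
  exact integral_window_lower hκ h0 hd.le hx.1 hx.2.le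

lemma tendsto_integral_window_atTop (hκ : AntitoneOn κ (Ioi 0)) (h0 : ∀ y, 0 < y → 0 < κ y)
    (hd : 0 ≤ d) : Tendsto (fun x => ∫ y in x..(x + d), κ y / y) atTop (𝓝 0) := by
  have h1 : Tendsto (fun x => d * κ 1 * x⁻¹) atTop (𝓝 0) := by
    simpa using (tendsto_inv_atTop_zero (𝕜 := ℝ)).const_mul (d * κ 1)
  refine squeeze_zero' ?_ ?_ h1
  · filter_upwards [eventually_gt_atTop 0] with x hx
    exact integral_window_nonneg (fun y hy => div_pos (h0 y hy) hy) hd hx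
  · filter_upwards [eventually_ge_atTop 1] with x hx
    have hx0 : 0 < x := by linarith
    refine (integral_window_upper (div_antitoneOn hκ h0) hd hx0).trans ?_
    have := hκ (mem_Ioi.2 zero_lt_one) hx0 hx
    rw [mul_assoc, div_eq_mul_inv]
    gcongr

end primitive

/-! ### The limit distribution function and its probability law. -/

section limitLaw

variable {lam ν γ t : ℝ}

lemma limitCDF_of_pos {x : ℝ} (hx : 0 < x) : limitCDF lam ν γ t x =
    Real.exp (-(lam * ∫ y in x..(x + t / lam), kappa lam ν γ y / y)) := if_pos hx

lemma limitCDF_of_nonpos (ht : 0 < t) {x : ℝ} (hx : x ≤ 0) : limitCDF lam ν γ t x = 0 := by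
  rw [limitCDF, if_neg hx.not_gt, if_neg fun h => ht.ne' h.2]

lemma limitCDF_nonneg (x : ℝ) : 0 ≤ limitCDF lam ν γ t x := by
  unfold limitCDF
  split_ifs <;> positivity

lemma monotone_limitCDF (hlam : 0 < lam) (hν : 1 < ν) (hν' : ν < 2) (hγ : 0 ≤ γ) (ht : 0 < t) :
    Monotone (limitCDF lam ν γ t) := by
  intro x y hxy
  rcases le_or_gt x 0 with hx | hx
  · rw [limitCDF_of_nonpos ht hx]
    exact limitCDF_nonneg y
  · have hy := hx.trans_le hxy
    rw [limitCDF_of_pos hx, limitCDF_of_pos hy]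
    have := integral_window_anti (kappa_div_antitoneOn hlam hν hν' hγ) (div_pos ht hlam).le hx hy hxy
    gcongr

/-- The delicate point is 0: the prescribed value 0 agrees with the right limit because the window
integral diverges there. -/
lemma continuousWithinAt_limitCDF (hlam : 0 < lam) (hν : 1 < ν) (hν' : ν < 2) (hγ : 0 ≤ γ)
    (ht : 0 < t) (x : ℝ) : ContinuousWithinAt (limitCDF lam ν γ t) (Ici x) x := by
  rcases lt_trichotomy x 0 with hx | rfl | hx
  · refine ContinuousAt.continuousWithinAt ((continuousAt_const (y := (0 : ℝ))).congr ?_)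
    filter_upwards [Iio_mem_nhds hx] with y hy
    exact (limitCDF_of_nonpos ht (le_of_lt hy)).symm
  · refine continuousWithinAt_Ioi_iff_Ici.1 ?_
    rw [ContinuousWithinAt, limitCDF_of_nonpos ht le_rfl]
    have h1 := tendsto_integral_window_zero (kappa_antitoneOn hlam hν hν' hγ)
      (fun y hy => kappa_pos hlam hν hν' hγ hy) (div_pos ht hlam)
    refine (Real.tendsto_exp_neg_atTop_nhds_zero.comp (h1.const_mul_atTop hlam)).congr' ?_
    filter_upwards [self_mem_nhdsWithin] with y hy
    exact (limitCDF_of_pos hy).symm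
  · refine ContinuousAt.continuousWithinAt ?_
    have h1 := continuousAt_integral_window (kappa_div_antitoneOn hlam hν hν' hγ)
      (div_pos ht hlam).le hx
    refine (ContinuousAt.rexp (h1.const_mul lam).neg).congr ?_
    filter_upwards [Ioi_mem_nhds hx] with y hy
    exact (limitCDF_of_pos hy).symm

/-- For t = 0 the window is empty and the law is the Dirac mass at 0. For t > 0 a Stieltjes measure
is used, and its total mass is 1 because the window integral tends to 0 at infinity. -/
lemma exists_limitLaw (hlam : 0 < lam) (hν : 1 < ν) (hν' : ν < 2) (hγ : 0 ≤ γ) (ht : 0 ≤ t) :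
    ∃ Z : ProbabilityMeasure ℝ, ∀ x, cdf (Z : Measure ℝ) x = limitCDF lam ν γ t x := by
  rcases ht.eq_or_lt with rfl | ht
  · refine ⟨⟨Measure.dirac 0, inferInstance⟩, fun x => ?_⟩
    rw [ProbabilityMeasure.coe_mk, cdf_eq_real, measureReal_def,
      Measure.dirac_apply' _ measurableSet_Iic]
    rcases lt_trichotomy x 0 with hx | rfl | hx
    · rw [indicator_of_notMem (show (0 : ℝ) ∉ Iic x from hx.not_ge)]
      simp [limitCDF, hx.not_gt, hx.ne]
    · simp [limitCDF]
    · simp [limitCDF, hx, hx.le]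
  · let F : StieltjesFunction ℝ := ⟨limitCDF lam ν γ t, monotone_limitCDF hlam hν hν' hγ ht,
      continuousWithinAt_limitCDF hlam hν hν' hγ ht⟩
    have h0 : Tendsto F atBot (𝓝 0) := by
      refine tendsto_const_nhds.congr' ?_
      filter_upwards [eventually_le_atBot 0] with x hx
      exact (limitCDF_of_nonpos ht hx).symm
    have h1 : Tendsto F atTop (𝓝 1) := by
      have h2 := tendsto_integral_window_atTop (kappa_antitoneOn hlam hν hν' hγ)
        (fun y hy => kappa_pos hlam hν hν' hγ hy) (div_pos ht hlam).le
      have h3 := (Real.continuous_exp.tendsto _).comp (h2.const_mul lam).neg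
      rw [mul_zero, neg_zero, Real.exp_zero] at h3
      refine h3.congr' ?_
      filter_upwards [eventually_gt_atTop 0] with x hx
      exact (limitCDF_of_pos hx).symm
    refine ⟨⟨F.measure, ⟨by rw [F.measure_univ h0 h1, sub_zero, ENNReal.ofReal_one]⟩⟩, fun x => ?_⟩
    rw [ProbabilityMeasure.coe_mk, cdf_measure_stieltjesFunction F h0 h1]

lemma limitCDF_of_kappa_const (hlam : 0 < lam) {k : ℝ} (hk : ∀ y, 0 < y → kappa lam ν γ y = k)
    (ht : 0 ≤ t) {x : ℝ} (hx : 0 < x) :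
    limitCDF lam ν γ t x = (1 + t / (x * lam)) ^ (-(lam * k)) := by
  have hd : 0 ≤ t / lam := by positivity
  have e : ∫ y in x..(x + t / lam), kappa lam ν γ y / y = ∫ y in x..(x + t / lam), k / y := by
    refine intervalIntegral.integral_congr fun y hy => ?_
    rw [uIcc_of_le (le_add_of_nonneg_right hd)] at hy
    simp only [hk y (hx.trans_le hy.1)]
  have e2 : (x + t / lam) / x = 1 + t / (x * lam) := by field_simp
  rw [limitCDF_of_pos hx, e, integral_window_const_div _ hx hd, e2, Real.rpow_def_of_pos
    (by positivity)]
  congr 1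
  ring

lemma tendsto_limitCDF (hlam : 0 < lam) (hν : 1 < ν) (hν' : ν < 2) (hγ : 0 < γ) {x : ℝ}
    (hx : 0 < x) : Tendsto (fun t => limitCDF lam ν γ t x) atTop
      (𝓝 (Real.exp (-(lam * ∫ y in Ioi x, kappa lam ν γ y / y)))) := by
  simp only [limitCDF_of_pos hx]
  have h1 : Tendsto (fun t => x + t / lam) atTop atTop :=
    tendsto_atTop_add_const_left _ _ (tendsto_id.atTop_div_const hlam)
  exact (Real.continuous_exp.tendsto _).comp (((intervalIntegral_tendsto_integral_Ioi x
    (integrableOn_kappa_div hlam hν hν' hγ hx) h1).const_mul lam).neg)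

end limitLaw

section convergence

variable {Ω : Type*} [MeasurableSpace Ω] {P : Measure Ω} [IsProbabilityMeasure P]
  {A : ℕ → ℕ → Ω → ℝ} {V : ℕ → Ω → ℝ} {ν γ lam : ℝ} {r : ℕ → ℝ}

lemma HeavyTraffic.tendstoInDistribution (h : HeavyTraffic P A V ν γ lam r) {t : ℝ} (ht : 0 ≤ t)
    {Z : ProbabilityMeasure ℝ} (hZ : ∀ x, cdf (Z : Measure ℝ) x = limitCDF lam ν γ t x) :
    TendstoInDistribution (fun (n : ℕ) ω => R (A n) V ⌊(n : ℝ) * t⌋₊ ω / n)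
      atTop (id : ℝ → ℝ) (fun _ => P) (Z : Measure ℝ) where
  forall_aemeasurable n := ((h.tandem n).aemeasurable_R _).div_const _
  tendsto := by
    refine tendsto_of_tendsto_cdf 0 fun x hx => ?_
    have e : ∀ n : ℕ, cdf (P.map fun ω => R (A n) V ⌊(n : ℝ) * t⌋₊ ω / n) x =
        P.real {ω | R (A n) V ⌊(n : ℝ) * t⌋₊ ω / n ≤ x} := fun n => by
      have hm := ((h.tandem n).aemeasurable_R ⌊(n : ℝ) * t⌋₊).div_const (n : ℝ)
      have := Measure.isProbabilityMeasure_map hm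
      rw [cdf_eq_real, map_measureReal_apply_of_aemeasurable hm measurableSet_Iic]
      rfl
    simp only [ProbabilityMeasure.coe_mk, Measure.map_id, e, hZ]
    rcases hx.lt_or_gt with hx | hx
    · have e2 : ∀ n : ℕ, P.real {ω | R (A n) V ⌊(n : ℝ) * t⌋₊ ω / n ≤ x} = 0 := fun n => by
        rw [measureReal_def, ENNReal.toReal_eq_zero_iff]
        left
        refine measure_eq_zero_iff_ae_notMem.2 ?_
        filter_upwards [(h.tandem n).ae_R_nonneg ⌊(n : ℝ) * t⌋₊] with ω hω hcon
        exact (hcon.trans_lt hx).not_ge (div_nonneg hω n.cast_nonneg)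
      simp only [e2]
      rw [limitCDF, if_neg hx.not_gt, if_neg fun h => hx.ne h.1]
      exact tendsto_const_nhds
    · rw [limitCDF_of_pos hx]
      refine (h.tendsto_measureReal_R ht hx).congr' ?_
      filter_upwards [eventually_gt_atTop 0] with n hn
      have hn' : (0 : ℝ) < n := Nat.cast_pos.2 hn
      simp only [div_le_iff₀' hn']

end convergence

end TandemQueue

/-! ### Heavy traffic limit and interchange of limits. -/

theorem theorem2p2
    {Ω : Type*} [MeasurableSpace Ω] (P : Measure Ω) [IsProbabilityMeasure P]
    (ν γ lam : ℝ) (hν : 1 < ν) (hν' : ν < 2) (hγ : 0 ≤ γ)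
    -- the common service times of all systems
    (V : ℕ → Ω → ℝ)
    (hV_nonneg : ∀ i, ∀ᵐ ω ∂P, 0 ≤ V i ω)
    (hV_indep : iIndepFun V P)
    (hV_ident : ∀ i, IdentDistrib (V i) (V 0) P P)
    (hV_pos : 0 < ∫ ω, V 0 ω ∂P)
    (hV_tail : TandemQueue.RegularlyVarying (TandemQueue.tail P (V 0)) (-ν))
    -- the Poisson arrivals of the systems, `A n` being the interarrival times of the `n`-th one
    (A : ℕ → ℕ → Ω → ℝ) (lamn : ℕ → ℝ)
    (hlamn_pos : ∀ n, 0 < lamn n)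
    (hA : ∀ n, TandemQueue.IsPoissonArrivals P (A n) (lamn n))
    (hAV : ∀ n, IndepFun (fun ω j => V j ω) (fun ω j => A n j ω) P)
    -- the heavy traffic assumptions
    (hlam : lam = 1 / ∫ ω, V 0 ω ∂P)
    (hlamn_mono : Monotone lamn)
    (hlamn_lim : Tendsto lamn atTop (𝓝 lam))
    (hrate : Tendsto
      (fun n : ℕ => (1 - lamn n * ∫ ω, V 0 ω ∂P) / (n * TandemQueue.tail P (V 0) n))
      atTop (𝓝 γ)) :
    -- `κ(y)` is the unique positive solution of its equation
    (∀ y : ℝ, 0 < y → ∀ k : ℝ,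
      (0 < k ∧ TandemQueue.KappaEq lam ν γ y k) ↔ k = TandemQueue.kappa lam ν γ y) ∧
    (∀ t x : ℝ, 0 ≤ t → 0 < x → IntervalIntegrable
      (fun y => TandemQueue.kappa lam ν γ y / y) volume x (x + t / lam)) ∧
    -- `Z t` is the law of `Z_t`
    ∃ Z : ℝ → ProbabilityMeasure ℝ,
      (∀ t : ℝ, 0 ≤ t → ∀ x : ℝ,
        cdf (Z t : Measure ℝ) x = TandemQueue.limitCDF lam ν γ t x) ∧
      -- convergence in distribution of `R^{(n)}_{[nt]} / n` to `Z_t`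
      (∀ t : ℝ, 0 ≤ t →
        TendstoInDistribution (fun (n : ℕ) ω => TandemQueue.R (A n) V ⌊(n : ℝ) * t⌋₊ ω / n)
          atTop (id : ℝ → ℝ) (fun _ => P) (Z t : Measure ℝ)) ∧
      -- the case `γ = 0`
      (γ = 0 → ∃ k : ℝ, (∀ y : ℝ, 0 < y → TandemQueue.kappa lam ν γ y = k) ∧
        ∀ t x : ℝ, 0 ≤ t → 0 < x →
          cdf (Z t : Measure ℝ) x = (1 + t / (x * lam)) ^ (-(lam * k))) ∧
      -- the case `γ > 0`: interchange of the limits `t → ∞` and `n → ∞`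
      (0 < γ → (∀ᶠ n in atTop, lamn n * ∫ ω, V 0 ω ∂P < 1) ∧
        ∀ x : ℝ, 0 < x →
          IntegrableOn (fun y => TandemQueue.kappa lam ν γ y / y) (Ioi x) ∧
          Tendsto (fun t => cdf (Z t : Measure ℝ) x) atTop
            (𝓝 (Real.exp (-(lam * ∫ y in Ioi x, TandemQueue.kappa lam ν γ y / y)))) ∧
          -- the scaled steady-state distribution of the `n`-th system
          (∀ n : ℕ, 1 ≤ n → lamn n * ∫ ω, V 0 ω ∂P < 1 →
            IntegrableOn (fun s : ℝ => n * (1 - TandemQueue.maxCDF P (A n) V (n * s))) (Ioi x) ∧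
            Tendsto (fun k : ℕ => P.real {ω | TandemQueue.R (A n) V k ω / n ≤ x}) atTop
              (𝓝 (TandemQueue.maxCDF P (A n) V (n * x) * Real.exp (-(lamn n *
                ∫ s in Ioi x, n * (1 - TandemQueue.maxCDF P (A n) V (n * s))))))) ∧
          Tendsto (fun n : ℕ => TandemQueue.maxCDF P (A n) V (n * x) * Real.exp (-(lamn n *
              ∫ s in Ioi x, n * (1 - TandemQueue.maxCDF P (A n) V (n * s))))) atTop
            (𝓝 (Real.exp (-(lam * ∫ y in Ioi x, TandemQueue.kappa lam ν γ y / y))))) := by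
  have hlam_pos : 0 < lam := by rw [hlam]; positivity
  have h : TandemQueue.HeavyTraffic P A V ν γ lam lamn :=
    { one_lt := hν
      lt_two := hν'
      nonneg := hγ
      lam_pos := hlam_pos
      tail_reg := hV_tail
      tandem := fun n =>
        { rate_pos := hlamn_pos n
          arrivals := hA n
          ident := hV_ident
          indep := hV_indep
          indep_arrivals := hAV n
          nonneg := hV_nonneg
          mean_pos := hV_pos
          load_le_one := by
            -- A nondecreasing sequence stays below its limit λ = 1/E V, so every system has load at
            -- most 1.
            have h1 := hlamn_mono.ge_of_tendsto hlamn_lim n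
            rwa [hlam, le_div_iff₀ hV_pos] at h1 }
      rate := hlamn_lim
      load := hrate }
  have hex : ∀ t : ℝ, ∃ Z : ProbabilityMeasure ℝ, 0 ≤ t →
      ∀ x, cdf (Z : Measure ℝ) x = TandemQueue.limitCDF lam ν γ t x := fun t => by
    by_cases ht : 0 ≤ t
    · obtain ⟨Z, hZ⟩ := TandemQueue.exists_limitLaw hlam_pos hν hν' hγ ht
      exact ⟨Z, fun _ => hZ⟩
    · exact ⟨⟨Measure.dirac 0, inferInstance⟩, fun h => absurd h ht⟩
  choose Z hZ using hex
  refine ⟨fun y hy k => TandemQueue.pos_and_kappaEq_iff hlam_pos hν hν' hγ hy, fun t x ht hx =>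
    TandemQueue.intervalIntegrable_of_antitoneOn
      (TandemQueue.kappa_div_antitoneOn hlam_pos hν hν' hγ) hx
      (le_add_of_nonneg_right (div_nonneg ht hlam_pos.le)),
    Z, hZ, fun t ht => h.tendstoInDistribution ht (hZ t ht), ?_, ?_⟩
  · rintro rfl
    refine ⟨TandemQueue.kappa lam ν 0 1, fun y _ => TandemQueue.kappa_zero_eq, fun t x ht hx => ?_⟩
    rw [hZ t ht]
    exact TandemQueue.limitCDF_of_kappa_const hlam_pos (fun y _ => TandemQueue.kappa_zero_eq) ht hx
  · intro hγ'
    refine ⟨h.eventually_load_lt_one hγ', fun x hx =>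
      ⟨TandemQueue.integrableOn_kappa_div hlam_pos hν hν' hγ' hx, ?_,
        fun n hn hload => h.tendsto_steadyState hn hload hx, h.tendsto_steadyState_limit hγ' hx⟩⟩
    refine (TandemQueue.tendsto_limitCDF hlam_pos hν hν' hγ' hx).congr' ?_
    filter_upwards [eventually_ge_atTop 0] with t ht
    exact (hZ t ht x).symm
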